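/- **Setting.** Fix $T\in\mathbb N$, non-empty finite sets $\mathcal X$ (states) and $\Gamma$ (actions) with discrete topologies, and $\mathcal Z=[0,1]$ with the uniform distribution $\nu$. $\mathcal P(\mathcal X)$ carries the metric $\mathrm{dist}(m,m')=\frac12\sum_{x}|m(x)-m'(x)|$ and its Borel $\sigma$-algebra. The data are Borel measurable functions $\Psi(t,\cdot):\mathcal X\times\mathcal P(\mathcal X)\times\Gamma\times\mathcal Z\to\mathcal X$, $f(t,\cdot):\mathcal X\times\mathcal P(\mathcal X)\times\Gamma\to\mathbb R$, $0\le t\le T-1$, and $F:\mathcal X\times\mathcal P(\mathcal X)\to\mathbb R$. For a path $x$ write $x^{(t)}=(x_0,\dots,x_t)$. Let $\mathcal R$ be the finite set of restricted strategies $\varphi:\{0,\dots,T-1\}\times\mathcal X\to\Gamma$, and $\widehat{\mathcal R}$ the set of progressive strategies $\varphi=(\varphi(t,\cdot))_{t=0}^{T-1}$, with $\varphi(t,\cdot):\mathcal X^{t+1}\times\mathcal P(\mathcal X)^{t+1}\to\Gamma$ Borel; $\mathcal R\subset\widehat{\mathcal R}$ via $\varphi(t,x^{(t)},m^{(t)})=\varphi(t,x_t)$.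 **Assumptions on the data.** - (A1) $\nu\{z:\Psi(t,x,m,u,z)=y\}>0$ for all $t,x,y,m,u$. - (A2) There is a non-decreasing $w:[0,\infty)\to[0,1]$ with $w(s)\to0$ as $s\to0^+$ such that $\nu\{z:\Psi(t,x,m,u,z)\ne\Psi(t,x,m',u,z)\}\le w(\mathrm{dist}(m,m'))$ for all $t,x,u,m,m'$; and for every $t$ and every probability measure $\tau$ on $\mathcal X\times\mathcal P(\mathcal X)\times\Gamma$, $\Psi(t,\cdot)$ is continuous at $\tau\otimes\nu$-almost every point. - (A3) $f$ and $F$ are Lipschitz continuous with a common constant $L$ (finite sets carry the discrete metric). **Mean field game.** Let $m_0\in\mathcal P(\mathcal X)$, let $\rho$ be a probability measure on $\mathcal R\times\mathcal P(\mathcal X)^{T+1}$, and $w:\widehat{\mathcal R}\to\widehat{\mathcal R}$ any map. A realization of $(m_0,\rho,w)$ consists, on some probability space, of random variables $\Phi$, $\mu=(\mu_t)_{t=0}^T$, $(\xi_t)_{t=1}^T$, $(X_t)_{t=0}^T$ such that $X_0\sim m_0$, $(\Phi,\mu)\sim\rho$, the $\xi_t$ are i.i.d. with law $\nu$, the variables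 $(\xi_t)_t$, $X_0$, $(\Phi,\mu)$ are independent, and almost surely $X_{t+1}=\Psi(t,X_t,\mu_t,w(\Phi)(t,X^{(t)},\mu^{(t)}),\xi_{t+1})$ for $0\le t\le T-1$. Its cost, which depends only on $(m_0,\rho,w)$, is $$J(m_0,\rho,w)=\mathbb E\Big[\sum_{t=0}^{T-1}f\big(t,X_t,\mu_t,w(\Phi)(t,X^{(t)},\mu^{(t)})\big)+F(X_T,\mu_T)\Big].$$ $\rho$ is a *correlated solution of the mean field game starting at $m_0$* if $J(m_0,\rho,\mathrm{id})\le J(m_0,\rho,w)$ for every $w$, and if for every realization of $(m_0,\rho,\mathrm{id})$ and every $t\in\{0,\dots,T\}$, $\mu_t(\cdot)=\mathbb P(X_t\in\cdot\mid\sigma(\mu))$ almost surely. **Conditions on $\rho$.** Let $(\Phi,\mu)\sim\rho$. - (R1) For each $\varphi\in\mathcal R$ with $\mathbb P(\Phi=\varphi)>0$ there is a finite set $\mathcal P_\varphi\subset\mathcal P(\mathcal X)^{T+1}$ with $\mathbb P(\mu\in\mathcal P_\varphi\mid\Phi=\varphi)=1$ and $\mathbb P(\mu=m\mid\Phi=\varphi)>0$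 for all $m\in\mathcal P_\varphi$. - (R2) There are Borel functions $\alpha_t:[0,1]\times\mathcal P(\mathcal X)^{t+2}\to\Gamma^{\mathcal X}$, $0\le t\le T-1$, such that on a suitable probability space $(\Phi,\mu)$ can be realized together with a random variable $Z\sim\nu$ independent of $\mu$ satisfying $\Phi(t,\cdot)=\alpha_t(Z,\mu^{(t+1)})$ for all $t$. **$N$-player game** ($N\ge2$). Let $\mathcal M_{N-1}=\{m\in\mathcal P(\mathcal X): (N-1)m(x)\in\{0,\dots,N-1\}\ \forall x\}$, let $\widehat{\mathcal E}_{t,N}$ be the finite set of functions $\mathcal X^{t+1}\times\mathcal M_{N-1}^{t+1}\to\Gamma$, and $\widehat{\mathcal R}_N=\prod_{t=0}^{T-1}\widehat{\mathcal E}_{t,N}\supset\mathcal R$. Let $\mathfrak m^N\in\mathcal P(\mathcal X^N)$, $\gamma^N\in\mathcal P(\widehat{\mathcal R}_N^N)$, with $i$-th marginal $\gamma^N_i$. A strategy modification for player $i$ is a law on $\widehat{\mathcal R}_N\times\widehat{\mathcal R}_N$ of the form $\widetilde\gamma(d\varphi,d\psi)=\beta_0(\varphi,d\psi_0)\cdots\beta_{T-1}(\varphi,d\psi_{T-1})\,\gamma^N_i(d\varphi)$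 with probability kernels $\beta_t$ from $\widehat{\mathcal R}_N$ to $\widehat{\mathcal E}_{t,N}$; following the suggestion is $\iota_{\gamma^N_i}(d\varphi,d\psi)=\delta_\varphi(d\psi)\gamma^N_i(d\varphi)$. A realization of $(\mathfrak m^N,\gamma^N,\widetilde\gamma)$ for player $i$ consists of random variables $X^j_t$, $\Phi_j$, $\xi^j_t$ ($1\le j\le N$), $\vartheta_t$, $\widetilde\Phi$ such that $(X^j_0)_j\sim\mathfrak m^N$, $(\Phi_j)_j\sim\gamma^N$; the $\xi^j_t$ ($1\le t\le T$) are i.i.d. with law $\nu$, and so are the $\vartheta_t$ ($0\le t\le T-1$); the families $(\xi^j_t)$, $(X_0^j)$, $(\vartheta_t)$, $(\Phi_j)$ are independent; $(\Phi_i,\widetilde\Phi)\sim\widetilde\gamma$ and each $\widetilde\Phi(t,\cdot)$ is measurable with respect to the completion of $\sigma(\Phi_i,\vartheta_t)$; and almost surely, with $\mu^j_t=\frac1{N-1}\sum_{k\ne j}\delta_{X^k_t}$, $$X^i_{t+1}=\Psi\big(t,X^i_t,\mu^i_t,\widetilde\Phi(t,X^{i,(t)},\mu^{i,(t)}),\xi^i_{t+1}\big),\qquad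 X^j_{t+1}=\Psi\big(t,X^j_t,\mu^j_t,\Phi_j(t,X^{j,(t)},\mu^{j,(t)}),\xi^j_{t+1}\big)\ (j\ne i).$$ The cost of player $i$, which depends only on $(\mathfrak m^N,\gamma^N,\widetilde\gamma)$, is $$J_i^N(\mathfrak m^N,\gamma^N,\widetilde\gamma)=\mathbb E\Big[\sum_{t=0}^{T-1}f\big(t,X^i_t,\mu^i_t,\widetilde\Phi(t,X^{i,(t)},\mu^{i,(t)})\big)+F(X^i_T,\mu^i_T)\Big].$$ $\gamma^N$ is an *$\varepsilon$-correlated equilibrium* with initial distribution $\mathfrak m^N$ if $J^N_i(\mathfrak m^N,\gamma^N,\iota_{\gamma^N_i})\le J^N_i(\mathfrak m^N,\gamma^N,\widetilde\gamma)+\varepsilon$ for every player $i$ and every strategy modification $\widetilde\gamma$ for player $i$. **Theorem.** Assume (A1)–(A3). Let $m_0\in\mathcal P(\mathcal X)$ and let $\rho$ be a correlated solution of the mean field game starting at $m_0$ that satisfies (R1) and (R2). Write $\rho(d\varphi,dm)=\rho_1(d\varphi\mid m)\rho_2(dm)$, where $\rho_2$ is the law of the flow of measures and $\rho_1$ the regular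 conditional law of the suggestion given the flow, and define $\gamma^N\in\mathcal P(\mathcal R^N)\subset\mathcal P(\widehat{\mathcal R}_N^N)$ by $$\gamma^N(C_1\times\dots\times C_N)=\int_{\mathcal P(\mathcal X)^{T+1}}\prod_{j=1}^N\rho_1(C_j\mid m)\,\rho_2(dm).$$ Then there is a sequence $(\varepsilon_N)\subset[0,\infty)$ with $\lim_{N\to\infty}\varepsilon_N=0$ such that, for all $N\ge2$, $\gamma^N$ is an $\varepsilon_N$-correlated equilibrium of the $N$-player game with initial distribution $m_0^{\otimes N}$. -/

import Mathlib

open MeasureTheory ProbabilityTheory Filter Topology unitInterval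
open scoped ENNReal

universe u

namespace CorrelatedMFG

/-! ### Spaces of measures, paths, strategies -/

/-- Probability measures on the finite set `𝒳`, identified with their mass functions.  The subspace
topology from `𝒳 → ℝ` is the topology of weak convergence; the σ-algebra is its Borel σ-algebra. -/
abbrev PM (𝒳 : Type u) [Fintype 𝒳] : Type u := stdSimplex ℝ 𝒳

/-- The measure on `𝒳` with mass function `m`. -/
noncomputable def PM.toMeasure {𝒳 : Type u} [Fintype 𝒳] [MeasurableSpace 𝒳] (m : PM 𝒳) :
    Measure 𝒳 :=
  ∑ x, ENNReal.ofReal (m.1 x) • Measure.dirac x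

/-- `dist(m, m') = (1/2) ∑ₓ |m(x) - m'(x)|`. -/
noncomputable def tvDist {𝒳 : Type u} [Fintype 𝒳] (m m' : PM 𝒳) : ℝ :=
  (1 / 2) * ∑ x, |m.1 x - m'.1 x|

open Classical in
/-- The discrete metric. -/
noncomputable def discDist {α : Type*} (a b : α) : ℝ := if a = b then 0 else 1

/-- The initial piece `(x₀, …, x_k)` of a path `(x₀, …, x_T)`. -/
def upTo {α : Type*} {T : ℕ} (x : Fin (T + 1) → α) (k : ℕ) (hk : k ≤ T) : Fin (k + 1) → α :=
  fun s => x (Fin.castLE (Nat.succ_le_succ hk) s)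

/-- Flows of measures `(m₀, …, m_T)`. -/
abbrev Flow (T : ℕ) (𝒳 : Type u) [Fintype 𝒳] : Type u := Fin (T + 1) → PM 𝒳

/-- The restricted (Markov) strategies `φ : {0, …, T-1} × 𝒳 → Γ`. -/
abbrev Restricted (T : ℕ) (𝒳 Γ : Type u) : Type u := Fin T → 𝒳 → Γ

/-- Progressive feedback strategies: at time `t` the action is a Borel function of the states
`(x₀, …, x_t)` and the measures `(m₀, …, m_t)`. -/
def Progressive (T : ℕ) (𝒳 Γ : Type u) [Fintype 𝒳] [MeasurableSpace 𝒳] [MeasurableSpace Γ] :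
    Type u :=
  {φ : (t : Fin T) → (Fin (t + 1) → 𝒳) × (Fin (t + 1) → PM 𝒳) → Γ // ∀ t, Measurable (φ t)}

/-- The inclusion of restricted strategies into progressive ones. -/
def Restricted.toProgressive {T : ℕ} {𝒳 Γ : Type u} [Fintype 𝒳] [MeasurableSpace 𝒳]
    [DiscreteMeasurableSpace 𝒳] [MeasurableSpace Γ] (φ : Restricted T 𝒳 Γ) :
    Progressive T 𝒳 Γ :=
  ⟨fun t h => φ t (h.1 (Fin.last t)), fun t =>
    (Measurable.of_discrete (f := φ t)).comp ((measurable_pi_apply _).comp measurable_fst)⟩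

/-! ### The data of the game -/

/-- System function, running costs and terminal costs (time horizon `T`, states `𝒳`, actions `Γ`,
noise states `[0,1]`). -/
structure GameData (T : ℕ) (𝒳 Γ : Type u) [Fintype 𝒳] where
  /-- the one-step system function -/
  Ψ : Fin T → 𝒳 → PM 𝒳 → Γ → I → 𝒳
  /-- the running costs -/
  f : Fin T → 𝒳 → PM 𝒳 → Γ → ℝ
  /-- the terminal costs -/
  F : 𝒳 → PM 𝒳 → ℝ

section Assumptions

variable {T : ℕ} {𝒳 Γ : Type u} [Fintype 𝒳]

/-- Non-degeneracy of the dynamics. -/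
def GameData.NonDegenerate (G : GameData T 𝒳 Γ) : Prop :=
  ∀ (t : Fin T) (m : PM 𝒳) (x y : 𝒳) (u : Γ), 0 < (volume : Measure I) {z | G.Ψ t x m u z = y}

/-- Continuity of the dynamics in the measure argument, with a common modulus `w`. -/
def GameData.HasModulus (G : GameData T 𝒳 Γ) : Prop :=
  ∃ w : ℝ → ℝ, MonotoneOn w (Set.Ici 0) ∧ (∀ s, 0 ≤ s → w s ∈ Set.Icc (0 : ℝ) 1) ∧
    Tendsto w (𝓝[>] 0) (𝓝 0) ∧
    ∀ (t : Fin T) (x : 𝒳) (u : Γ) (m m' : PM 𝒳),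
      (volume : Measure I) {z | G.Ψ t x m u z ≠ G.Ψ t x m' u z} ≤ ENNReal.ofReal (w (tvDist m m'))

/-- For all `t` and all probability measures `τ` on `𝒳 × 𝒫(𝒳) × Γ`, the function `Ψ(t, ·)` is
continuous at `τ ⊗ ν`-almost every point. -/
def GameData.AEContinuous [TopologicalSpace 𝒳] [MeasurableSpace 𝒳] [TopologicalSpace Γ]
    [MeasurableSpace Γ] (G : GameData T 𝒳 Γ) : Prop :=
  ∀ (t : Fin T) (τ : Measure (𝒳 × PM 𝒳 × Γ)), IsProbabilityMeasure τ →
    ∀ᵐ p ∂(τ.prod (volume : Measure I)),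
      ContinuousAt (fun q : (𝒳 × PM 𝒳 × Γ) × I => G.Ψ t q.1.1 q.1.2.1 q.1.2.2 q.2) p

/-- The running and terminal costs are Lipschitz continuous with a common constant, for the sum of
the discrete metrics on the finite sets and `dist` on `𝒫(𝒳)`. -/
def GameData.LipschitzCosts (G : GameData T 𝒳 Γ) : Prop :=
  ∃ L : ℝ,
    (∀ (t t' : Fin T) (x x' : 𝒳) (m m' : PM 𝒳) (u u' : Γ),
      |G.f t x m u - G.f t' x' m' u'| ≤
        L * (discDist t t' + discDist x x' + tvDist m m' + discDist u u')) ∧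
    (∀ (x x' : 𝒳) (m m' : PM 𝒳),
      |G.F x m - G.F x' m'| ≤ L * (discDist x x' + tvDist m m'))

end Assumptions

/-! ### The mean field game -/

section MeanField

variable {T : ℕ} {𝒳 Γ : Type u} [Fintype 𝒳] [MeasurableSpace 𝒳] [DiscreteMeasurableSpace 𝒳]
  [MeasurableSpace Γ]

/-- A realization of `(m₀, ρ, w)`, for an initial law `m₀`, a correlated suggestion `ρ` (a law on
restricted strategies and flows of measures) and a strategy modification `w`.  The noise
variable `ξ t` enters the step from time `t` to time `t + 1`. -/
structure MFGRealization (G : GameData T 𝒳 Γ) (m₀ : PM 𝒳)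
    (ρ : Measure (Restricted T 𝒳 Γ × Flow T 𝒳)) (w : Progressive T 𝒳 Γ → Progressive T 𝒳 Γ)
    {Ω : Type u} [MeasurableSpace Ω] (P : Measure Ω) where
  /-- the state process -/
  X : Fin (T + 1) → Ω → 𝒳
  /-- the suggestion -/
  Φ : Ω → Restricted T 𝒳 Γ
  /-- the random flow of measures -/
  μ : Ω → Flow T 𝒳
  /-- the idiosyncratic noise -/
  ξ : Fin T → Ω → I
  measurable_X : ∀ t, Measurable (X t)
  measurable_Φ : Measurable Φ
  measurable_μ : Measurable μ
  measurable_ξ : ∀ t, Measurable (ξ t)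
  law_X_zero : P.map (X 0) = m₀.toMeasure
  law_suggestion : P.map (fun ω => (Φ ω, μ ω)) = ρ
  law_ξ : ∀ t, P.map (ξ t) = volume
  iIndepFun_ξ : iIndepFun ξ P
  /-- `ξ`, `X₀` and `(Φ, μ)` are independent: first `ξ` of the two others jointly … -/
  indep_ξ : IndepFun (fun ω t => ξ t ω) (fun ω => (X 0 ω, (Φ ω, μ ω))) P
  /-- … and then `X₀` of `(Φ, μ)`. -/
  indep_X_zero : IndepFun (X 0) (fun ω => (Φ ω, μ ω)) P
  dynamics : ∀ t : Fin T, ∀ᵐ ω ∂P,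
    X t.succ ω = G.Ψ t (X t.castSucc ω) (μ ω t.castSucc)
      ((w (Φ ω).toProgressive).1 t
        (upTo (fun s => X s ω) t t.isLt.le, upTo (μ ω) t t.isLt.le)) (ξ t ω)

/-- The expected costs of the representative player. -/
noncomputable def MFGRealization.cost {G : GameData T 𝒳 Γ} {m₀ : PM 𝒳}
    {ρ : Measure (Restricted T 𝒳 Γ × Flow T 𝒳)} {w : Progressive T 𝒳 Γ → Progressive T 𝒳 Γ}
    {Ω : Type u} [MeasurableSpace Ω] {P : Measure Ω} (R : MFGRealization G m₀ ρ w P) : ℝ :=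
  ∫ ω, ((∑ t : Fin T, G.f t (R.X t.castSucc ω) (R.μ ω t.castSucc)
      ((w (R.Φ ω).toProgressive).1 t
        (upTo (fun s => R.X s ω) t t.isLt.le, upTo (R.μ ω) t t.isLt.le)))
    + G.F (R.X (Fin.last T) ω) (R.μ ω (Fin.last T))) ∂P

/-- Optimality: following the suggestion (`w = id`) costs at most as much as any modification.
The costs depend on the realization only through `(m₀, ρ, w)`, so `J(m₀, ρ, id) ≤ J(m₀, ρ, w)` is
stated for arbitrary realizations. -/
def MFGOptimality (G : GameData T 𝒳 Γ) (m₀ : PM 𝒳)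
    (ρ : Measure (Restricted T 𝒳 Γ × Flow T 𝒳)) : Prop :=
  ∀ w : Progressive T 𝒳 Γ → Progressive T 𝒳 Γ,
    ∀ {Ω Ω' : Type u} [MeasurableSpace Ω] [MeasurableSpace Ω'] (P : Measure Ω) (P' : Measure Ω')
      [IsProbabilityMeasure P] [IsProbabilityMeasure P']
      (R : MFGRealization G m₀ ρ id P) (R' : MFGRealization G m₀ ρ w P'), R.cost ≤ R'.cost

/-- Consistency: `μ_t = ℙ(X_t ∈ · | σ(μ))` for every realization of `(m₀, ρ, id)`. -/
def MFGConsistency (G : GameData T 𝒳 Γ) (m₀ : PM 𝒳)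
    (ρ : Measure (Restricted T 𝒳 Γ × Flow T 𝒳)) : Prop :=
  ∀ {Ω : Type u} [MeasurableSpace Ω] (P : Measure Ω) [IsProbabilityMeasure P]
    (R : MFGRealization G m₀ ρ id P) (t : Fin (T + 1)) (x : 𝒳),
    (fun ω => (R.μ ω t).1 x) =ᵐ[P]
      P[(R.X t ⁻¹' {x}).indicator (fun _ => (1 : ℝ)) | MeasurableSpace.comap R.μ inferInstance]

/-- Correlated solutions of the mean field game with initial distribution `m₀`. -/
def IsCorrelatedMFGSolution (G : GameData T 𝒳 Γ) (m₀ : PM 𝒳)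
    (ρ : Measure (Restricted T 𝒳 Γ × Flow T 𝒳)) : Prop :=
  MFGOptimality G m₀ ρ ∧ MFGConsistency G m₀ ρ

/-- Finitely many flows per suggestion: for every `φ` suggested with positive probability there is a
finite set of flows that carries the conditional law of the flow given `Φ = φ`, each of its elements
with positive probability. -/
def FinitelyManyFlows (ρ : Measure (Restricted T 𝒳 Γ × Flow T 𝒳)) : Prop :=
  ∀ φ : Restricted T 𝒳 Γ, 0 < ρ {p | p.1 = φ} →
    ∃ S : Finset (Flow T 𝒳),
      ρ[|{p | p.1 = φ}] {p | p.2 ∈ S} = 1 ∧ ∀ m ∈ S, 0 < ρ[|{p | p.1 = φ}] {p | p.2 = m}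

/-- Information structure of the suggestion: `ρ` is the joint law of some `(Φ, μ)` such that
`Φ(t, ·) = α_t(Z, (μ₀, …, μ_{t+1}))` for Borel functions `α_t` and a random variable `Z`, uniform
on `[0,1]` and independent of `μ`. -/
def HasOneStepInformation (ρ : Measure (Restricted T 𝒳 Γ × Flow T 𝒳)) : Prop :=
  ∃ α : (t : Fin T) → I × (Fin (t + 1 + 1) → PM 𝒳) → 𝒳 → Γ, (∀ t, Measurable (α t)) ∧
    ∃ (Ω : Type u) (_ : MeasurableSpace Ω) (P : Measure Ω) (_ : IsProbabilityMeasure P)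
      (Φ : Ω → Restricted T 𝒳 Γ) (μ : Ω → Flow T 𝒳) (Z : Ω → I),
      Measurable Φ ∧ Measurable μ ∧ Measurable Z ∧
      P.map (fun ω => (Φ ω, μ ω)) = ρ ∧ P.map Z = volume ∧ IndepFun Z μ P ∧
      ∀ t ω, Φ ω t = α t (Z ω, upTo (μ ω) (t + 1) t.isLt)

end MeanField

/-! ### The `N`-player game -/

section NPlayer

/-- Empirical measures of `n`-samples. -/
def EmpMeas (n : ℕ) (𝒳 : Type u) [Fintype 𝒳] : Type u :=
  {m : PM 𝒳 // ∀ x, ∃ k : ℕ, k ≤ n ∧ m.1 x = (k : ℝ) / (n : ℝ)}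

open Classical in
/-- The empirical measure of the states of all players but player `i`. -/
noncomputable def empOthers {N : ℕ} [hN : N.AtLeastTwo] {𝒳 : Type u} [Fintype 𝒳]
    (x : Fin N → 𝒳) (i : Fin N) : EmpMeas (N - 1) 𝒳 :=
  ⟨⟨fun y => ((Finset.univ.filter fun j => j ≠ i ∧ x j = y).card : ℝ) / ((N - 1 : ℕ) : ℝ), by
      refine ⟨fun y => by positivity, ?_⟩
      rw [← Finset.sum_div, ← Nat.cast_sum]
      have h : ∑ y, (Finset.univ.filter fun j => j ≠ i ∧ x j = y).card = N - 1 := by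
        have h1 := Finset.card_eq_sum_card_fiberwise (f := x) (s := Finset.univ.erase i)
          (t := Finset.univ) (fun _ _ => Finset.mem_coe.2 (Finset.mem_univ _))
        rw [Finset.card_erase_of_mem (Finset.mem_univ i), Finset.card_univ, Fintype.card_fin] at h1
        rw [h1]
        refine Finset.sum_congr rfl fun y _ => congrArg Finset.card ?_
        ext j
        simp
      rw [h]
      have h2 := hN.prop
      exact div_self (Nat.cast_ne_zero.2 (by omega))⟩,
    fun y => ⟨_, by
      have h1 := Finset.card_le_card (s := Finset.univ.filter fun j => j ≠ i ∧ x j = y)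
        (t := Finset.univ.erase i) (fun j => by simp +contextual)
      rwa [Finset.card_erase_of_mem (Finset.mem_univ i), Finset.card_univ, Fintype.card_fin] at h1,
      rfl⟩⟩

/-- Time-`t` feedback functions in the `N`-player game: they depend on the states of the own player
and on the empirical measures of the `N - 1` other players, up to time `t`. -/
def StepStrategy (N : ℕ) (𝒳 Γ : Type u) [Fintype 𝒳] (t : ℕ) : Type u :=
  (Fin (t + 1) → 𝒳) × (Fin (t + 1) → EmpMeas (N - 1) 𝒳) → Γ

/-- The discrete σ-algebra. -/
instance (N : ℕ) (𝒳 Γ : Type u) [Fintype 𝒳] (t : ℕ) : MeasurableSpace (StepStrategy N 𝒳 Γ t) := ⊤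

/-- Progressive feedback strategies in the `N`-player game, `ψ = (ψ₀, …, ψ_{T-1})`. -/
abbrev NStrategy (N T : ℕ) (𝒳 Γ : Type u) [Fintype 𝒳] : Type u :=
  (t : Fin T) → StepStrategy N 𝒳 Γ t

/-- The inclusion of restricted strategies into those of the `N`-player game. -/
def Restricted.toNStrategy {T : ℕ} {𝒳 Γ : Type u} [Fintype 𝒳] (N : ℕ) (φ : Restricted T 𝒳 Γ) :
    NStrategy N T 𝒳 Γ :=
  fun t h => φ t (h.1 (Fin.last t))

variable {N T : ℕ} {𝒳 Γ : Type u} [Fintype 𝒳]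

/-- Strategy modifications of a suggestion with law `γ`: laws of the form
`γ̃(dφ, dψ) = β₀(φ, dψ₀) ⋯ β_{T-1}(φ, dψ_{T-1}) γ(dφ)` for probability kernels `β_t`. -/
def IsStrategyModification (γ : Measure (NStrategy N T 𝒳 Γ))
    (γ' : Measure (NStrategy N T 𝒳 Γ × NStrategy N T 𝒳 Γ)) : Prop :=
  ∃ β : (t : Fin T) → Kernel (NStrategy N T 𝒳 Γ) (StepStrategy N 𝒳 Γ t),
    (∀ t, IsMarkovKernel (β t)) ∧
      γ' = γ.bind fun φ => (Measure.pi fun t => β t φ).map fun ψ => (φ, ψ)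

/-- The modification `ι_γ` of the player who follows the suggestion. -/
noncomputable def followSuggestion (γ : Measure (NStrategy N T 𝒳 Γ)) :
    Measure (NStrategy N T 𝒳 Γ × NStrategy N T 𝒳 Γ) :=
  γ.map fun φ => (φ, φ)

variable [N.AtLeastTwo] [MeasurableSpace 𝒳]

/-- The action of player `i` at time `t` under the strategy `ψ`, along the path `x` of the states of
all players. -/
noncomputable def action (ψ : NStrategy N T 𝒳 Γ) (i : Fin N) (x : Fin (T + 1) → Fin N → 𝒳)
    (t : Fin T) : Γ :=
  ψ t (upTo (fun s => x s i) t t.isLt.le, upTo (fun s => empOthers (x s) i) t t.isLt.le)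

/-- A realization of `(𝔪, γ, γ')` for player `i`, for an initial law `𝔪` on `𝒳^N`, a correlated
suggestion `γ` and a strategy modification `γ'`.  The noise variable `ξ t j` enters the step of
player `j` from time `t` to time `t + 1`. -/
structure NRealization (G : GameData T 𝒳 Γ) (𝔪 : Measure (Fin N → 𝒳))
    (γ : Measure (Fin N → NStrategy N T 𝒳 Γ))
    (γ' : Measure (NStrategy N T 𝒳 Γ × NStrategy N T 𝒳 Γ)) (i : Fin N)
    {Ω : Type u} [MeasurableSpace Ω] (P : Measure Ω) where
  /-- the states of all players -/
  X : Fin (T + 1) → Ω → Fin N → 𝒳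
  /-- the suggestions -/
  Φ : Ω → Fin N → NStrategy N T 𝒳 Γ
  /-- the strategy played by player `i` -/
  Φ' : Ω → NStrategy N T 𝒳 Γ
  /-- the idiosyncratic noise -/
  ξ : Fin T → Fin N → Ω → I
  /-- the randomization device of player `i` -/
  ϑ : Fin T → Ω → I
  measurable_X : ∀ t, Measurable (X t)
  measurable_Φ : Measurable Φ
  measurable_Φ' : Measurable Φ'
  measurable_ξ : ∀ t j, Measurable (ξ t j)
  measurable_ϑ : ∀ t, Measurable (ϑ t)
  law_X_zero : P.map (X 0) = 𝔪
  law_Φ : P.map Φ = γ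
  law_ξ : ∀ t j, P.map (ξ t j) = volume
  iIndepFun_ξ : iIndepFun (fun p : Fin T × Fin N => ξ p.1 p.2) P
  law_ϑ : ∀ t, P.map (ϑ t) = volume
  iIndepFun_ϑ : iIndepFun ϑ P
  /-- `ξ`, `X₀`, `ϑ` and `Φ` are independent: first `ξ` of the three others jointly … -/
  indep_ξ : IndepFun (fun ω (p : Fin T × Fin N) => ξ p.1 p.2 ω)
    (fun ω => (X 0 ω, (fun t => ϑ t ω), Φ ω)) P
  /-- … then `X₀` of the two remaining ones jointly … -/
  indep_X_zero : IndepFun (X 0) (fun ω => ((fun t => ϑ t ω), Φ ω)) P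
  /-- … and then `ϑ` of `Φ`. -/
  indep_ϑ : IndepFun (fun ω t => ϑ t ω) Φ P
  law_modification : P.map (fun ω => (Φ ω i, Φ' ω)) = γ'
  /-- `Φ'(t, ·)` is measurable for the completion of `σ(Φ_i, ϑ_t)`. -/
  adapted : ∀ t : Fin T, ∃ g : Ω → StepStrategy N 𝒳 Γ t,
    Measurable[MeasurableSpace.comap (fun ω => (Φ ω i, ϑ t ω)) inferInstance] g ∧
      (fun ω => Φ' ω t) =ᵐ[P] g
  dynamics : ∀ (t : Fin T) (j : Fin N), ∀ᵐ ω ∂P,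
    X t.succ ω j = G.Ψ t (X t.castSucc ω j) (empOthers (X t.castSucc ω) j).1
      (action (if j = i then Φ' ω else Φ ω j) j (fun s => X s ω) t) (ξ t j ω)

/-- The expected costs of player `i`. -/
noncomputable def NRealization.cost {G : GameData T 𝒳 Γ} {𝔪 : Measure (Fin N → 𝒳)}
    {γ : Measure (Fin N → NStrategy N T 𝒳 Γ)}
    {γ' : Measure (NStrategy N T 𝒳 Γ × NStrategy N T 𝒳 Γ)} {i : Fin N}
    {Ω : Type u} [MeasurableSpace Ω] {P : Measure Ω} (R : NRealization G 𝔪 γ γ' i P) : ℝ :=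
  ∫ ω, ((∑ t : Fin T, G.f t (R.X t.castSucc ω i) (empOthers (R.X t.castSucc ω) i).1
      (action (R.Φ' ω) i (fun s => R.X s ω) t))
    + G.F (R.X (Fin.last T) ω i) (empOthers (R.X (Fin.last T) ω) i).1) ∂P

/-- `ε`-correlated equilibria of the `N`-player game with initial distribution `𝔪`.  The costs
depend on the realization only through `(𝔪, γ, γ')`, so
`J_i(𝔪, γ, ι) ≤ J_i(𝔪, γ, γ') + ε` is stated for arbitrary realizations. -/
def IsCorrelatedEquilibrium (G : GameData T 𝒳 Γ) (𝔪 : Measure (Fin N → 𝒳)) (ε : ℝ)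
    (γ : Measure (Fin N → NStrategy N T 𝒳 Γ)) : Prop :=
  IsProbabilityMeasure γ ∧
  ∀ (i : Fin N) (γ' : Measure (NStrategy N T 𝒳 Γ × NStrategy N T 𝒳 Γ)),
    IsStrategyModification (γ.map fun φ => φ i) γ' →
    ∀ {Ω Ω' : Type u} [MeasurableSpace Ω] [MeasurableSpace Ω'] (P : Measure Ω) (P' : Measure Ω')
      [IsProbabilityMeasure P] [IsProbabilityMeasure P']
      (R : NRealization G 𝔪 γ (followSuggestion (γ.map fun φ => φ i)) i P)
      (R' : NRealization G 𝔪 γ γ' i P'), R.cost ≤ R'.cost + ε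

end NPlayer

/-- The mixture `γ^N = ∫ ρ₁(· | m)^{⊗N} ρ₂(dm)` on `N`-tuples of restricted strategies, where `ρ₂` is
the law of the flow of measures and `ρ₁(· | m)` the regular conditional law of the suggestion given
that the flow is `m`. -/
noncomputable def mixture {T : ℕ} {𝒳 Γ : Type u} [Fintype 𝒳] [Finite Γ] [Nonempty Γ]
    [MeasurableSpace Γ] [DiscreteMeasurableSpace Γ]
    (ρ : Measure (Restricted T 𝒳 Γ × Flow T 𝒳)) [IsFiniteMeasure ρ] (N : ℕ) :
    Measure (Fin N → Restricted T 𝒳 Γ) :=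
  ρ.snd.bind fun m => Measure.pi fun _ : Fin N => (ρ.map Prod.swap).condKernel m

end CorrelatedMFG

/-! Given the flow `m`, the suggestions are independent and of the form `sugg α Z_j m` with private
uniform variables `Z_j`. The `N`-player game is therefore a mixture over `m` of games whose players
carry i.i.d. private randomness (initial state, `Z_j`, noise). All comparisons are made on that
product space, with bounds uniform in the deviating player `i` and in the map `g` that modifies its
suggestion.

Propagation of chaos. An opponent, who obeys its suggestion, is coupled with `meanPath`, driven by
the same randomness but with `m` in place of the empirical measure. Consistency says that for almost
every `m` this copy has law `m t` at time `t` (`ae_meanPath_law`). The law of large numbers and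
induction on time then force the empirical measures to be close to `m` (`measure_others_ne_le`,
`integral_dist_le_couplingBound`); the deviator has weight `1/(N-1)` only.

The deviator's strategy is an arbitrary function of the empirical measures, so they cannot be
replaced by `m` inside it. They are replaced in the dynamics and costs of player `i` only, while the
strategy keeps reading the empirical measures of opponents who react to its path (`limitPath`,
`measure_self_ne_le`). This behaviour is available in the mean field game: with the opponents'
randomness `ω` frozen, the representative player simulates them along its own states and the flow.
By (R2) the suggestions that shaped the states up to time `t` involve the flow up to time `t` only,
so the simulation is a progressive strategy (`reactAction_congr`, `simulate`). Optimality for each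
`ω`, averaged over `ω`, shows that the limit costs of any `g` are at least the mean field costs
(`meanCost_le_integral_limitCost`), with equality for `g = id`.

Finally, a modification randomized by `ϑ` is a random `g` independent of all else, so its costs are
an average over deterministic `g` (`cost_eq_integral_nCost`). Passing to the limit costs once for
the suggestion and once for the deviation gives an error of twice `gapBound`. -/

namespace CorrelatedMFG

/-! ### Resampling a coordinate of a product measure -/

section Resampling

variable {ι : Type*} [Fintype ι] [DecidableEq ι] {β : ι → Type*} [∀ i, MeasurableSpace (β i)]
  (μ : ∀ i, Measure (β i)) [∀ i, IsProbabilityMeasure (μ i)]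

omit [Fintype ι] in
theorem measurable_update_prod (j : ι) :
    Measurable fun p : (∀ i, β i) × β j => Function.update p.1 j p.2 := by
  refine measurable_pi_iff.2 fun i => ?_
  by_cases h : i = j
  · subst h
    simpa using measurable_snd
  · simp only [Function.update_of_ne h]
    exact (measurable_pi_apply i).comp measurable_fst

/-- On a box, the discarded coordinate contributes mass one and the fresh one the missing factor.
Redrawing a coordinate is how independence is exploited below: it permits Fubini in one noise
variable with everything else frozen. -/
theorem measurePreserving_update (j : ι) :
    MeasurePreserving (fun p : (∀ i, β i) × β j => Function.update p.1 j p.2)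
      ((Measure.pi μ).prod (μ j)) (Measure.pi μ) := by
  refine ⟨measurable_update_prod j, (Measure.pi_eq fun s hs => ?_).symm⟩
  rw [Measure.map_apply (measurable_update_prod j) (MeasurableSet.univ_pi hs)]
  have h : (fun p : (∀ i, β i) × β j => Function.update p.1 j p.2) ⁻¹' Set.univ.pi s =
      (Set.univ.pi (Function.update s j Set.univ)) ×ˢ s j := by
    ext p
    simp only [Set.mem_preimage, Set.mem_pi, Set.mem_univ, true_implies, Set.mem_prod]
    constructor
    · refine fun h => ⟨fun i => ?_, by simpa using h j⟩
      by_cases hi : i = j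
      · subst hi; simp
      · simpa [Function.update_of_ne hi] using h i
    · rintro ⟨h, h'⟩ i
      by_cases hi : i = j
      · subst hi; simpa using h'
      · simpa [Function.update_of_ne hi] using h i
  rw [h, Measure.prod_prod, Measure.pi_pi, ← Finset.mul_prod_erase _ _ (Finset.mem_univ j),
    ← Finset.mul_prod_erase _ (fun i => μ i (s i)) (Finset.mem_univ j)]
  simp only [Function.update_self, measure_univ, one_mul]
  rw [mul_comm]
  congr 1
  refine Finset.prod_congr rfl fun i hi => ?_
  rw [Function.update_of_ne (Finset.ne_of_mem_erase hi)]

/-- Redrawing coordinate `j` as a whole separates it from the others, and on each fibre the claim is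
the invariance of `μ j` under `r`. It serves to redraw only a part of a coordinate that is itself a
tuple. -/
theorem measurePreserving_update_of_measurePreserving (j : ι) {E : Type*} [MeasurableSpace E]
    (ν : Measure E) [IsProbabilityMeasure ν] {r : β j × E → β j}
    (hr : MeasurePreserving r ((μ j).prod ν) (μ j)) :
    MeasurePreserving (fun p : (∀ i, β i) × E => Function.update p.1 j (r (p.1 j, p.2)))
      ((Measure.pi μ).prod ν) (Measure.pi μ) := by
  have hm : Measurable fun p : (∀ i, β i) × E => Function.update p.1 j (r (p.1 j, p.2)) :=
    (measurable_update_prod j).comp (measurable_fst.prodMk (hr.measurable.comp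
      (((measurable_pi_apply j).comp measurable_fst).prodMk measurable_snd)))
  refine ⟨hm, Measure.ext fun A hA => ?_⟩
  rw [Measure.map_apply hm hA, Measure.prod_apply (hm hA),
    ← (measurePreserving_update μ j).lintegral_comp (measurable_measure_prodMk_left (hm hA)),
    lintegral_prod (μ := Measure.pi μ) (ν := μ j) _ (by
      exact ((measurable_measure_prodMk_left (hm hA)).comp
        (measurable_update_prod j)).aemeasurable),
    ← (measurePreserving_update μ j).measure_preimage hA.nullMeasurableSet,
    Measure.prod_apply (measurable_update_prod j hA)]
  refine lintegral_congr fun ω => ?_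
  have hω : MeasurableSet (Prod.mk ω ⁻¹'
      ((fun p : (∀ i, β i) × β j => Function.update p.1 j p.2) ⁻¹' A)) :=
    measurable_prodMk_left (measurable_update_prod j hA)
  rw [← hr.measure_preimage hω.nullMeasurableSet, Measure.prod_apply (hr.measurable hω)]
  refine lintegral_congr fun w => congrArg ν ?_
  ext z
  simp

end Resampling

/-! ### Progressive recursions -/

section Recursion

variable {T : ℕ} {S : Type*}

/-- Iterates of a progressive recursion, constant after the last computed time. -/
def recAux (s₀ : S) (step : Fin T → (Fin (T + 1) → S) → S) : ℕ → Fin (T + 1) → S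
  | 0 => fun _ => s₀
  | n + 1 => fun s => if h : n < T ∧ n < (s : ℕ) then step ⟨n, h.1⟩ (recAux s₀ step n)
      else recAux s₀ step n s

/-- The path started at `s₀` with `p (t + 1) = step t p`, for steps that depend on the past. -/
def recPath (s₀ : S) (step : Fin T → (Fin (T + 1) → S) → S) : Fin (T + 1) → S :=
  recAux s₀ step T

/-- The value of `step t` depends on the path up to time `t` only. -/
def IsProgressiveStep (step : Fin T → (Fin (T + 1) → S) → S) : Prop :=
  ∀ (t : Fin T) (p q : Fin (T + 1) → S), (∀ s : Fin (T + 1), (s : ℕ) ≤ t → p s = q s) → step t p = step t q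

theorem recAux_succ_of_le (s₀ : S) (step : Fin T → (Fin (T + 1) → S) → S) (n : ℕ)
    (s : Fin (T + 1)) (h : (s : ℕ) ≤ n) : recAux s₀ step (n + 1) s = recAux s₀ step n s := by
  simp [recAux, Nat.not_lt.2 h]

theorem recAux_add_of_le (s₀ : S) (step : Fin T → (Fin (T + 1) → S) → S) (n k : ℕ)
    (s : Fin (T + 1)) (h : (s : ℕ) ≤ n) : recAux s₀ step (n + k) s = recAux s₀ step n s := by
  induction k with
  | zero => rfl
  | succ k ih => rw [← add_assoc, recAux_succ_of_le _ _ _ _ (by omega), ih]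

/-- Entry `s` is final after `s` passes, because a pass overwrites later times only. -/
theorem recPath_eq_recAux (s₀ : S) (step : Fin T → (Fin (T + 1) → S) → S) (n : ℕ) (hn : n ≤ T)
    (s : Fin (T + 1)) (h : (s : ℕ) ≤ n) : recPath s₀ step s = recAux s₀ step n s := by
  obtain ⟨k, rfl⟩ := Nat.exists_eq_add_of_le hn
  exact recAux_add_of_le _ _ _ _ _ h

theorem recPath_zero (s₀ : S) (step : Fin T → (Fin (T + 1) → S) → S) :
    recPath s₀ step 0 = s₀ := by
  rw [recPath_eq_recAux s₀ step 0 (Nat.zero_le _) 0 le_rfl]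
  rfl

theorem recPath_succ (s₀ : S) {step : Fin T → (Fin (T + 1) → S) → S}
    (hstep : IsProgressiveStep step) (t : Fin T) :
    recPath s₀ step t.succ = step t (recPath s₀ step) := by
  rw [recPath_eq_recAux s₀ step (t + 1) t.isLt t.succ (by simp)]
  have : recAux s₀ step (t + 1) t.succ = step t (recAux s₀ step t) := by simp [recAux]
  rw [this]
  exact hstep _ _ _ fun s hs => (recPath_eq_recAux s₀ step t t.isLt.le s hs).symm

/-- Strong induction on time. The bound `n` allows comparing two recursions whose data agree only up
to a given time. -/
theorem path_eq_of_step {p q : Fin (T + 1) → S} (n : ℕ) (h0 : p 0 = q 0)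
    (hs : ∀ t : Fin T, (t : ℕ) + 1 ≤ n → (∀ s : Fin (T + 1), (s : ℕ) ≤ t → p s = q s) →
      p t.succ = q t.succ) : ∀ s : Fin (T + 1), (s : ℕ) ≤ n → p s = q s := by
  have key : ∀ k : ℕ, k ≤ n → ∀ s : Fin (T + 1), (s : ℕ) ≤ k → p s = q s := by
    intro k
    induction k with
    | zero =>
      intro _ s hs0
      have : s = 0 := Fin.ext (by simpa using hs0)
      rw [this, h0]
    | succ k ih =>
      intro hk s hsk
      rcases Nat.lt_or_ge (s : ℕ) (k + 1) with h | h
      · exact ih (by omega) s (by omega)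
      · have hkT : k < T := by have := s.isLt; omega
        have : s = (⟨k, hkT⟩ : Fin T).succ := Fin.ext (by simp; omega)
        rw [this]
        exact hs ⟨k, hkT⟩ hk fun s' hs' => ih (by omega) s' hs'
  exact key n le_rfl

theorem eq_recPath {p : Fin (T + 1) → S} {s₀ : S} {step : Fin T → (Fin (T + 1) → S) → S}
    (hstep : IsProgressiveStep step) (h0 : p 0 = s₀) (hs : ∀ t, p t.succ = step t p) :
    p = recPath s₀ step := by
  funext s
  refine path_eq_of_step T (by rw [h0, recPath_zero]) (fun t _ h => ?_) s (by omega)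
  rw [hs t, recPath_succ _ hstep]
  exact hstep t _ _ h

theorem measurable_recPath [MeasurableSpace S] {Ω : Type*} [MeasurableSpace Ω] {s₀ : Ω → S}
    {step : Ω → Fin T → (Fin (T + 1) → S) → S} (h0 : Measurable s₀)
    (hs : ∀ t, Measurable fun q : Ω × (Fin (T + 1) → S) => step q.1 t q.2) :
    Measurable fun ω => recPath (s₀ ω) (step ω) := by
  have key : ∀ n, Measurable fun ω => recAux (s₀ ω) (step ω) n := by
    intro n
    induction n with
    | zero => exact measurable_pi_iff.2 fun _ => h0
    | succ n ih =>
      refine measurable_pi_iff.2 fun s => ?_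
      by_cases h : n < T ∧ n < (s : ℕ)
      · simp only [recAux, h, and_self, dite_true]
        exact (hs ⟨n, h.1⟩).comp (measurable_id.prodMk ih)
      · simp only [recAux, h, dite_false]
        exact (measurable_pi_apply s).comp ih
  exact key T

theorem upTo_congr {α : Type*} {p q : Fin (T + 1) → α} (k : ℕ) (hk : k ≤ T)
    (h : ∀ s : Fin (T + 1), (s : ℕ) ≤ k → p s = q s) : upTo p k hk = upTo q k hk := by
  funext s
  exact h _ (by have := s.isLt; simp; omega)

end Recursion

/-! ### Finiteness and measurability -/

section Instances

variable {𝒳 Γ : Type u} [Fintype 𝒳]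

/-- An empirical measure is determined by its numerators. Finiteness makes the strategy spaces of
the `N`-player game finite and discrete, which disposes of most measurability questions there. -/
instance instFiniteEmpMeas (n : ℕ) : Finite (EmpMeas n 𝒳) := by
  classical
  refine Finite.of_injective
    (fun m : EmpMeas n 𝒳 => fun x => (⟨(m.2 x).choose,
      Nat.lt_succ_of_le (m.2 x).choose_spec.1⟩ : Fin (n + 1))) fun m m' h => ?_
  refine Subtype.ext (Subtype.ext (funext fun x => ?_))
  have hx := congrArg Fin.val (congrFun h x)
  simp only at hx
  rw [(m.2 x).choose_spec.2, (m'.2 x).choose_spec.2, hx]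

instance instFiniteStepStrategy (N : ℕ) [Finite Γ] (t : ℕ) : Finite (StepStrategy N 𝒳 Γ t) := by
  unfold StepStrategy
  infer_instance

instance instNonemptyStepStrategy (N : ℕ) [Nonempty Γ] (t : ℕ) :
    Nonempty (StepStrategy N 𝒳 Γ t) := by
  unfold StepStrategy
  infer_instance

instance instDiscreteStepStrategy (N : ℕ) (t : ℕ) :
    DiscreteMeasurableSpace (StepStrategy N 𝒳 Γ t) := ⟨fun _ => trivial⟩

variable [MeasurableSpace 𝒳] [DiscreteMeasurableSpace 𝒳] [Finite Γ] [MeasurableSpace Γ]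
  [DiscreteMeasurableSpace Γ] 

end Instances

/-! ### The metric on measures and empirical measures -/

section Distance

variable {𝒳 : Type u} [Fintype 𝒳]

theorem tvDist_nonneg (m m' : PM 𝒳) : 0 ≤ tvDist m m' :=
  mul_nonneg (by norm_num) (Finset.sum_nonneg fun _ _ => abs_nonneg _)

theorem tvDist_triangle (m m' m'' : PM 𝒳) : tvDist m m'' ≤ tvDist m m' + tvDist m' m'' := by
  unfold tvDist
  rw [← mul_add, ← Finset.sum_add_distrib]
  gcongr
  exact abs_sub_le _ _ _

theorem tvDist_le_one (m m' : PM 𝒳) : tvDist m m' ≤ 1 := by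
  have h : ∑ x, |m.1 x - m'.1 x| ≤ ∑ x, (m.1 x + m'.1 x) :=
    Finset.sum_le_sum fun x _ => by
      have h1 := m.2.1 x
      have h2 := m'.2.1 x
      exact abs_le.2 ⟨by linarith, by linarith⟩
  rw [Finset.sum_add_distrib, m.2.2, m'.2.2] at h
  unfold tvDist
  linarith

variable {N : ℕ} [hN : N.AtLeastTwo]

include hN in
theorem natCast_pred_pos : (0 : ℝ) < ((N - 1 : ℕ) : ℝ) := by
  have := hN.prop
  exact_mod_cast (by omega : 0 < N - 1)

open Classical in
theorem empOthers_apply (x : Fin N → 𝒳) (j : Fin N) (y : 𝒳) :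
    (empOthers x j).1.1 y =
      (∑ k ∈ Finset.univ.erase j, if x k = y then (1 : ℝ) else 0) / ((N - 1 : ℕ) : ℝ) := by
  have h : (empOthers x j).1.1 y =
      ((Finset.univ.filter fun k => k ≠ j ∧ x k = y).card : ℝ) / ((N - 1 : ℕ) : ℝ) := rfl
  rw [h, Finset.sum_boole]
  congr 3
  ext k
  simp

open Classical in
-- Each player with different states moves an atom of mass `1/(N-1)`. This changes two masses, and
-- the factor 2 cancels the `1/2` in `tvDist`.
theorem tvDist_empOthers_le (x y : Fin N → 𝒳) (j : Fin N) :
    tvDist (empOthers x j).1 (empOthers y j).1 ≤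
      (∑ k ∈ Finset.univ.erase j, if x k ≠ y k then (1 : ℝ) else 0) / ((N - 1 : ℕ) : ℝ) := by
  have hpos := natCast_pred_pos (N := N)
  have h1 : ∀ a, |(empOthers x j).1.1 a - (empOthers y j).1.1 a| ≤
      (∑ k ∈ Finset.univ.erase j,
        |(if x k = a then (1 : ℝ) else 0) - if y k = a then 1 else 0|) / ((N - 1 : ℕ) : ℝ) := by
    intro a
    rw [empOthers_apply, empOthers_apply, ← sub_div, ← Finset.sum_sub_distrib, abs_div,
      abs_of_pos hpos]
    gcongr
    exact Finset.abs_sum_le_sum_abs _ _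
  have h2 : ∀ k, ∑ a, |(if x k = a then (1 : ℝ) else 0) - if y k = a then 1 else 0| ≤
      2 * if x k ≠ y k then (1 : ℝ) else 0 := by
    intro k
    by_cases hk : x k = y k
    · simp [hk]
    · calc ∑ a, |(if x k = a then (1 : ℝ) else 0) - if y k = a then 1 else 0|
          ≤ ∑ a, ((if x k = a then (1 : ℝ) else 0) + if y k = a then 1 else 0) := by
            refine Finset.sum_le_sum fun a _ => ?_
            split_ifs <;> norm_num
        _ = 2 * if x k ≠ y k then (1 : ℝ) else 0 := by
            rw [Finset.sum_add_distrib]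
            simp [hk]
            norm_num
  calc tvDist (empOthers x j).1 (empOthers y j).1
      ≤ (1 / 2) * ∑ a, (∑ k ∈ Finset.univ.erase j,
        |(if x k = a then (1 : ℝ) else 0) - if y k = a then 1 else 0|) / ((N - 1 : ℕ) : ℝ) := by
        unfold tvDist
        gcongr with a
        exact h1 a
    _ = (1 / 2) * (∑ k ∈ Finset.univ.erase j,
        ∑ a, |(if x k = a then (1 : ℝ) else 0) - if y k = a then 1 else 0|) /
          ((N - 1 : ℕ) : ℝ) := by
        rw [← Finset.sum_div, Finset.sum_comm, mul_div_assoc]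
    _ ≤ (1 / 2) * (∑ k ∈ Finset.univ.erase j, 2 * if x k ≠ y k then (1 : ℝ) else 0) /
          ((N - 1 : ℕ) : ℝ) := by
        gcongr with k
        exact h2 k
    _ = _ := by rw [← Finset.mul_sum]; ring

end Distance

/-! ### The law of large numbers -/

section LLN

variable {W : Type*} [MeasurableSpace W] (π : Measure W) [IsProbabilityMeasure π]

/-- This is the non-negativity of the variance of `|S|`. -/
theorem integral_abs_le_sqrt {Ω : Type*} [MeasurableSpace Ω] {P : Measure Ω}
    [IsProbabilityMeasure P] {S : Ω → ℝ} (hS : MemLp S 2 P) {v : ℝ}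
    (hv : ∫ ω, S ω ^ 2 ∂P ≤ v) : ∫ ω, |S ω| ∂P ≤ √v := by
  have h := variance_eq_sub hS.abs
  have h0 := variance_nonneg |S| P
  have h1 : (∫ ω, (|S| ^ 2) ω ∂P) = ∫ ω, S ω ^ 2 ∂P := integral_congr_ae (ae_of_all _ fun ω => by simp)
  have h2 : (∫ ω, (|S|) ω ∂P) = ∫ ω, |S ω| ∂P := rfl
  rw [h, h1, h2] at h0
  exact Real.le_sqrt_of_sq_le (by linarith)

theorem integral_abs_sum_le {ι : Type*} [Fintype ι] [DecidableEq ι] {h : W → ℝ}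
    (hm : Measurable h) (hb : ∀ w, |h w| ≤ 1) (h0 : ∫ w, h w ∂π = 0) (s : Finset ι) :
    ∫ ω : ι → W, |∑ k ∈ s, h (ω k)| ∂(Measure.pi fun _ => π) ≤ √(s.card : ℝ) := by
  -- Padding with zero outside `s` turns the partial sum into a sum over all coordinates, for which
  -- variances add.
  have hL : ∀ i : ι, MemLp (fun w => if i ∈ s then h w else 0) 2 π := fun i => by
    by_cases hi : i ∈ s
    · simp only [hi, if_true]
      exact MemLp.of_bound hm.aestronglyMeasurable 1 (ae_of_all _ hb)
    · simp [hi]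
  have hvar := variance_sum_pi (μ := fun _ : ι => π) hL
  have hS : (∑ i, fun ω : ι → W => if i ∈ s then h (ω i) else 0) =
      fun ω => ∑ k ∈ s, h (ω k) := by
    funext ω
    simp
  rw [hS] at hvar
  have hSm : Measurable fun ω : ι → W => ∑ k ∈ s, h (ω k) :=
    Finset.measurable_sum _ fun k _ => hm.comp (measurable_pi_apply k)
  have hSL : MemLp (fun ω : ι → W => ∑ k ∈ s, h (ω k)) 2 (Measure.pi fun _ => π) := by
    refine MemLp.of_bound hSm.aestronglyMeasurable (s.card : ℝ) (ae_of_all _ fun ω => ?_)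
    refine (norm_sum_le _ _).trans ?_
    calc ∑ k ∈ s, ‖h (ω k)‖ ≤ ∑ k ∈ s, (1 : ℝ) := Finset.sum_le_sum fun k _ => hb _
      _ = s.card := by simp
  have hint : ∀ k : ι, ∫ ω : ι → W, h (ω k) ∂(Measure.pi fun _ => π) = 0 := fun k => by
    have he := (measurePreserving_eval (fun _ : ι => π) k).map_eq
    have := integral_map (μ := Measure.pi fun _ : ι => π) (f := h)
      (measurable_pi_apply k).aemeasurable hm.aestronglyMeasurable
    rw [← h0, ← this]
    exact congrArg (fun κ => ∫ w, h w ∂κ) he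
  have hmean : ∫ ω : ι → W, ∑ k ∈ s, h (ω k) ∂(Measure.pi fun _ => π) = 0 := by
    rw [integral_finsetSum]
    · exact Finset.sum_eq_zero fun k _ => hint k
    · intro k _
      exact Integrable.of_bound (hm.comp (measurable_pi_apply k)).aestronglyMeasurable 1
        (ae_of_all _ fun ω => hb _)
  refine integral_abs_le_sqrt hSL ?_
  rw [← variance_of_integral_eq_zero hSm.aemeasurable hmean, hvar]
  calc ∑ i, Var[fun w => if i ∈ s then h w else 0; π]
      ≤ ∑ i, if i ∈ s then (1 : ℝ) else 0 := by
        refine Finset.sum_le_sum fun i _ => ?_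
        by_cases hi : i ∈ s
        · simp only [hi, if_true]
          refine (variance_le_expectation_sq hm.aestronglyMeasurable).trans ?_
          calc π[h ^ 2] ≤ ∫ _, (1 : ℝ) ∂π := by
                refine integral_mono_of_nonneg (ae_of_all _ fun w => sq_nonneg _)
                  (integrable_const _) (ae_of_all _ fun w => ?_)
                simpa using (sq_le_one_iff_abs_le_one _).2 (hb w)
            _ = 1 := by simp
        · simp only [hi, if_false]
          exact (variance_zero π).le
    _ = s.card := by simp

/-- For each point `x`, the centred indicators of `Y = x` are independent and bounded by one, so
their sum over `N - 1` players is of order `√(N-1)` in mean. The factor `1/2` in `tvDist` is given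
away. -/
theorem integral_tvDist_empOthers_le {𝒳 : Type u} [Fintype 𝒳] [MeasurableSpace 𝒳]
    [DiscreteMeasurableSpace 𝒳] {N : ℕ} [hN : N.AtLeastTwo] {Y : W → 𝒳} (hY : Measurable Y)
    {m : PM 𝒳} (hm : ∀ x, π.real (Y ⁻¹' {x}) = m.1 x) (j : Fin N) :
    ∫ ω : Fin N → W, tvDist (empOthers (fun k => Y (ω k)) j).1 m ∂(Measure.pi fun _ => π) ≤
      Fintype.card 𝒳 / √((N - 1 : ℕ) : ℝ) := by
  classical
  have hpos := natCast_pred_pos (N := N)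
  let h : 𝒳 → W → ℝ := fun x w => (if Y w = x then 1 else 0) - m.1 x
  have hms : ∀ x, MeasurableSet (Y ⁻¹' {x}) := fun x => hY (MeasurableSet.of_discrete)
  have hhm : ∀ x, Measurable (h x) := fun x =>
    (Measurable.ite (hms x) measurable_const measurable_const).sub measurable_const
  have hm1 : ∀ x, m.1 x ≤ 1 := fun x => by
    rw [← m.2.2]
    exact Finset.single_le_sum (f := m.1) (fun y _ => m.2.1 y) (Finset.mem_univ x)
  have hhb : ∀ x w, |h x w| ≤ 1 := fun x w => by
    have h1 := m.2.1 x
    have h2 := hm1 x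
    simp only [h]
    split_ifs <;> exact abs_le.2 ⟨by linarith, by linarith⟩
  have hh0 : ∀ x, ∫ w, h x w ∂π = 0 := fun x => by
    have hi : (fun w => if Y w = x then (1 : ℝ) else 0) = (Y ⁻¹' {x}).indicator fun _ => 1 := by
      funext w
      simp [Set.indicator_apply]
    simp only [h]
    rw [integral_sub, hi, integral_indicator_const _ (hms x), hm x]
    · simp
    · rw [hi]
      exact (integrable_const _).indicator (hms x)
    · exact integrable_const _
  have hcard : ((Finset.univ.erase j).card : ℝ) = ((N - 1 : ℕ) : ℝ) := by
    rw [Finset.card_erase_of_mem (Finset.mem_univ j), Finset.card_univ, Fintype.card_fin]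
  have key : ∀ ω : Fin N → W, tvDist (empOthers (fun k => Y (ω k)) j).1 m =
      ∑ x, (1 / 2) * (|∑ k ∈ Finset.univ.erase j, h x (ω k)| / ((N - 1 : ℕ) : ℝ)) := by
    intro ω
    unfold tvDist
    rw [Finset.mul_sum]
    refine Finset.sum_congr rfl fun x _ => ?_
    rw [empOthers_apply]
    simp only [h]
    rw [Finset.sum_sub_distrib, Finset.sum_const, nsmul_eq_mul, hcard]
    conv_rhs => rw [← abs_of_pos hpos, ← abs_div, abs_of_pos hpos, sub_div,
      mul_div_cancel_left₀ _ hpos.ne']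
  simp only [key]
  rw [integral_finsetSum]
  · calc ∑ x, ∫ ω : Fin N → W, (1 / 2) * (|∑ k ∈ Finset.univ.erase j, h x (ω k)| /
          ((N - 1 : ℕ) : ℝ)) ∂(Measure.pi fun _ => π)
        ≤ ∑ x : 𝒳, 1 / √((N - 1 : ℕ) : ℝ) := by
          refine Finset.sum_le_sum fun x _ => ?_
          rw [integral_const_mul, integral_div]
          have hle := integral_abs_sum_le π (hhm x) (hhb x) (hh0 x) (Finset.univ.erase j)
          rw [hcard] at hle
          have : √((N - 1 : ℕ) : ℝ) / ((N - 1 : ℕ) : ℝ) = 1 / √((N - 1 : ℕ) : ℝ) := by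
            rw [Real.sqrt_div_self']
          rw [← this]
          have h2 : 0 ≤ √((N - 1 : ℕ) : ℝ) / ((N - 1 : ℕ) : ℝ) := by positivity
          have h3 := div_le_div_of_nonneg_right hle hpos.le
          have h4 : 0 ≤ (∫ ω : Fin N → W, |∑ k ∈ Finset.univ.erase j, h x (ω k)|
              ∂(Measure.pi fun _ => π)) / ((N - 1 : ℕ) : ℝ) :=
            div_nonneg (integral_nonneg fun _ => abs_nonneg _) hpos.le
          linarith
      _ = Fintype.card 𝒳 / √((N - 1 : ℕ) : ℝ) := by simp [div_eq_mul_inv]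
  · intro x _
    have hSm : Measurable fun ω : Fin N → W => ∑ k ∈ Finset.univ.erase j, h x (ω k) :=
      Finset.measurable_sum _ fun k _ => (hhm x).comp (measurable_pi_apply k)
    refine (Integrable.div_const (Integrable.abs ?_) _).const_mul _
    refine Integrable.of_bound hSm.aestronglyMeasurable ((N - 1 : ℕ) : ℝ) (ae_of_all _ fun ω => ?_)
    refine (norm_sum_le _ _).trans ?_
    calc ∑ k ∈ Finset.univ.erase j, ‖h x (ω k)‖ ≤ ∑ k ∈ Finset.univ.erase j, (1 : ℝ) :=
          Finset.sum_le_sum fun k _ => hhb x _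
      _ = ((N - 1 : ℕ) : ℝ) := by rw [Finset.sum_const, nsmul_eq_mul, hcard, mul_one]

end LLN

/-! ### Moduli of continuity -/

section Modulus

/-- If `w` bounds a quantity in terms of a random distance `D` with `E D ≤ e`, then
`w (√e) + √e` bounds its expectation. -/
noncomputable def meanModulus (w : ℝ → ℝ) (e : ℝ) : ℝ := w √e + √e

variable {w : ℝ → ℝ}

/-- Markov's inequality with threshold `√e`: below it `w` is monotone, above it `w ≤ 1 ≤ D / √e`.
With `E D ≤ e` both terms become small together, and no concavity of `w` is required. -/
theorem modulus_le (hmono : MonotoneOn w (Set.Ici 0)) (h01 : ∀ s, 0 ≤ s → w s ∈ Set.Icc (0 : ℝ) 1)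
    {e D : ℝ} (he : 0 < e) (hD : 0 ≤ D) : w D ≤ w √e + D / √e := by
  have hs : 0 < √e := Real.sqrt_pos.2 he
  rcases le_total D √e with h | h
  · have := hmono (Set.mem_Ici.2 hD) (Set.mem_Ici.2 hs.le) h
    have : 0 ≤ D / √e := by positivity
    linarith
  · have h1 : 1 ≤ D / √e := (one_le_div hs).2 h
    have h2 := (h01 D hD).2
    have h3 := (h01 √e hs.le).1
    linarith

theorem lintegral_modulus_le (hmono : MonotoneOn w (Set.Ici 0))
    (h01 : ∀ s, 0 ≤ s → w s ∈ Set.Icc (0 : ℝ) 1) {Ω : Type*} [MeasurableSpace Ω] {P : Measure Ω}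
    [IsProbabilityMeasure P] {D : Ω → ℝ} (hD : ∀ ω, 0 ≤ D ω) (hDi : Integrable D P) {e : ℝ}
    (he : 0 < e) (hDe : ∫ ω, D ω ∂P ≤ e) :
    ∫⁻ ω, ENNReal.ofReal (w (D ω)) ∂P ≤ ENNReal.ofReal (meanModulus w e) := by
  have hs : 0 < √e := Real.sqrt_pos.2 he
  calc ∫⁻ ω, ENNReal.ofReal (w (D ω)) ∂P ≤ ∫⁻ ω, ENNReal.ofReal (w √e + D ω / √e) ∂P :=
        lintegral_mono fun ω => ENNReal.ofReal_le_ofReal (modulus_le hmono h01 he (hD ω))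
    _ = ENNReal.ofReal (∫ ω, (w √e + D ω / √e) ∂P) := by
        rw [ofReal_integral_eq_lintegral_ofReal]
        · exact (integrable_const _).add (hDi.div_const _)
        · exact ae_of_all _ fun ω => add_nonneg (h01 _ hs.le).1 (div_nonneg (hD ω) hs.le)
    _ ≤ ENNReal.ofReal (meanModulus w e) := by
        refine ENNReal.ofReal_le_ofReal ?_
        rw [integral_add (integrable_const _) (hDi.div_const _), integral_div]
        have : (∫ ω, D ω ∂P) / √e ≤ √e := by
          rw [div_le_iff₀ hs, Real.mul_self_sqrt he.le]
          exact hDe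
        simpa [meanModulus] using this

theorem meanModulus_nonneg (h01 : ∀ s, 0 ≤ s → w s ∈ Set.Icc (0 : ℝ) 1) (e : ℝ) :
    0 ≤ meanModulus w e :=
  add_nonneg (h01 _ (Real.sqrt_nonneg _)).1 (Real.sqrt_nonneg _)

/-- The limit of `w` is taken along positive arguments, hence the condition that `e` be eventually
positive. -/
theorem tendsto_meanModulus (hw : Tendsto w (𝓝[>] 0) (𝓝 0)) {e : ℕ → ℝ}
    (he : Tendsto e atTop (𝓝 0)) (hpos : ∀ᶠ n in atTop, 0 < e n) :
    Tendsto (fun n => meanModulus w (e n)) atTop (𝓝 0) := by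
  have h1 : Tendsto (fun n => √(e n)) atTop (𝓝 0) := by
    have := (Real.continuous_sqrt.tendsto 0).comp he
    rwa [Real.sqrt_zero] at this
  have h2 : Tendsto (fun n => √(e n)) atTop (𝓝[>] 0) :=
    tendsto_nhdsWithin_iff.2 ⟨h1, hpos.mono fun n hn => Real.sqrt_pos.2 hn⟩
  simpa [meanModulus] using (hw.comp h2).add h1

/-- Bounds, for the game with `n` opponents, on the probability that a player's state differs from
its mean field approximation up to time `t`. -/
noncomputable def couplingBound (w : ℝ → ℝ) (c : ℝ) (n : ℕ) : ℕ → ℝ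
  | 0 => 0
  | t + 1 => couplingBound w c n t + meanModulus w (couplingBound w c n t + c / √(n : ℝ))

theorem couplingBound_nonneg (h01 : ∀ s, 0 ≤ s → w s ∈ Set.Icc (0 : ℝ) 1) (c : ℝ) (n t : ℕ) :
    0 ≤ couplingBound w c n t := by
  induction t with
  | zero => exact le_rfl
  | succ t ih => exact add_nonneg ih (meanModulus_nonneg h01 _)

theorem tendsto_div_sqrt (c : ℝ) : Tendsto (fun n : ℕ => c / √(n : ℝ)) atTop (𝓝 0) :=
  Tendsto.div_atTop tendsto_const_nhds
    (Real.tendsto_sqrt_atTop.comp tendsto_natCast_atTop_atTop)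

theorem tendsto_couplingBound (h01 : ∀ s, 0 ≤ s → w s ∈ Set.Icc (0 : ℝ) 1)
    (hw : Tendsto w (𝓝[>] 0) (𝓝 0)) {c : ℝ} (hc : 0 < c) (t : ℕ) :
    Tendsto (fun n => couplingBound w c n t) atTop (𝓝 0) := by
  induction t with
  | zero => exact tendsto_const_nhds
  | succ t ih =>
    have h := ih.add (tendsto_div_sqrt c)
    rw [add_zero] at h
    have := ih.add (tendsto_meanModulus hw h ?_)
    · simpa [couplingBound] using this
    -- The term `c / √n` keeps the argument positive, also for `t = 0`, where `couplingBound`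
    -- vanishes.
    · filter_upwards [eventually_gt_atTop 0] with n hn
      have : 0 < √(n : ℝ) := Real.sqrt_pos.2 (by exact_mod_cast hn)
      have := couplingBound_nonneg h01 c n t
      positivity

end Modulus

/-! ### The private randomness of a player -/

section Noise

variable {T : ℕ} {𝒳 Γ : Type u} [Fintype 𝒳] [MeasurableSpace 𝒳]

/-- The private randomness of a player: initial state, randomization of the suggestion, noise. -/
abbrev Noise (T : ℕ) (𝒳 : Type u) : Type u := 𝒳 × I × (Fin T → I)

instance instIsProbabilityMeasureToMeasure (m : PM 𝒳) : IsProbabilityMeasure m.toMeasure := by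
  constructor
  unfold PM.toMeasure
  rw [Measure.finsetSum_apply]
  simp only [Measure.smul_apply, measure_univ, smul_eq_mul, mul_one]
  rw [← ENNReal.ofReal_sum_of_nonneg fun x _ => m.2.1 x, m.2.2, ENNReal.ofReal_one]

/-- The law of the private randomness. -/
noncomputable def noiseLaw (T : ℕ) (m₀ : PM 𝒳) : Measure (Noise T 𝒳) :=
  m₀.toMeasure.prod ((volume : Measure I).prod (Measure.pi fun _ => volume))

instance instIsProbabilityMeasureNoiseLaw (m₀ : PM 𝒳) :
    IsProbabilityMeasure (noiseLaw T m₀) := by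
  unfold noiseLaw
  infer_instance

/-- Replace the noise variable of one time step. -/
def setNoise (t : Fin T) (p : Noise T 𝒳 × I) : Noise T 𝒳 :=
  (p.1.1, p.1.2.1, Function.update p.1.2.2 t p.2)

theorem measurePreserving_setNoise (m₀ : PM 𝒳) (t : Fin T) :
    MeasurePreserving (setNoise (𝒳 := 𝒳) t) ((noiseLaw T m₀).prod volume) (noiseLaw T m₀) := by
  have h1 := measurePreserving_update (fun _ : Fin T => (volume : Measure I)) t
  have h2 := (MeasurePreserving.id (volume : Measure I)).prod h1
  have h3 := (MeasurePreserving.id m₀.toMeasure).prod h2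
  have e1 : MeasurePreserving (MeasurableEquiv.prodAssoc (α := 𝒳) (β := I × (Fin T → I)) (γ := I))
      ((noiseLaw T m₀).prod volume) (m₀.toMeasure.prod
        (((volume : Measure I).prod (Measure.pi fun _ => volume)).prod volume)) :=
    ⟨MeasurableEquiv.measurable _, Measure.prodAssoc_prod⟩
  have e2 : MeasurePreserving (MeasurableEquiv.prodAssoc (α := I) (β := Fin T → I) (γ := I))
      (((volume : Measure I).prod (Measure.pi fun _ => volume)).prod volume)
      ((volume : Measure I).prod ((Measure.pi fun _ => volume).prod volume)) :=
    ⟨MeasurableEquiv.measurable _, Measure.prodAssoc_prod⟩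
  exact h3.comp (((MeasurePreserving.id m₀.toMeasure).prod e2).comp e1)

/-- Replace the noise variable of one player in one time step. -/
def resample {N : ℕ} (j : Fin N) (t : Fin T) (p : (Fin N → Noise T 𝒳) × I) : Fin N → Noise T 𝒳 :=
  Function.update p.1 j (setNoise t (p.1 j, p.2))

theorem measurePreserving_resample {N : ℕ} (m₀ : PM 𝒳) (j : Fin N) (t : Fin T) :
    MeasurePreserving (resample (𝒳 := 𝒳) j t)
      ((Measure.pi fun _ : Fin N => noiseLaw T m₀).prod volume)
      (Measure.pi fun _ : Fin N => noiseLaw T m₀) :=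
  measurePreserving_update_of_measurePreserving (fun _ : Fin N => noiseLaw T m₀) j volume
    (measurePreserving_setNoise m₀ t)

end Noise

/-! ### Coordinates after a redraw. -/

section Resample

variable {T : ℕ} {𝒳 : Type u}

theorem resample_fst {N : ℕ} (j : Fin N) (t : Fin T) (ω : Fin N → Noise T 𝒳) (z : I) (k : Fin N) :
    (resample j t (ω, z) k).1 = (ω k).1 := by
  by_cases h : k = j
  · subst h; simp [resample, setNoise]
  · simp [resample, h]

theorem resample_snd {N : ℕ} (j : Fin N) (t : Fin T) (ω : Fin N → Noise T 𝒳) (z : I) (k : Fin N) :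
    (resample j t (ω, z) k).2.1 = (ω k).2.1 := by
  by_cases h : k = j
  · subst h; simp [resample, setNoise]
  · simp [resample, h]

theorem resample_self {N : ℕ} (j : Fin N) (t : Fin T) (ω : Fin N → Noise T 𝒳) (z : I) :
    (resample j t (ω, z) j).2.2 t = z := by
  simp [resample, setNoise]

theorem resample_ne {N : ℕ} (j : Fin N) {t s : Fin T} (hs : s ≠ t) (ω : Fin N → Noise T 𝒳) (z : I)
    (k : Fin N) : (resample j t (ω, z) k).2.2 s = (ω k).2.2 s := by
  by_cases h : k = j
  · subst h; simp [resample, setNoise, hs]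
  · simp [resample, h]

end Resample

/-! ### State processes -/

section Paths

variable {T : ℕ} {𝒳 Γ : Type u} [Fintype 𝒳]

/-- The restricted strategy suggested to a player with randomization `z` when the flow is `m`. -/
def sugg (α : (t : Fin T) → I × (Fin (t + 1 + 1) → PM 𝒳) → 𝒳 → Γ) (z : I) (m : Flow T 𝒳) :
    Restricted T 𝒳 Γ :=
  fun t => α t (z, upTo m (t + 1) t.isLt)

section NPlayers

variable {N : ℕ} [N.AtLeastTwo]

/-- One step of the `N`-player game when player `i` plays `ψ`. -/
noncomputable def nStep (G : GameData T 𝒳 Γ) (i : Fin N) (φ : Fin N → NStrategy N T 𝒳 Γ)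
    (ψ : NStrategy N T 𝒳 Γ) (ξ : Fin T → Fin N → I) (t : Fin T) (p : Fin (T + 1) → Fin N → 𝒳) :
    Fin N → 𝒳 :=
  fun j => G.Ψ t (p t.castSucc j) (empOthers (p t.castSucc) j).1
    (action (if j = i then ψ else φ j) j p t) (ξ t j)

/-- The states in the `N`-player game when player `i` plays `ψ`. -/
noncomputable def nPath (G : GameData T 𝒳 Γ) (i : Fin N) (x₀ : Fin N → 𝒳)
    (φ : Fin N → NStrategy N T 𝒳 Γ) (ψ : NStrategy N T 𝒳 Γ) (ξ : Fin T → Fin N → I) :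
    Fin (T + 1) → Fin N → 𝒳 :=
  recPath x₀ (nStep G i φ ψ ξ)

theorem action_congr (ψ : NStrategy N T 𝒳 Γ) (j : Fin N) {p q : Fin (T + 1) → Fin N → 𝒳}
    (t : Fin T) (h : ∀ s : Fin (T + 1), (s : ℕ) ≤ t → p s = q s) :
    action ψ j p t = action ψ j q t := by
  unfold action
  rw [upTo_congr (p := fun s => p s j) (q := fun s => q s j) t _ fun s hs => by rw [h s hs],
    upTo_congr (p := fun s => empOthers (p s) j) (q := fun s => empOthers (q s) j) t _
      fun s hs => by rw [h s hs]]

theorem isProgressiveStep_nStep (G : GameData T 𝒳 Γ) (i : Fin N) (φ : Fin N → NStrategy N T 𝒳 Γ)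
    (ψ : NStrategy N T 𝒳 Γ) (ξ : Fin T → Fin N → I) : IsProgressiveStep (nStep G i φ ψ ξ) := by
  intro t p q h
  funext j
  unfold nStep
  rw [action_congr _ j t h, h t.castSucc (by simp)]

theorem nPath_succ (G : GameData T 𝒳 Γ) (i : Fin N) (x₀ : Fin N → 𝒳)
    (φ : Fin N → NStrategy N T 𝒳 Γ) (ψ : NStrategy N T 𝒳 Γ) (ξ : Fin T → Fin N → I) (t : Fin T) :
    nPath G i x₀ φ ψ ξ t.succ = nStep G i φ ψ ξ t (nPath G i x₀ φ ψ ξ) :=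
  recPath_succ _ (isProgressiveStep_nStep G i φ ψ ξ) t

/-- The states in the `N`-player game, when the players' suggestions are generated from the flow `m`
and player `i` modifies the suggestion by `g`. -/
noncomputable def couplePath (G : GameData T 𝒳 Γ)
    (α : (t : Fin T) → I × (Fin (t + 1 + 1) → PM 𝒳) → 𝒳 → Γ) (i : Fin N)
    (g : NStrategy N T 𝒳 Γ → NStrategy N T 𝒳 Γ) (m : Flow T 𝒳) (ω : Fin N → Noise T 𝒳) :
    Fin (T + 1) → Fin N → 𝒳 :=
  nPath G i (fun j => (ω j).1) (fun j => (sugg α (ω j).2.1 m).toNStrategy N)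
    (g ((sugg α (ω i).2.1 m).toNStrategy N)) fun t j => (ω j).2.2 t

open Classical in
/-- One step of the states of all players, when the states of player `i` are prescribed. -/
noncomputable def othersStep (G : GameData T 𝒳 Γ)
    (α : (t : Fin T) → I × (Fin (t + 1 + 1) → PM 𝒳) → 𝒳 → Γ) (i : Fin N)
    (m : Flow T 𝒳) (ω : Fin N → Noise T 𝒳) (x : Fin (T + 1) → 𝒳) (t : Fin T)
    (p : Fin (T + 1) → Fin N → 𝒳) : Fin N → 𝒳 :=
  fun j => if j = i then x t.succ else
    G.Ψ t (p t.castSucc j) (empOthers (p t.castSucc) j).1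
      (sugg α (ω j).2.1 m t (p t.castSucc j)) ((ω j).2.2 t)

/-- The states of all players, when the states of player `i` are prescribed. -/
noncomputable def othersPath (G : GameData T 𝒳 Γ)
    (α : (t : Fin T) → I × (Fin (t + 1 + 1) → PM 𝒳) → 𝒳 → Γ) (i : Fin N)
    (m : Flow T 𝒳) (ω : Fin N → Noise T 𝒳) (x : Fin (T + 1) → 𝒳) : Fin (T + 1) → Fin N → 𝒳 :=
  recPath (Function.update (fun j => (ω j).1) i (x 0)) (othersStep G α i m ω x)

/-- The action of player `i` under `ψ` along the path `x`, when the other players react to it. -/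
noncomputable def reactAction (G : GameData T 𝒳 Γ)
    (α : (t : Fin T) → I × (Fin (t + 1 + 1) → PM 𝒳) → 𝒳 → Γ) (i : Fin N)
    (ψ : NStrategy N T 𝒳 Γ) (m : Flow T 𝒳) (ω : Fin N → Noise T 𝒳) (x : Fin (T + 1) → 𝒳)
    (t : Fin T) : Γ :=
  ψ t (upTo x t t.isLt.le, upTo (fun s => empOthers (othersPath G α i m ω x s) i) t t.isLt.le)

/-- The states of player `i`, when the flow `m` replaces the empirical measures in the dynamics of
player `i`, but not in the strategy. -/
noncomputable def limitPath (G : GameData T 𝒳 Γ)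
    (α : (t : Fin T) → I × (Fin (t + 1 + 1) → PM 𝒳) → 𝒳 → Γ) (i : Fin N)
    (g : NStrategy N T 𝒳 Γ → NStrategy N T 𝒳 Γ) (m : Flow T 𝒳) (ω : Fin N → Noise T 𝒳) :
    Fin (T + 1) → 𝒳 :=
  recPath (ω i).1 fun t x => G.Ψ t (x t.castSucc) (m t.castSucc)
    (reactAction G α i (g ((sugg α (ω i).2.1 m).toNStrategy N)) m ω x t) ((ω i).2.2 t)

theorem isProgressiveStep_othersStep (G : GameData T 𝒳 Γ)
    (α : (t : Fin T) → I × (Fin (t + 1 + 1) → PM 𝒳) → 𝒳 → Γ) (i : Fin N)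
    (m : Flow T 𝒳) (ω : Fin N → Noise T 𝒳) (x : Fin (T + 1) → 𝒳) :
    IsProgressiveStep (othersStep G α i m ω x) := by
  intro t p q h
  funext j
  unfold othersStep
  rw [h t.castSucc (by simp)]

theorem othersPath_succ (G : GameData T 𝒳 Γ)
    (α : (t : Fin T) → I × (Fin (t + 1 + 1) → PM 𝒳) → 𝒳 → Γ) (i : Fin N)
    (m : Flow T 𝒳) (ω : Fin N → Noise T 𝒳) (x : Fin (T + 1) → 𝒳) (t : Fin T) :
    othersPath G α i m ω x t.succ = othersStep G α i m ω x t (othersPath G α i m ω x) :=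
  recPath_succ _ (isProgressiveStep_othersStep G α i m ω x) t

/-- The reaction up to time `n` depends only on the prescribed path and on the flow up to time `n`,
and not on the randomness of player `i`. -/
theorem othersPath_congr (G : GameData T 𝒳 Γ)
    (α : (t : Fin T) → I × (Fin (t + 1 + 1) → PM 𝒳) → 𝒳 → Γ) (i : Fin N)
    {m m' : Flow T 𝒳} {ω ω' : Fin N → Noise T 𝒳} {x x' : Fin (T + 1) → 𝒳} (n : ℕ)
    (hm : ∀ s : Fin (T + 1), (s : ℕ) ≤ n → m s = m' s)
    (hω : ∀ j, j ≠ i → ω j = ω' j)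
    (hx : ∀ s : Fin (T + 1), (s : ℕ) ≤ n → x s = x' s) :
    ∀ s : Fin (T + 1), (s : ℕ) ≤ n → othersPath G α i m ω x s = othersPath G α i m' ω' x' s := by
  refine path_eq_of_step n ?_ fun t ht h => ?_
  · simp only [othersPath, recPath_zero]
    rw [hx 0 (Nat.zero_le _)]
    funext j
    by_cases hj : j = i
    · subst hj; simp
    · simp [hj, hω j hj]
  · rw [othersPath_succ, othersPath_succ]
    funext j
    unfold othersStep
    by_cases hj : j = i
    · simp only [hj, if_true]
      exact hx _ (by simpa using ht)
    · simp only [hj, if_false]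
      rw [h t.castSucc (by simp), hω j hj]
      unfold sugg
      -- The suggestion at time `t` reads the flow up to `t + 1`, but acts first on the state at
      -- time `t + 1 ≤ n`. One step of look-ahead is exactly what can be afforded here.
      rw [upTo_congr (p := m) (q := m') (t + 1) _ fun s hs => hm s (by omega)]

/-- The deviator's action at time `t` is progressive in its own states and the flow once the
opponents' randomness is frozen. This makes it admissible in the mean field game. -/
theorem reactAction_congr (G : GameData T 𝒳 Γ)
    (α : (t : Fin T) → I × (Fin (t + 1 + 1) → PM 𝒳) → 𝒳 → Γ) (i : Fin N) (ψ : NStrategy N T 𝒳 Γ)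
    {m m' : Flow T 𝒳} {ω ω' : Fin N → Noise T 𝒳} {x x' : Fin (T + 1) → 𝒳} (t : Fin T)
    (hm : ∀ s : Fin (T + 1), (s : ℕ) ≤ t → m s = m' s)
    (hω : ∀ j, j ≠ i → ω j = ω' j)
    (hx : ∀ s : Fin (T + 1), (s : ℕ) ≤ t → x s = x' s) :
    reactAction G α i ψ m ω x t = reactAction G α i ψ m' ω' x' t := by
  unfold reactAction
  rw [upTo_congr (t : ℕ) _ hx,
    upTo_congr (p := fun s => empOthers (othersPath G α i m ω x s) i)
      (q := fun s => empOthers (othersPath G α i m' ω' x' s) i) (t : ℕ) _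
      fun s hs => by rw [othersPath_congr G α i t hm hω hx s hs]]

theorem isProgressiveStep_limit (G : GameData T 𝒳 Γ)
    (α : (t : Fin T) → I × (Fin (t + 1 + 1) → PM 𝒳) → 𝒳 → Γ) (i : Fin N) (ψ : NStrategy N T 𝒳 Γ)
    (m : Flow T 𝒳) (ω : Fin N → Noise T 𝒳) (ξ : Fin T → I) :
    IsProgressiveStep fun (t : Fin T) (x : Fin (T + 1) → 𝒳) => G.Ψ t (x t.castSucc) (m t.castSucc)
      (reactAction G α i ψ m ω x t) (ξ t) := by
  intro t p q h
  beta_reduce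
  rw [h t.castSucc (by simp), reactAction_congr G α i ψ t (fun _ _ => rfl) (fun _ _ => rfl) h]

theorem limitPath_succ (G : GameData T 𝒳 Γ)
    (α : (t : Fin T) → I × (Fin (t + 1 + 1) → PM 𝒳) → 𝒳 → Γ) (i : Fin N)
    (g : NStrategy N T 𝒳 Γ → NStrategy N T 𝒳 Γ) (m : Flow T 𝒳) (ω : Fin N → Noise T 𝒳)
    (t : Fin T) :
    limitPath G α i g m ω t.succ = G.Ψ t (limitPath G α i g m ω t.castSucc) (m t.castSucc)
      (reactAction G α i (g ((sugg α (ω i).2.1 m).toNStrategy N)) m ω (limitPath G α i g m ω) t)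
      ((ω i).2.2 t) :=
  recPath_succ _ (isProgressiveStep_limit G α i _ m ω (ω i).2.2) t

/-- In the `N`-player game, the players react to the states of player `i`. -/
theorem couplePath_eq_othersPath (G : GameData T 𝒳 Γ)
    (α : (t : Fin T) → I × (Fin (t + 1 + 1) → PM 𝒳) → 𝒳 → Γ) (i : Fin N)
    (g : NStrategy N T 𝒳 Γ → NStrategy N T 𝒳 Γ) (m : Flow T 𝒳) (ω : Fin N → Noise T 𝒳) :
    couplePath G α i g m ω = othersPath G α i m ω fun s => couplePath G α i g m ω s i := by
  refine eq_recPath (isProgressiveStep_othersStep G α i m ω _) ?_ fun t => ?_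
  · funext j
    by_cases hj : j = i
    · subst hj; simp
    · simp [hj, couplePath, nPath, recPath_zero]
  · funext j
    by_cases hj : j = i
    · subst hj; simp [othersStep]
    · rw [couplePath, nPath_succ]
      simp only [othersStep, nStep, hj, if_false]
      rfl

/-- Since this is an identity, `couplePath` and `limitPath` prescribe the same actions as long as
the states of player `i` agree; no continuity of the strategy is involved. -/
theorem action_couplePath (G : GameData T 𝒳 Γ)
    (α : (t : Fin T) → I × (Fin (t + 1 + 1) → PM 𝒳) → 𝒳 → Γ) (i : Fin N)
    (g : NStrategy N T 𝒳 Γ → NStrategy N T 𝒳 Γ) (m : Flow T 𝒳) (ω : Fin N → Noise T 𝒳)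
    (ψ : NStrategy N T 𝒳 Γ) (t : Fin T) :
    action ψ i (couplePath G α i g m ω) t =
      reactAction G α i ψ m ω (fun s => couplePath G α i g m ω s i) t := by
  unfold reactAction
  rw [← couplePath_eq_othersPath]
  rfl

/-- The noise with index `t` enters first in the state at time `t + 1`. This expresses that it is
independent of the past. -/
theorem couplePath_resample (G : GameData T 𝒳 Γ)
    (α : (t : Fin T) → I × (Fin (t + 1 + 1) → PM 𝒳) → 𝒳 → Γ) (i : Fin N)
    (g : NStrategy N T 𝒳 Γ → NStrategy N T 𝒳 Γ) (m : Flow T 𝒳) (ω : Fin N → Noise T 𝒳)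
    (j : Fin N) (t : Fin T) (z : I) :
    ∀ s : Fin (T + 1), (s : ℕ) ≤ t →
      couplePath G α i g m (resample j t (ω, z)) s = couplePath G α i g m ω s := by
  unfold couplePath
  refine path_eq_of_step t ?_ fun r hr h => ?_
  · simp only [nPath, recPath_zero, resample_fst]
  · rw [nPath_succ, nPath_succ]
    funext k
    unfold nStep
    rw [action_congr _ k r h, h r.castSucc (by simp)]
    simp only [resample_snd]
    rw [resample_ne j (fun h => by subst h; omega)]

end NPlayers

/-- The states of a player who follows the suggestion in the mean field game with flow `m`. -/
def meanPath (G : GameData T 𝒳 Γ)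
    (α : (t : Fin T) → I × (Fin (t + 1 + 1) → PM 𝒳) → 𝒳 → Γ) (m : Flow T 𝒳) (w : Noise T 𝒳) :
    Fin (T + 1) → 𝒳 :=
  recPath w.1 fun t x => G.Ψ t (x t.castSucc) (m t.castSucc)
    (sugg α w.2.1 m t (x t.castSucc)) (w.2.2 t)

theorem meanPath_succ (G : GameData T 𝒳 Γ)
    (α : (t : Fin T) → I × (Fin (t + 1 + 1) → PM 𝒳) → 𝒳 → Γ) (m : Flow T 𝒳) (w : Noise T 𝒳)
    (t : Fin T) : meanPath G α m w t.succ = G.Ψ t (meanPath G α m w t.castSucc) (m t.castSucc)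
      (sugg α w.2.1 m t (meanPath G α m w t.castSucc)) (w.2.2 t) := by
  refine recPath_succ _ (fun t p q h => ?_) t
  rw [h t.castSucc (by simp)]

end Paths

/-! ### Measurability of the state processes -/

section Strategies

variable {T : ℕ} {𝒳 Γ : Type u} [MeasurableSpace Γ]

theorem measurable_upTo {β E : Type*} [MeasurableSpace β] [MeasurableSpace E]
    {x : E → Fin (T + 1) → β} (hx : Measurable x) (k : ℕ) (hk : k ≤ T) :
    Measurable fun e => upTo (x e) k hk :=
  measurable_pi_iff.2 fun _ => (measurable_pi_apply _).comp hx

theorem measurable_sugg [Fintype 𝒳] {α : (t : Fin T) → I × (Fin (t + 1 + 1) → PM 𝒳) → 𝒳 → Γ}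
    (hα : ∀ t, Measurable (α t)) {E : Type*} [MeasurableSpace E] {z : E → I} {M : E → Flow T 𝒳}
    (hz : Measurable z) (hM : Measurable M) : Measurable fun e => sugg α (z e) (M e) :=
  measurable_pi_iff.2 fun t => (hα t).comp (hz.prodMk (measurable_upTo hM _ _))

end Strategies

section Measurability

set_option linter.unusedSectionVars false

variable {T : ℕ} {𝒳 Γ : Type u} [Fintype 𝒳] [MeasurableSpace 𝒳] [DiscreteMeasurableSpace 𝒳]
  [Finite Γ] [MeasurableSpace Γ] [DiscreteMeasurableSpace Γ]

theorem measurable_apply_of_discrete {E : Type*} [MeasurableSpace E]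
    {φ : E → 𝒳 → Γ} {x : E → 𝒳} (hφ : Measurable φ) (hx : Measurable x) :
    Measurable fun e => φ e (x e) :=
  measurable_from_prod_countable_left (f := fun q : E × 𝒳 => φ q.1 q.2)
    (fun a => (measurable_pi_apply a).comp hφ) |>.comp (measurable_id.prodMk hx)

theorem measurable_step {G : GameData T 𝒳 Γ}
    (hΨ : ∀ t, Measurable fun q : (𝒳 × PM 𝒳 × Γ) × I => G.Ψ t q.1.1 q.1.2.1 q.1.2.2 q.2)
    {E : Type*} [MeasurableSpace E] (t : Fin T) {x : E → 𝒳} {M : E → PM 𝒳} {v : E → Γ} {ξ : E → I}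
    (hx : Measurable x) (hM : Measurable M) (hv : Measurable v) (hξ : Measurable ξ) :
    Measurable fun e => G.Ψ t (x e) (M e) (v e) (ξ e) :=
  (hΨ t).comp ((hx.prodMk (hM.prodMk hv)).prodMk hξ)

variable {G : GameData T 𝒳 Γ}
  (hΨ : ∀ t, Measurable fun q : (𝒳 × PM 𝒳 × Γ) × I => G.Ψ t q.1.1 q.1.2.1 q.1.2.2 q.2)
  {α : (t : Fin T) → I × (Fin (t + 1 + 1) → PM 𝒳) → 𝒳 → Γ} (hα : ∀ t, Measurable (α t))
  {E : Type*} [MeasurableSpace E] {M : E → Flow T 𝒳} (hM : Measurable M)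

include hΨ hα hM in
theorem measurable_meanPath {w : E → Noise T 𝒳} (hw : Measurable w) :
    Measurable fun e => meanPath G α (M e) (w e) := by
  refine measurable_recPath (measurable_fst.comp hw) fun t => ?_
  have hx : Measurable fun q : E × (Fin (T + 1) → 𝒳) => q.2 t.castSucc :=
    (measurable_pi_apply _).comp measurable_snd
  refine measurable_step hΨ t hx (((measurable_pi_apply _).comp hM).comp measurable_fst) ?_
    ((measurable_pi_apply t).comp (measurable_snd.comp (measurable_snd.comp
      (hw.comp measurable_fst))))
  exact measurable_apply_of_discrete ((measurable_pi_apply t).comp ((measurable_sugg hα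
    (measurable_fst.comp (measurable_snd.comp hw)) hM).comp measurable_fst)) hx

variable {N : ℕ} [N.AtLeastTwo]

include hΨ in
theorem measurable_nPath (i : Fin N) {x₀ : E → Fin N → 𝒳} {φ : E → Fin N → NStrategy N T 𝒳 Γ}
    {ψ : E → NStrategy N T 𝒳 Γ} {ξ : E → Fin T → Fin N → I} (hx₀ : Measurable x₀)
    (hφ : Measurable φ) (hψ : Measurable ψ) (hξ : Measurable ξ) :
    Measurable fun e => nPath G i (x₀ e) (φ e) (ψ e) (ξ e) := by
  refine measurable_recPath hx₀ fun t => measurable_pi_iff.2 fun j => ?_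
  refine measurable_step hΨ t ?_ ?_ ?_ ?_
  · exact (Measurable.of_discrete (f := fun p : Fin (T + 1) → Fin N → 𝒳 => p t.castSucc j)).comp
      measurable_snd
  · exact (Measurable.of_discrete (f := fun p : Fin (T + 1) → Fin N → 𝒳 =>
      (empOthers (p t.castSucc) j).1)).comp measurable_snd
  · exact (Measurable.of_discrete (f := fun r : ((Fin N → NStrategy N T 𝒳 Γ) × NStrategy N T 𝒳 Γ) ×
      (Fin (T + 1) → Fin N → 𝒳) => action (if j = i then r.1.2 else r.1.1 j) j r.2 t)).comp
      (((hφ.prodMk hψ).comp measurable_fst).prodMk measurable_snd)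
  · exact (measurable_pi_apply j).comp ((measurable_pi_apply t).comp (hξ.comp measurable_fst))

variable {ω : E → Fin N → Noise T 𝒳} (hω : Measurable ω)

include hα hM hω in
theorem measurable_sugg_apply (j : Fin N) :
    Measurable fun e => sugg α (ω e j).2.1 (M e) :=
  measurable_sugg hα (measurable_fst.comp (measurable_snd.comp
    ((measurable_pi_apply j).comp hω))) hM

include hα hM hω in
theorem measurable_modified (i : Fin N) (g : NStrategy N T 𝒳 Γ → NStrategy N T 𝒳 Γ) :
    Measurable fun e => g ((sugg α (ω e i).2.1 (M e)).toNStrategy N) :=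
  (Measurable.of_discrete (f := fun φ : Restricted T 𝒳 Γ => g (φ.toNStrategy N))).comp
    (measurable_sugg_apply hα hM hω i)

include hΨ hα hM hω

theorem measurable_couplePath (i : Fin N) (g : NStrategy N T 𝒳 Γ → NStrategy N T 𝒳 Γ) :
    Measurable fun e => couplePath G α i g (M e) (ω e) := by
  have hj : ∀ j, Measurable fun e => ω e j := fun j => (measurable_pi_apply j).comp hω
  refine measurable_nPath hΨ i ?_ ?_ (measurable_modified hα hM hω i g) ?_
  · exact measurable_pi_iff.2 fun j => measurable_fst.comp (hj j)
  · exact measurable_pi_iff.2 fun j => measurable_modified hα hM hω j id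
  · exact measurable_pi_iff.2 fun t => measurable_pi_iff.2 fun j =>
      (measurable_pi_apply t).comp (measurable_snd.comp (measurable_snd.comp (hj j)))

theorem measurable_othersPath (i : Fin N) {x : E → Fin (T + 1) → 𝒳} (hx : Measurable x) :
    Measurable fun e => othersPath G α i (M e) (ω e) (x e) := by
  have hj : ∀ j, Measurable fun e => ω e j := fun j => (measurable_pi_apply j).comp hω
  refine measurable_recPath ?_ fun t => measurable_pi_iff.2 fun j => ?_
  · exact (measurable_update_prod (β := fun _ : Fin N => 𝒳) i).comp
      ((measurable_pi_iff.2 fun j => measurable_fst.comp (hj j)).prodMk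
        ((measurable_pi_apply 0).comp hx))
  · by_cases h : j = i
    · simp only [othersStep, h, if_true]
      exact (measurable_pi_apply _).comp (hx.comp measurable_fst)
    · simp only [othersStep, h, if_false]
      have hp : Measurable fun q : E × (Fin (T + 1) → Fin N → 𝒳) => q.2 t.castSucc j :=
        (measurable_pi_apply j).comp ((measurable_pi_apply _).comp measurable_snd)
      refine measurable_step hΨ t hp ?_ ?_ ?_
      · exact (Measurable.of_discrete (f := fun p : Fin (T + 1) → Fin N → 𝒳 =>
          (empOthers (p t.castSucc) j).1)).comp measurable_snd
      · exact measurable_apply_of_discrete ((measurable_pi_apply t).comp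
          ((measurable_sugg_apply hα hM hω j).comp measurable_fst)) hp
      · exact (measurable_pi_apply t).comp (measurable_snd.comp (measurable_snd.comp
          ((hj j).comp measurable_fst)))

theorem measurable_reactAction (i : Fin N) {ψ : E → NStrategy N T 𝒳 Γ} (hψ : Measurable ψ)
    {x : E → Fin (T + 1) → 𝒳} (hx : Measurable x) (t : Fin T) :
    Measurable fun e => reactAction G α i (ψ e) (M e) (ω e) (x e) t :=
  (Measurable.of_discrete (f := fun r : (NStrategy N T 𝒳 Γ × (Fin (T + 1) → 𝒳)) ×
      (Fin (T + 1) → Fin N → 𝒳) => r.1.1 t (upTo r.1.2 t t.isLt.le,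
        upTo (fun s => empOthers (r.2 s) i) t t.isLt.le))).comp
    ((hψ.prodMk hx).prodMk (measurable_othersPath hΨ hα hM hω i hx))

theorem measurable_limitPath (i : Fin N) (g : NStrategy N T 𝒳 Γ → NStrategy N T 𝒳 Γ) :
    Measurable fun e => limitPath G α i g (M e) (ω e) := by
  have hi : Measurable fun e => ω e i := (measurable_pi_apply i).comp hω
  refine measurable_recPath (measurable_fst.comp hi) fun t => ?_
  have hM' : Measurable fun q : E × (Fin (T + 1) → 𝒳) => M q.1 := hM.comp measurable_fst
  have hω' : Measurable fun q : E × (Fin (T + 1) → 𝒳) => ω q.1 := hω.comp measurable_fst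
  refine measurable_step hΨ t ((measurable_pi_apply _).comp measurable_snd)
    ((measurable_pi_apply _).comp hM') ?_ ((measurable_pi_apply t).comp (measurable_snd.comp
      (measurable_snd.comp (hi.comp measurable_fst))))
  exact measurable_reactAction hΨ hα hM' hω' i (measurable_modified hα hM' hω' i g) measurable_snd t

end Measurability

/-! ### Propagation of chaos -/

section Coupling

set_option linter.unusedSectionVars false

variable {T : ℕ} {𝒳 Γ : Type u} [Fintype 𝒳] [MeasurableSpace 𝒳] [DiscreteMeasurableSpace 𝒳]
  [Finite Γ] [MeasurableSpace Γ] [DiscreteMeasurableSpace Γ] {G : GameData T 𝒳 Γ}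
  (hΨ : ∀ t, Measurable fun q : (𝒳 × PM 𝒳 × Γ) × I => G.Ψ t q.1.1 q.1.2.1 q.1.2.2 q.2)
  {w : ℝ → ℝ} (hmono : MonotoneOn w (Set.Ici 0)) (h01 : ∀ s, 0 ≤ s → w s ∈ Set.Icc (0 : ℝ) 1)
  (hw : ∀ (t : Fin T) (x : 𝒳) (u : Γ) (m m' : PM 𝒳),
      (volume : Measure I) {z | G.Ψ t x m u z ≠ G.Ψ t x m' u z} ≤ ENNReal.ofReal (w (tvDist m m')))
  (m₀ : PM 𝒳) {N : ℕ}

include hΨ hw in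
-- State, measure and action do not depend on the noise about to be used. Redrawing that noise and
-- integrating over it first reduces the claim to the modulus assumption with frozen arguments.
theorem measure_step_ne_le (j : Fin N) (t : Fin T) {x : (Fin N → Noise T 𝒳) → 𝒳}
    {M : (Fin N → Noise T 𝒳) → PM 𝒳} {v : (Fin N → Noise T 𝒳) → Γ} (m : PM 𝒳)
    (hx : Measurable x) (hM : Measurable M) (hv : Measurable v)
    (hxr : ∀ ω z, x (resample j t (ω, z)) = x ω) (hMr : ∀ ω z, M (resample j t (ω, z)) = M ω)
    (hvr : ∀ ω z, v (resample j t (ω, z)) = v ω) :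
    (Measure.pi fun _ : Fin N => noiseLaw T m₀)
        {ω | G.Ψ t (x ω) (M ω) (v ω) ((ω j).2.2 t) ≠ G.Ψ t (x ω) m (v ω) ((ω j).2.2 t)} ≤
      ∫⁻ ω, ENNReal.ofReal (w (tvDist (M ω) m)) ∂(Measure.pi fun _ : Fin N => noiseLaw T m₀) := by
  have hξ : Measurable fun ω : Fin N → Noise T 𝒳 => (ω j).2.2 t :=
    (measurable_pi_apply t).comp (measurable_snd.comp (measurable_snd.comp (measurable_pi_apply j)))
  have hS : MeasurableSet
      {ω | G.Ψ t (x ω) (M ω) (v ω) ((ω j).2.2 t) ≠ G.Ψ t (x ω) m (v ω) ((ω j).2.2 t)} :=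
    (measurableSet_eq_fun (measurable_step hΨ t hx hM hv hξ)
      (measurable_step hΨ t hx measurable_const hv hξ)).compl
  rw [← (measurePreserving_resample m₀ j t).measure_preimage hS.nullMeasurableSet,
    Measure.prod_apply ((measurePreserving_resample m₀ j t).measurable hS)]
  refine lintegral_mono fun ω => ?_
  refine le_trans (le_of_eq ?_) (hw t (x ω) (v ω) (M ω) m)
  congr 1
  ext z
  simp only [Set.mem_preimage, Set.mem_ofPred_eq, hxr, hMr, hvr, resample_self]

include hΨ hw in
-- If two paths agree up to time `t`, they separate at `t + 1` only if one step with common state,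
-- action and noise distinguishes `M` from `m`. It is used for opponents against `meanPath` and for
-- player `i` against `limitPath`.
theorem measure_path_ne_succ_le (j : Fin N) (t : Fin T)
    {A B : (Fin N → Noise T 𝒳) → Fin (T + 1) → 𝒳}
    {M : (Fin N → Noise T 𝒳) → PM 𝒳} {v : (Fin N → Noise T 𝒳) → Γ} (m : PM 𝒳)
    (hA : Measurable A) (hM : Measurable M) (hv : Measurable v)
    (hAr : ∀ ω z, A (resample j t (ω, z)) t.castSucc = A ω t.castSucc)
    (hMr : ∀ ω z, M (resample j t (ω, z)) = M ω) (hvr : ∀ ω z, v (resample j t (ω, z)) = v ω)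
    (hAs : ∀ ω, A ω t.succ = G.Ψ t (A ω t.castSucc) (M ω) (v ω) ((ω j).2.2 t))
    (hBs : ∀ ω, (∀ s : Fin (T + 1), (s : ℕ) ≤ t → A ω s = B ω s) →
      B ω t.succ = G.Ψ t (A ω t.castSucc) m (v ω) ((ω j).2.2 t)) :
    (Measure.pi fun _ : Fin N => noiseLaw T m₀)
        {ω | ∃ s : Fin (T + 1), (s : ℕ) ≤ (t : ℕ) + 1 ∧ A ω s ≠ B ω s} ≤
      (Measure.pi fun _ : Fin N => noiseLaw T m₀)
        {ω | ∃ s : Fin (T + 1), (s : ℕ) ≤ t ∧ A ω s ≠ B ω s} +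
      ∫⁻ ω, ENNReal.ofReal (w (tvDist (M ω) m)) ∂(Measure.pi fun _ : Fin N => noiseLaw T m₀) := by
  refine le_trans (measure_mono fun ω hω => ?_) ((measure_union_le _ _).trans
    (add_le_add_right (measure_step_ne_le hΨ hw m₀ j t m ((measurable_pi_apply _).comp hA) hM hv
      hAr hMr hvr) _))
  by_cases h : ∃ s : Fin (T + 1), (s : ℕ) ≤ t ∧ A ω s ≠ B ω s
  · exact Or.inl h
  · push Not at h
    refine Or.inr fun heq => ?_
    obtain ⟨s, hs, hne⟩ := hω
    rcases Nat.lt_or_ge (s : ℕ) (t + 1) with hlt | hge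
    · exact hne (h s (by omega))
    · have : s = t.succ := Fin.ext (by simp; omega)
      subst this
      exact hne (by rw [hAs, hBs ω h]; exact heq)

variable [N.AtLeastTwo] {α : (t : Fin T) → I × (Fin (t + 1 + 1) → PM 𝒳) → 𝒳 → Γ}
  (hα : ∀ t, Measurable (α t)) (i : Fin N) (g : NStrategy N T 𝒳 Γ → NStrategy N T 𝒳 Γ)
  {m : Flow T 𝒳}
  (hm : ∀ t x, (noiseLaw T m₀).real ((fun v => meanPath G α m v t) ⁻¹' {x}) = (m t).1 x)

omit [N.AtLeastTwo] in
theorem measure_toReal_le {Ω : Type*} [MeasurableSpace Ω] {P : Measure Ω} [IsProbabilityMeasure P]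
    {A B : Set Ω} {e : ℝ} {a : ℝ≥0∞} (h : P A ≤ P B + a) (ha : a ≤ ENNReal.ofReal e)
    (he : 0 ≤ e) : P.real A ≤ P.real B + e := by
  have h1 : P A ≤ P B + ENNReal.ofReal e := h.trans (by gcongr)
  have h2 := ENNReal.toReal_mono (by finiteness) h1
  rwa [ENNReal.toReal_add (by finiteness) (by finiteness), ENNReal.toReal_ofReal he] at h2

include hΨ hα hm in
-- The empirical measure is compared with that of the i.i.d. copies `meanPath`, which by `hm` have
-- law `m t`. The first distance counts disagreements, the second is the law of large numbers.
theorem integral_dist_le (t : Fin (T + 1)) {a : ℝ} (ha : 0 ≤ a)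
    (hc : ∀ j, j ≠ i → (Measure.pi fun _ : Fin N => noiseLaw T m₀).real
      {ω | couplePath G α i g m ω t j ≠ meanPath G α m (ω j) t} ≤ a) (j : Fin N) :
    ∫ ω, tvDist (empOthers (couplePath G α i g m ω t) j).1 (m t)
        ∂(Measure.pi fun _ : Fin N => noiseLaw T m₀) ≤
      a + (Fintype.card 𝒳 + 1 : ℝ) / √((N - 1 : ℕ) : ℝ) := by
  classical
  have hpos := natCast_pred_pos (N := N)
  set P := Measure.pi fun _ : Fin N => noiseLaw T m₀ with hP
  have hX : Measurable (couplePath G α i g m) :=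
    measurable_couplePath hΨ hα measurable_const measurable_id i g
  have hY : ∀ k : Fin N, Measurable fun ω : Fin N → Noise T 𝒳 => meanPath G α m (ω k) t :=
    fun k => (measurable_pi_apply t).comp
      (measurable_meanPath hΨ hα measurable_const (measurable_pi_apply k))
  have hne : ∀ k, MeasurableSet {ω | couplePath G α i g m ω t k ≠ meanPath G α m (ω k) t} :=
    fun k => (measurableSet_eq_fun ((measurable_pi_apply k).comp ((measurable_pi_apply t).comp hX))
      (hY k)).compl
  have hind : ∀ k : Fin N, (fun ω => if couplePath G α i g m ω t k ≠ meanPath G α m (ω k) t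
      then (1 : ℝ) else 0) =
      {ω | couplePath G α i g m ω t k ≠ meanPath G α m (ω k) t}.indicator fun _ => 1 := fun k => by
    funext ω
    simp [Set.indicator_apply]
  have hint : ∀ k : Fin N, Integrable (fun ω => if couplePath G α i g m ω t k ≠
      meanPath G α m (ω k) t then (1 : ℝ) else 0) P := fun k => by
    rw [hind]
    exact (integrable_const _).indicator (hne k)
  have hval : ∀ k : Fin N, ∫ ω, (if couplePath G α i g m ω t k ≠
      meanPath G α m (ω k) t then (1 : ℝ) else 0) ∂P =
      P.real {ω | couplePath G α i g m ω t k ≠ meanPath G α m (ω k) t} := fun k => by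
    rw [hind, integral_indicator_const _ (hne k)]
    simp
  have hYt : Measurable fun ω : Fin N → Noise T 𝒳 => fun k => meanPath G α m (ω k) t :=
    measurable_pi_iff.2 hY
  have hdY : Measurable fun ω : Fin N → Noise T 𝒳 =>
      tvDist (empOthers (fun k => meanPath G α m (ω k) t) j).1 (m t) :=
    (Measurable.of_discrete (f := fun p : Fin N → 𝒳 => tvDist (empOthers p j).1 (m t))).comp hYt
  have hdYi : Integrable (fun ω : Fin N → Noise T 𝒳 =>
      tvDist (empOthers (fun k => meanPath G α m (ω k) t) j).1 (m t)) P :=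
    Integrable.of_bound hdY.aestronglyMeasurable 1 (ae_of_all _ fun ω => by
      rw [Real.norm_of_nonneg (tvDist_nonneg _ _)]
      exact tvDist_le_one _ _)
  have hLLN := integral_tvDist_empOthers_le (noiseLaw T m₀) (Y := fun v => meanPath G α m v t)
    ((measurable_pi_apply t).comp (measurable_meanPath hΨ hα measurable_const measurable_id))
    (hm t) j
  have hsumi : Integrable (fun ω => (∑ k ∈ Finset.univ.erase j,
      if couplePath G α i g m ω t k ≠ meanPath G α m (ω k) t then (1 : ℝ) else 0) /
        ((N - 1 : ℕ) : ℝ)) P :=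
    (integrable_finsetSum _ fun k _ => hint k).div_const _
  have hcard : ((Finset.univ.erase j).card : ℝ) = ((N - 1 : ℕ) : ℝ) := by
    rw [Finset.card_erase_of_mem (Finset.mem_univ j), Finset.card_univ, Fintype.card_fin]
  calc ∫ ω, tvDist (empOthers (couplePath G α i g m ω t) j).1 (m t) ∂P
      ≤ ∫ ω, ((∑ k ∈ Finset.univ.erase j,
          if couplePath G α i g m ω t k ≠ meanPath G α m (ω k) t then (1 : ℝ) else 0) /
            ((N - 1 : ℕ) : ℝ) +
          tvDist (empOthers (fun k => meanPath G α m (ω k) t) j).1 (m t)) ∂P := by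
        refine integral_mono_of_nonneg (ae_of_all _ fun ω => tvDist_nonneg _ _)
          (hsumi.add hdYi) (ae_of_all _ fun ω => ?_)
        exact (tvDist_triangle _ (empOthers (fun k => meanPath G α m (ω k) t) j).1 _).trans
          (add_le_add_left (tvDist_empOthers_le _ _ j) _)
    _ = (∑ k ∈ Finset.univ.erase j,
          P.real {ω | couplePath G α i g m ω t k ≠ meanPath G α m (ω k) t}) / ((N - 1 : ℕ) : ℝ) +
        ∫ ω, tvDist (empOthers (fun k => meanPath G α m (ω k) t) j).1 (m t) ∂P := by
        rw [integral_add hsumi hdYi, integral_div, integral_finsetSum _ fun k _ => hint k]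
        simp only [hval]
    -- The deviator may be anywhere; its disagreement is bounded by one and costs `1/(N-1) ≤
    -- 1/√(N-1)`. This is the `+ 1` in the rate constant.
    _ ≤ (∑ k ∈ Finset.univ.erase j, (a + if k = i then 1 else 0)) / ((N - 1 : ℕ) : ℝ) +
        Fintype.card 𝒳 / √((N - 1 : ℕ) : ℝ) := by
        gcongr with k
        · by_cases hk : k = i
          · simp only [hk, if_true]
            linarith [measureReal_le_one (μ := P)
              (s := {ω | couplePath G α i g m ω t i ≠ meanPath G α m (ω i) t})]
          · simpa [hk] using hc k hk
    _ ≤ (((N - 1 : ℕ) : ℝ) * a + 1) / ((N - 1 : ℕ) : ℝ) +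
        Fintype.card 𝒳 / √((N - 1 : ℕ) : ℝ) := by
        gcongr
        rw [Finset.sum_add_distrib, Finset.sum_const, nsmul_eq_mul, hcard]
        gcongr
        rw [Finset.sum_ite_eq']
        split_ifs <;> norm_num
    _ ≤ a + (Fintype.card 𝒳 + 1 : ℝ) / √((N - 1 : ℕ) : ℝ) := by
        have h1 : (1 : ℝ) ≤ ((N - 1 : ℕ) : ℝ) := by
          have : 0 < N - 1 := by exact_mod_cast hpos
          exact_mod_cast this
        have h2 : √((N - 1 : ℕ) : ℝ) ≤ ((N - 1 : ℕ) : ℝ) := by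
          rw [Real.sqrt_le_left (by linarith)]
          nlinarith
        have h3 : 1 / ((N - 1 : ℕ) : ℝ) ≤ 1 / √((N - 1 : ℕ) : ℝ) :=
          one_div_le_one_div_of_le (Real.sqrt_pos.2 hpos) h2
        rw [add_div, mul_div_cancel_left₀ _ hpos.ne', add_div]
        linarith

/-- The constant in the rate of convergence of empirical measures. -/
noncomputable def rateConst (𝒳 : Type u) [Fintype 𝒳] : ℝ := Fintype.card 𝒳 + 1

theorem integrable_dist (t : Fin (T + 1)) (j : Fin N) (hX : Measurable (couplePath G α i g m)) :
    Integrable (fun ω => tvDist (empOthers (couplePath G α i g m ω t) j).1 (m t))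
      (Measure.pi fun _ : Fin N => noiseLaw T m₀) :=
  Integrable.of_bound ((Measurable.of_discrete (f := fun p : Fin (T + 1) → Fin N → 𝒳 =>
    tvDist (empOthers (p t) j).1 (m t))).comp hX).aestronglyMeasurable 1 (ae_of_all _ fun ω => by
      rw [Real.norm_of_nonneg (tvDist_nonneg _ _)]
      exact tvDist_le_one _ _)

include hΨ hα hm hmono h01 hw in
-- A discrete Gronwall argument: the disagreement of the opponents up to time `n` bounds the mean
-- distance of the empirical measures from `m n`, and this bounds the probability of a new
-- disagreement at the next step. The hypothesis must cover all opponents at once.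
theorem measure_others_ne_le (n : ℕ) (hn : n ≤ T) (j : Fin N) (hj : j ≠ i) :
    (Measure.pi fun _ : Fin N => noiseLaw T m₀).real
      {ω | ∃ s : Fin (T + 1), (s : ℕ) ≤ n ∧ couplePath G α i g m ω s j ≠ meanPath G α m (ω j) s} ≤
    couplingBound w (rateConst 𝒳) (N - 1) n := by
  have hX : Measurable (couplePath G α i g m) :=
    measurable_couplePath hΨ hα measurable_const measurable_id i g
  induction n generalizing j with
  | zero =>
    have : {ω : Fin N → Noise T 𝒳 | ∃ s : Fin (T + 1), (s : ℕ) ≤ 0 ∧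
        couplePath G α i g m ω s j ≠ meanPath G α m (ω j) s} = ∅ := by
      ext ω
      simp only [Set.mem_ofPred_eq, Set.mem_empty_iff_false, iff_false, not_exists, not_and, not_not]
      intro s hs
      have : s = 0 := Fin.ext (by simpa using hs)
      subst this
      simp [couplePath, nPath, meanPath, recPath_zero]
    rw [this]
    simp [couplingBound]
  | succ n ih =>
    have hnT : n < T := hn
    let t : Fin T := ⟨n, hnT⟩
    have hb := couplingBound_nonneg h01 (rateConst 𝒳) (N - 1) n
    have hd := integral_dist_le hΨ m₀ hα i g hm t.castSucc hb (fun k hk =>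
      le_trans (measureReal_mono fun ω hω => by exact ⟨t.castSucc, le_rfl, hω⟩) (ih hnT.le k hk)) j
    have hpos : 0 < couplingBound w (rateConst 𝒳) (N - 1) n +
        rateConst 𝒳 / √((N - 1 : ℕ) : ℝ) := by
      have := Real.sqrt_pos.2 (natCast_pred_pos (N := N))
      have : 0 < rateConst 𝒳 := by unfold rateConst; positivity
      positivity
    have hl := lintegral_modulus_le hmono h01 (fun ω => tvDist_nonneg _ _)
      (integrable_dist m₀ i g t.castSucc j hX) hpos hd
    have hs := measure_path_ne_succ_le hΨ hw m₀ j t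
      (A := fun ω s => couplePath G α i g m ω s j) (B := fun ω s => meanPath G α m (ω j) s)
      (M := fun ω => (empOthers (couplePath G α i g m ω t.castSucc) j).1)
      (v := fun ω => sugg α (ω j).2.1 m t (couplePath G α i g m ω t.castSucc j)) (m t.castSucc)
      (measurable_pi_iff.2 fun s => (measurable_pi_apply j).comp ((measurable_pi_apply s).comp hX))
      ((Measurable.of_discrete (f := fun p : Fin (T + 1) → Fin N → 𝒳 =>
        (empOthers (p t.castSucc) j).1)).comp hX)
      (measurable_apply_of_discrete ((measurable_pi_apply t).comp
        (measurable_sugg_apply hα measurable_const measurable_id j))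
        ((measurable_pi_apply j).comp ((measurable_pi_apply _).comp hX)))
      (fun ω z => by rw [couplePath_resample G α i g m ω j t z _ (by simp)])
      (fun ω z => by rw [couplePath_resample G α i g m ω j t z _ (by simp)])
      (fun ω z => by rw [couplePath_resample G α i g m ω j t z _ (by simp), resample_snd])
      (fun ω => by
        rw [couplePath, nPath_succ]
        simp only [nStep, hj, if_false]
        rfl)
      (fun ω h => by
        rw [meanPath_succ, ← h t.castSucc (by simp)])
    exact (measure_toReal_le hs hl (meanModulus_nonneg h01 _)).trans
      (add_le_add_left (ih hnT.le j hj) _)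

include hΨ hα hm hmono h01 hw in
theorem integral_dist_le_couplingBound (t : Fin (T + 1)) (j : Fin N) :
    ∫ ω, tvDist (empOthers (couplePath G α i g m ω t) j).1 (m t)
        ∂(Measure.pi fun _ : Fin N => noiseLaw T m₀) ≤
      couplingBound w (rateConst 𝒳) (N - 1) t + rateConst 𝒳 / √((N - 1 : ℕ) : ℝ) :=
  integral_dist_le hΨ m₀ hα i g hm t (couplingBound_nonneg h01 _ _ _) (fun k hk =>
    le_trans (measureReal_mono fun ω hω => by exact ⟨t, le_rfl, hω⟩)
      (measure_others_ne_le hΨ hmono h01 hw m₀ hα i g hm t (by omega) k hk)) j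

include hΨ hα hm hmono h01 hw in
-- The distance of the empirical measures from `m` is already controlled by the opponents, so the
-- errors of the single steps are just added up.
theorem measure_self_ne_le (n : ℕ) (hn : n ≤ T) :
    (Measure.pi fun _ : Fin N => noiseLaw T m₀).real
      {ω | ∃ s : Fin (T + 1), (s : ℕ) ≤ n ∧ couplePath G α i g m ω s i ≠ limitPath G α i g m ω s} ≤
    couplingBound w (rateConst 𝒳) (N - 1) n := by
  have hX : Measurable (couplePath G α i g m) :=
    measurable_couplePath hΨ hα measurable_const measurable_id i g
  induction n with
  | zero =>
    have : {ω : Fin N → Noise T 𝒳 | ∃ s : Fin (T + 1), (s : ℕ) ≤ 0 ∧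
        couplePath G α i g m ω s i ≠ limitPath G α i g m ω s} = ∅ := by
      ext ω
      simp only [Set.mem_ofPred_eq, Set.mem_empty_iff_false, iff_false, not_exists, not_and, not_not]
      intro s hs
      have : s = 0 := Fin.ext (by simpa using hs)
      subst this
      simp [couplePath, nPath, limitPath, recPath_zero]
    rw [this]
    simp [couplingBound]
  | succ n ih =>
    have hnT : n < T := hn
    let t : Fin T := ⟨n, hnT⟩
    have hb := couplingBound_nonneg h01 (rateConst 𝒳) (N - 1) n
    have hd := integral_dist_le_couplingBound hΨ hmono h01 hw m₀ hα i g hm t.castSucc i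
    have hpos : 0 < couplingBound w (rateConst 𝒳) (N - 1) n +
        rateConst 𝒳 / √((N - 1 : ℕ) : ℝ) := by
      have := Real.sqrt_pos.2 (natCast_pred_pos (N := N))
      have : 0 < rateConst 𝒳 := by unfold rateConst; positivity
      positivity
    have hl := lintegral_modulus_le hmono h01 (fun ω => tvDist_nonneg _ _)
      (integrable_dist m₀ i g t.castSucc i hX) hpos hd
    have hg := measurable_modified (M := fun _ => m) hα measurable_const measurable_id i g
    have hs := measure_path_ne_succ_le hΨ hw m₀ i t
      (A := fun ω s => couplePath G α i g m ω s i) (B := fun ω s => limitPath G α i g m ω s)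
      (M := fun ω => (empOthers (couplePath G α i g m ω t.castSucc) i).1)
      (v := fun ω => action (g ((sugg α (ω i).2.1 m).toNStrategy N)) i (couplePath G α i g m ω) t)
      (m t.castSucc)
      (measurable_pi_iff.2 fun s => (measurable_pi_apply i).comp ((measurable_pi_apply s).comp hX))
      ((Measurable.of_discrete (f := fun p : Fin (T + 1) → Fin N → 𝒳 =>
        (empOthers (p t.castSucc) i).1)).comp hX)
      ((Measurable.of_discrete (f := fun r : NStrategy N T 𝒳 Γ × (Fin (T + 1) → Fin N → 𝒳) =>
        action r.1 i r.2 t)).comp (hg.prodMk hX))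
      (fun ω z => by rw [couplePath_resample G α i g m ω i t z _ (by simp)])
      (fun ω z => by rw [couplePath_resample G α i g m ω i t z _ (by simp)])
      (fun ω z => by
        rw [resample_snd]
        exact action_congr _ i t (couplePath_resample G α i g m ω i t z))
      (fun ω => by
        rw [couplePath, nPath_succ]
        simp only [nStep, if_true])
      -- While the own states agree, the opponents' reactions coincide, so `limitPath` uses the same
      -- action as the `N`-player game.
      (fun ω h => by
        rw [limitPath_succ, ← h t.castSucc (by simp), action_couplePath,
          reactAction_congr G α i _ t (fun _ _ => rfl) (fun _ _ => rfl) fun s hs => (h s hs).symm])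
    exact (measure_toReal_le hs hl (meanModulus_nonneg h01 _)).trans (add_le_add_left (ih hnT.le) _)

end Coupling

/-! ### Costs -/

section Costs

variable {T : ℕ} {𝒳 Γ : Type u} [Fintype 𝒳]

/-- The costs along a path of states, measures and actions. -/
def pathCost (G : GameData T 𝒳 Γ) (x : Fin (T + 1) → 𝒳) (M : Flow T 𝒳) (v : Fin T → Γ) : ℝ :=
  (∑ t : Fin T, G.f t (x t.castSucc) (M t.castSucc) (v t)) + G.F (x (Fin.last T)) (M (Fin.last T))

theorem discDist_self {α : Type*} (a : α) : discDist a a = 0 := by simp [discDist]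

theorem discDist_nonneg {α : Type*} (a b : α) : 0 ≤ discDist a b := by
  unfold discDist
  split_ifs <;> norm_num

theorem discDist_le_one {α : Type*} (a b : α) : discDist a b ≤ 1 := by
  unfold discDist
  split_ifs <;> norm_num

variable {G : GameData T 𝒳 Γ} {L : ℝ}
  (hf : ∀ (t t' : Fin T) (x x' : 𝒳) (m m' : PM 𝒳) (u u' : Γ),
      |G.f t x m u - G.f t' x' m' u'| ≤
        L * (discDist t t' + discDist x x' + tvDist m m' + discDist u u'))
  (hF : ∀ (x x' : 𝒳) (m m' : PM 𝒳), |G.F x m - G.F x' m'| ≤ L * (discDist x x' + tvDist m m'))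

include hf hF

theorem abs_pathCost_sub_le (x : Fin (T + 1) → 𝒳) (M M' : Flow T 𝒳) (v : Fin T → Γ) :
    |pathCost G x M v - pathCost G x M' v| ≤ L * ∑ t, tvDist (M t) (M' t) := by
  unfold pathCost
  rw [add_sub_add_comm, ← Finset.sum_sub_distrib, Fin.sum_univ_castSucc, mul_add, Finset.mul_sum]
  refine (abs_add_le _ _).trans (add_le_add ((Finset.abs_sum_le_sum_abs _ _).trans
    (Finset.sum_le_sum fun t _ => ?_)) ?_)
  · simpa [discDist_self] using hf t t (x t.castSucc) (x t.castSucc) (M t.castSucc) (M' t.castSucc)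
      (v t) (v t)
  · simpa [discDist_self] using hF (x (Fin.last T)) (x (Fin.last T)) (M (Fin.last T))
      (M' (Fin.last T))

theorem exists_abs_pathCost_le [Nonempty 𝒳] [Nonempty Γ] (m₀ : PM 𝒳) :
    ∃ C, 0 ≤ C ∧ ∀ x M v, |pathCost G x M v| ≤ C := by
  obtain ⟨x₀⟩ := ‹Nonempty 𝒳›
  obtain ⟨u₀⟩ := ‹Nonempty Γ›
  -- No sign of `L` is assumed, hence `|L|`. The numbers 4 and 2 below count the distances in the
  -- two Lipschitz bounds, each at most one.
  have hL : ∀ d n : ℝ, 0 ≤ d → d ≤ n → L * d ≤ |L| * n := fun d n h0 h1 =>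
    (mul_le_mul_of_nonneg_right (le_abs_self L) h0).trans
      (mul_le_mul_of_nonneg_left h1 (abs_nonneg L))
  refine ⟨(∑ t : Fin T, (|G.f t x₀ m₀ u₀| + |L| * 4)) + (|G.F x₀ m₀| + |L| * 2), by positivity,
    fun x M v => ?_⟩
  refine (abs_add_le _ _).trans (add_le_add ((Finset.abs_sum_le_sum_abs _ _).trans
    (Finset.sum_le_sum fun t _ => ?_)) ?_)
  · have h1 := hf t t (x t.castSucc) x₀ (M t.castSucc) m₀ (v t) u₀
    have h2 := abs_sub_abs_le_abs_sub (G.f t (x t.castSucc) (M t.castSucc) (v t)) (G.f t x₀ m₀ u₀)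
    have h3 := hL (discDist t t + discDist (x t.castSucc) x₀ + tvDist (M t.castSucc) m₀ +
      discDist (v t) u₀) 4 (by
        have := discDist_nonneg t t
        have := discDist_nonneg (x t.castSucc) x₀
        have := tvDist_nonneg (M t.castSucc) m₀
        have := discDist_nonneg (v t) u₀
        linarith) (by
        have := discDist_le_one t t
        have := discDist_le_one (x t.castSucc) x₀
        have := tvDist_le_one (M t.castSucc) m₀
        have := discDist_le_one (v t) u₀
        linarith)
    linarith
  · have h1 := hF (x (Fin.last T)) x₀ (M (Fin.last T)) m₀
    have h2 := abs_sub_abs_le_abs_sub (G.F (x (Fin.last T)) (M (Fin.last T))) (G.F x₀ m₀)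
    have h3 := hL (discDist (x (Fin.last T)) x₀ + tvDist (M (Fin.last T)) m₀) 2 (by
        have := discDist_nonneg (x (Fin.last T)) x₀
        have := tvDist_nonneg (M (Fin.last T)) m₀
        linarith) (by
        have := discDist_le_one (x (Fin.last T)) x₀
        have := tvDist_le_one (M (Fin.last T)) m₀
        linarith)
    linarith

omit hf hF in
theorem continuous_of_tvDist {h : PM 𝒳 → ℝ} (hh : ∀ m m', |h m - h m'| ≤ L * tvDist m m') :
    Continuous h := by
  refine continuous_iff_continuousAt.2 fun m => tendsto_iff_dist_tendsto_zero.2 ?_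
  refine squeeze_zero (fun _ => dist_nonneg) (fun m' => hh m' m) ?_
  have hc : Continuous fun m' : PM 𝒳 => L * tvDist m' m := by
    unfold tvDist
    refine continuous_const.mul (continuous_const.mul (continuous_finsetSum _ fun x _ => ?_))
    exact (((continuous_apply x).comp continuous_subtype_val).sub continuous_const).abs
  have := hc.tendsto m
  simpa [tvDist] using this

/-- The costs are continuous in the measure for each of the finitely many states and actions. -/
theorem measurable_pathCost [MeasurableSpace 𝒳] [DiscreteMeasurableSpace 𝒳] [Finite Γ]
    [MeasurableSpace Γ] [DiscreteMeasurableSpace Γ] {E : Type*} [MeasurableSpace E]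
    {x : E → Fin (T + 1) → 𝒳} {M : E → Flow T 𝒳} {v : E → Fin T → Γ} (hx : Measurable x)
    (hM : Measurable M) (hv : Measurable v) :
    Measurable fun e => pathCost G (x e) (M e) (v e) := by
  refine (Finset.measurable_sum _ fun t _ => ?_).add ?_
  · have : Measurable fun q : (𝒳 × Γ) × PM 𝒳 => G.f t q.1.1 q.2 q.1.2 :=
      measurable_from_prod_countable_right fun r => (continuous_of_tvDist (L := L) fun m m' => by
        simpa [discDist_self] using hf t t r.1 r.1 m m' r.2 r.2).measurable
    exact this.comp ((((measurable_pi_apply t.castSucc).comp hx).prodMk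
      ((measurable_pi_apply t).comp hv)).prodMk ((measurable_pi_apply t.castSucc).comp hM))
  · have : Measurable fun q : 𝒳 × PM 𝒳 => G.F q.1 q.2 :=
      measurable_from_prod_countable_right fun r => (continuous_of_tvDist (L := L) fun m m' => by
        simpa [discDist_self] using hF r r m m').measurable
    exact this.comp (((measurable_pi_apply (Fin.last T)).comp hx).prodMk
      ((measurable_pi_apply (Fin.last T)).comp hM))

end Costs

/-! ### Replacing the empirical measures by the flow in the expected costs. -/

section CostGap

set_option linter.unusedSectionVars false

variable {T : ℕ} {𝒳 Γ : Type u} [Fintype 𝒳] {N : ℕ} [N.AtLeastTwo]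

/-- The costs of player `i` in the `N`-player game along `couplePath`. -/
noncomputable def coupleCost (G : GameData T 𝒳 Γ)
    (α : (t : Fin T) → I × (Fin (t + 1 + 1) → PM 𝒳) → 𝒳 → Γ) (i : Fin N)
    (g : NStrategy N T 𝒳 Γ → NStrategy N T 𝒳 Γ) (m : Flow T 𝒳) (ω : Fin N → Noise T 𝒳) : ℝ :=
  pathCost G (fun s => couplePath G α i g m ω s i)
    (fun s => (empOthers (couplePath G α i g m ω s) i).1)
    (action (g ((sugg α (ω i).2.1 m).toNStrategy N)) i (couplePath G α i g m ω))

/-- The costs of player `i` along `limitPath`. -/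
noncomputable def limitCost (G : GameData T 𝒳 Γ)
    (α : (t : Fin T) → I × (Fin (t + 1 + 1) → PM 𝒳) → 𝒳 → Γ) (i : Fin N)
    (g : NStrategy N T 𝒳 Γ → NStrategy N T 𝒳 Γ) (m : Flow T 𝒳) (ω : Fin N → Noise T 𝒳) : ℝ :=
  pathCost G (limitPath G α i g m ω) m
    (reactAction G α i (g ((sugg α (ω i).2.1 m).toNStrategy N)) m ω (limitPath G α i g m ω))

/-- The bound on the difference of expected costs, for the game with `n` opponents. -/
noncomputable def gapBound (T : ℕ) (w : ℝ → ℝ) (c L C : ℝ) (n : ℕ) : ℝ :=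
  |L| * ∑ t : Fin (T + 1), (couplingBound w c n t + c / √(n : ℝ)) + 2 * C * couplingBound w c n T

theorem gapBound_nonneg {w : ℝ → ℝ} (h01 : ∀ s, 0 ≤ s → w s ∈ Set.Icc (0 : ℝ) 1) {c : ℝ}
    (hc : 0 ≤ c) (L : ℝ) {C : ℝ} (hC : 0 ≤ C) (n : ℕ) : 0 ≤ gapBound T w c L C n := by
  have h := couplingBound_nonneg h01 c n
  exact add_nonneg (mul_nonneg (abs_nonneg _) (Finset.sum_nonneg fun t _ =>
    add_nonneg (h t) (by positivity))) (mul_nonneg (by positivity) (h T))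

theorem tendsto_gapBound {w : ℝ → ℝ} (h01 : ∀ s, 0 ≤ s → w s ∈ Set.Icc (0 : ℝ) 1)
    (hw : Tendsto w (𝓝[>] 0) (𝓝 0)) {c : ℝ} (hc : 0 < c) (L C : ℝ) :
    Tendsto (gapBound T w c L C) atTop (𝓝 0) := by
  have h := tendsto_couplingBound h01 hw hc
  have h1 : Tendsto (fun n : ℕ => ∑ t : Fin (T + 1), (couplingBound w c n t + c / √(n : ℝ)))
      atTop (𝓝 (∑ t : Fin (T + 1), (0 + 0))) :=
    tendsto_finsetSum _ fun t _ => (h t).add (tendsto_div_sqrt c)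
  have := (h1.const_mul |L|).add ((h T).const_mul (2 * C))
  simp only [add_zero, Finset.sum_const_zero, mul_zero] at this
  exact this

variable [MeasurableSpace 𝒳] [DiscreteMeasurableSpace 𝒳]
  [Finite Γ] [MeasurableSpace Γ] [DiscreteMeasurableSpace Γ] {G : GameData T 𝒳 Γ}
  (hΨ : ∀ t, Measurable fun q : (𝒳 × PM 𝒳 × Γ) × I => G.Ψ t q.1.1 q.1.2.1 q.1.2.2 q.2)
  {L : ℝ} (hf : ∀ (t t' : Fin T) (x x' : 𝒳) (m m' : PM 𝒳) (u u' : Γ),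
      |G.f t x m u - G.f t' x' m' u'| ≤
        L * (discDist t t' + discDist x x' + tvDist m m' + discDist u u'))
  (hF : ∀ (x x' : 𝒳) (m m' : PM 𝒳), |G.F x m - G.F x' m'| ≤ L * (discDist x x' + tvDist m m'))
  {α : (t : Fin T) → I × (Fin (t + 1 + 1) → PM 𝒳) → 𝒳 → Γ}
  (hα : ∀ t, Measurable (α t)) (i : Fin N) (g : NStrategy N T 𝒳 Γ → NStrategy N T 𝒳 Γ)

section

variable {E : Type*} [MeasurableSpace E] {M : E → Flow T 𝒳} (hM : Measurable M)
  {ω : E → Fin N → Noise T 𝒳} (hω : Measurable ω)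

include hΨ hf hF hα hM hω

theorem measurable_coupleCost : Measurable fun e => coupleCost G α i g (M e) (ω e) := by
  have hX := measurable_couplePath hΨ hα hM hω i g
  have hg := measurable_modified hα hM hω i g
  refine measurable_pathCost hf hF ?_ ?_ ?_
  · exact (Measurable.of_discrete (f := fun p : Fin (T + 1) → Fin N → 𝒳 => fun s => p s i)).comp hX
  · exact (Measurable.of_discrete (f := fun p : Fin (T + 1) → Fin N → 𝒳 =>
      fun s => (empOthers (p s) i).1)).comp hX
  · exact (Measurable.of_discrete (f := fun r : NStrategy N T 𝒳 Γ × (Fin (T + 1) → Fin N → 𝒳) =>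
        action r.1 i r.2)).comp (hg.prodMk hX)

theorem measurable_limitCost : Measurable fun e => limitCost G α i g (M e) (ω e) := by
  have hX := measurable_limitPath hΨ hα hM hω i g
  have hg := measurable_modified hα hM hω i g
  exact measurable_pathCost hf hF hX hM (measurable_pi_iff.2 fun t =>
    measurable_reactAction hΨ hα hM hω i hg hX t)

end

variable {w : ℝ → ℝ} (hmono : MonotoneOn w (Set.Ici 0))
  (h01 : ∀ s, 0 ≤ s → w s ∈ Set.Icc (0 : ℝ) 1)
  (hw : ∀ (t : Fin T) (x : 𝒳) (u : Γ) (m m' : PM 𝒳),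
      (volume : Measure I) {z | G.Ψ t x m u z ≠ G.Ψ t x m' u z} ≤ ENNReal.ofReal (w (tvDist m m')))
  (m₀ : PM 𝒳) {m : Flow T 𝒳}
  (hm : ∀ t x, (noiseLaw T m₀).real ((fun v => meanPath G α m v t) ⁻¹' {x}) = (m t).1 x)
  {C : ℝ} (hC : ∀ x M v, |pathCost G x M v| ≤ C)

include hΨ hf hF hα hmono h01 hw hm hC in
-- Where the two paths of player `i` agree, so do the actions, and only the measures in the costs
-- differ: the Lipschitz bound applies. Where they disagree, the crude bound `2 * C` is multiplied
-- by a small probability. The result is uniform in `m` and `g`.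
theorem abs_integral_cost_sub_le :
    |∫ ω, coupleCost G α i g m ω ∂(Measure.pi fun _ : Fin N => noiseLaw T m₀) -
      ∫ ω, limitCost G α i g m ω ∂(Measure.pi fun _ : Fin N => noiseLaw T m₀)| ≤
      gapBound T w (rateConst 𝒳) L C (N - 1) := by
  classical
  set P := Measure.pi fun _ : Fin N => noiseLaw T m₀ with hP
  have hX : Measurable (couplePath G α i g m) :=
    measurable_couplePath hΨ hα measurable_const measurable_id i g
  have hXl : Measurable (limitPath G α i g m) :=
    measurable_limitPath hΨ hα measurable_const measurable_id i g
  have hc : Integrable (coupleCost G α i g m) P := Integrable.of_bound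
    (measurable_coupleCost hΨ hf hF hα i g measurable_const measurable_id).aestronglyMeasurable C
    (ae_of_all _ fun ω => hC _ _ _)
  have hl : Integrable (limitCost G α i g m) P := Integrable.of_bound
    (measurable_limitCost hΨ hf hF hα i g measurable_const measurable_id).aestronglyMeasurable C
    (ae_of_all _ fun ω => hC _ _ _)
  set S : Set (Fin N → Noise T 𝒳) :=
    {ω | ∃ s : Fin (T + 1), (s : ℕ) ≤ T ∧ couplePath G α i g m ω s i ≠ limitPath G α i g m ω s}
    with hS
  have hSm : MeasurableSet S := by
    have : S = (fun ω => (couplePath G α i g m ω, limitPath G α i g m ω)) ⁻¹'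
        {r | ∃ s : Fin (T + 1), (s : ℕ) ≤ T ∧ r.1 s i ≠ r.2 s} := rfl
    rw [this]
    exact (hX.prodMk hXl) (MeasurableSet.of_discrete)
  have hC0 : 0 ≤ C := by
    have ω₀ : Fin N → Noise T 𝒳 := (Measure.nonempty_of_neZero P).some
    exact (abs_nonneg _).trans (hC _ _ _ : |coupleCost G α i g m ω₀| ≤ C)
  have hdi : ∀ t, Integrable (fun ω => tvDist (empOthers (couplePath G α i g m ω t) i).1 (m t)) P :=
    fun t => integrable_dist m₀ i g t i hX
  have hpt : ∀ ω, |coupleCost G α i g m ω - limitCost G α i g m ω| ≤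
      |L| * ∑ t, tvDist (empOthers (couplePath G α i g m ω t) i).1 (m t) +
        S.indicator (fun _ => 2 * C) ω := by
    intro ω
    by_cases h : ω ∈ S
    · have h1 : 0 ≤ |L| * ∑ t, tvDist (empOthers (couplePath G α i g m ω t) i).1 (m t) :=
        mul_nonneg (abs_nonneg _) (Finset.sum_nonneg fun t _ => tvDist_nonneg _ _)
      rw [Set.indicator_of_mem h]
      have h2 := abs_sub (coupleCost G α i g m ω) (limitCost G α i g m ω)
      have h3 : |coupleCost G α i g m ω| ≤ C := hC _ _ _
      have h4 : |limitCost G α i g m ω| ≤ C := hC _ _ _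
      linarith
    · rw [Set.indicator_of_notMem h, add_zero]
      have hpath : (fun s => couplePath G α i g m ω s i) = limitPath G α i g m ω := by
        funext s
        by_contra hne
        exact h ⟨s, by omega, hne⟩
      have hact : action (g ((sugg α (ω i).2.1 m).toNStrategy N)) i (couplePath G α i g m ω) =
          reactAction G α i (g ((sugg α (ω i).2.1 m).toNStrategy N)) m ω
            (limitPath G α i g m ω) := by
        funext t
        rw [action_couplePath, hpath]
      unfold coupleCost limitCost
      rw [hact, hpath]
      refine (abs_pathCost_sub_le hf hF _ _ _ _).trans ?_
      exact mul_le_mul_of_nonneg_right (le_abs_self L)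
        (Finset.sum_nonneg fun t _ => tvDist_nonneg _ _)
  have hi1 : Integrable (fun ω => |L| * ∑ t, tvDist (empOthers (couplePath G α i g m ω t) i).1
      (m t)) P := (integrable_finsetSum _ fun t _ => hdi t).const_mul _
  have hi2 : Integrable (S.indicator fun _ => 2 * C) P := (integrable_const _).indicator hSm
  calc |∫ ω, coupleCost G α i g m ω ∂P - ∫ ω, limitCost G α i g m ω ∂P|
      = |∫ ω, (coupleCost G α i g m ω - limitCost G α i g m ω) ∂P| := by
        rw [integral_sub hc hl]
    _ ≤ ∫ ω, |coupleCost G α i g m ω - limitCost G α i g m ω| ∂P := abs_integral_le_integral_abs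
    _ ≤ ∫ ω, (|L| * ∑ t, tvDist (empOthers (couplePath G α i g m ω t) i).1 (m t) +
        S.indicator (fun _ => 2 * C) ω) ∂P :=
        integral_mono_of_nonneg (ae_of_all _ fun _ => abs_nonneg _) (hi1.add hi2)
          (ae_of_all _ hpt)
    _ = |L| * ∑ t, ∫ ω, tvDist (empOthers (couplePath G α i g m ω t) i).1 (m t) ∂P +
        2 * C * P.real S := by
        rw [integral_add hi1 hi2, integral_const_mul, integral_finsetSum _ fun t _ => hdi t,
          integral_indicator_const _ hSm, smul_eq_mul, mul_comm (P.real S)]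
    _ ≤ gapBound T w (rateConst 𝒳) L C (N - 1) := by
        unfold gapBound
        gcongr with t
        · exact integral_dist_le_couplingBound hΨ hmono h01 hw m₀ hα i g hm t i
        · exact measure_self_ne_le hΨ hmono h01 hw m₀ hα i g hm T le_rfl

end CostGap

/-! ### Rearranging product measures -/

section Rearrange

theorem measurePreserving_rotate {A B C : Type*} [MeasurableSpace A] [MeasurableSpace B]
    [MeasurableSpace C] (μ : Measure A) (ν : Measure B) (τ : Measure C) [SFinite μ] [SFinite ν]
    [SFinite τ] : MeasurePreserving (fun q : A × B × C => (q.2.1, q.1, q.2.2))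
      (μ.prod (ν.prod τ)) (ν.prod (μ.prod τ)) := by
  have h1 := (measurePreserving_prodAssoc μ ν τ).symm
  have h2 := (Measure.measurePreserving_swap (μ := μ) (ν := ν)).prod (MeasurePreserving.id τ)
  exact (measurePreserving_prodAssoc ν μ τ).comp (h2.comp h1)

theorem indepFun_comp_measurePreserving {Ω Ω' β γ : Type*} [MeasurableSpace Ω] [MeasurableSpace Ω']
    [MeasurableSpace β] [MeasurableSpace γ] {P : Measure Ω} {Q : Measure Ω'} {e : Ω → Ω'}
    (he : MeasurePreserving e P Q) {X : Ω' → β} {Y : Ω' → γ} (hX : Measurable X)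
    (hY : Measurable Y) (h : IndepFun X Y Q) :
    IndepFun (fun ω => X (e ω)) (fun ω => Y (e ω)) P := by
  rw [indepFun_iff_measure_inter_preimage_eq_mul] at h ⊢
  intro s t hs ht
  have := h s t hs ht
  rw [← he.measure_preimage (hX hs).nullMeasurableSet,
    ← he.measure_preimage (hY ht).nullMeasurableSet,
    ← he.measure_preimage ((hX hs).inter (hY ht)).nullMeasurableSet] at this
  exact this

end Rearrange

/-! ### Realizations of the mean field game -/

section MeanFieldRealization

variable {T : ℕ} {𝒳 Γ : Type u} [Fintype 𝒳] [MeasurableSpace 𝒳] [DiscreteMeasurableSpace 𝒳]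
  [MeasurableSpace Γ]

/-- The states in the mean field game with flow `m` under the modification `w`. -/
def progPath (G : GameData T 𝒳 Γ) (α : (t : Fin T) → I × (Fin (t + 1 + 1) → PM 𝒳) → 𝒳 → Γ)
    (w : Progressive T 𝒳 Γ → Progressive T 𝒳 Γ) (m : Flow T 𝒳) (v : Noise T 𝒳) :
    Fin (T + 1) → 𝒳 :=
  recPath v.1 fun t x => G.Ψ t (x t.castSucc) (m t.castSucc)
    ((w (sugg α v.2.1 m).toProgressive).1 t (upTo x t t.isLt.le, upTo m t t.isLt.le)) (v.2.2 t)

/-- The actions in the mean field game with flow `m` under the modification `w`. -/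
def progAction (G : GameData T 𝒳 Γ) (α : (t : Fin T) → I × (Fin (t + 1 + 1) → PM 𝒳) → 𝒳 → Γ)
    (w : Progressive T 𝒳 Γ → Progressive T 𝒳 Γ) (m : Flow T 𝒳) (v : Noise T 𝒳) (t : Fin T) : Γ :=
  (w (sugg α v.2.1 m).toProgressive).1 t
    (upTo (progPath G α w m v) t t.isLt.le, upTo m t t.isLt.le)

theorem progPath_succ (G : GameData T 𝒳 Γ)
    (α : (t : Fin T) → I × (Fin (t + 1 + 1) → PM 𝒳) → 𝒳 → Γ)
    (w : Progressive T 𝒳 Γ → Progressive T 𝒳 Γ) (m : Flow T 𝒳) (v : Noise T 𝒳) (t : Fin T) :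
    progPath G α w m v t.succ = G.Ψ t (progPath G α w m v t.castSucc) (m t.castSucc)
      (progAction G α w m v t) (v.2.2 t) := by
  refine recPath_succ _ (fun t p q h => ?_) t
  rw [h t.castSucc (by simp), upTo_congr (t : ℕ) _ h]

variable [Finite Γ] [DiscreteMeasurableSpace Γ]
variable {G : GameData T 𝒳 Γ}
  (hΨ : ∀ t, Measurable fun q : (𝒳 × PM 𝒳 × Γ) × I => G.Ψ t q.1.1 q.1.2.1 q.1.2.2 q.2)
  {α : (t : Fin T) → I × (Fin (t + 1 + 1) → PM 𝒳) → 𝒳 → Γ} (hα : ∀ t, Measurable (α t))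
  (w : Progressive T 𝒳 Γ → Progressive T 𝒳 Γ)

theorem measurable_modification (t : Fin T) :
    Measurable fun r : Restricted T 𝒳 Γ × (Fin (t + 1) → 𝒳) × (Fin (t + 1) → PM 𝒳) =>
      (w r.1.toProgressive).1 t r.2 :=
  measurable_from_prod_countable_right fun φ => (w φ.toProgressive).2 t

include hΨ hα

theorem measurable_progPath :
    Measurable fun q : Flow T 𝒳 × Noise T 𝒳 => progPath G α w q.1 q.2 := by
  have hs : Measurable fun q : Flow T 𝒳 × Noise T 𝒳 => sugg α q.2.2.1 q.1 :=
    measurable_sugg hα (by fun_prop) measurable_fst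
  refine measurable_recPath (by fun_prop) fun t => ?_
  refine measurable_step hΨ t (by fun_prop) (by fun_prop) ?_ (by fun_prop)
  exact (measurable_modification w t).comp ((hs.comp measurable_fst).prodMk
    ((measurable_upTo measurable_snd _ _).prodMk
      (measurable_upTo (measurable_fst.comp measurable_fst) _ _)))

theorem measurable_progAction :
    Measurable fun q : Flow T 𝒳 × Noise T 𝒳 => progAction G α w q.1 q.2 := by
  have hs : Measurable fun q : Flow T 𝒳 × Noise T 𝒳 => sugg α q.2.2.1 q.1 :=
    measurable_sugg hα (by fun_prop) measurable_fst
  exact measurable_pi_iff.2 fun t => (measurable_modification w t).comp (hs.prodMk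
    ((measurable_upTo (measurable_progPath hΨ hα w) _ _).prodMk (measurable_upTo measurable_fst _ _)))

variable (m₀ : PM 𝒳) {ρ : Measure (Restricted T 𝒳 Γ × Flow T 𝒳)} [IsProbabilityMeasure ρ]
  (hρ : (ρ.snd.prod (volume : Measure I)).map (fun q => (sugg α q.2 q.1, q.1)) = ρ)

/-- The realization of the mean field game on the product of the spaces of flows and noises. -/
noncomputable def canonicalRealization :
    MFGRealization G m₀ ρ w (ρ.snd.prod (noiseLaw T m₀)) := by
  have hs : Measurable fun q : Flow T 𝒳 × Noise T 𝒳 => sugg α q.2.2.1 q.1 :=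
    measurable_sugg hα (by fun_prop) measurable_fst
  have hsI : Measurable fun q : Flow T 𝒳 × I => sugg α q.2 q.1 :=
    measurable_sugg hα measurable_snd measurable_fst
  have hX := measurable_progPath hΨ hα w
  have hP0 : ∀ q : Flow T 𝒳 × Noise T 𝒳, progPath G α w q.1 q.2 0 = q.2.1 :=
    fun q => recPath_zero _ _
  let Ξ : Measure (Fin T → I) := Measure.pi fun _ => volume
  -- The rearrangements bring to the front the factor whose independence of the remaining ones is to
  -- be read off: the initial state or the noise.
  have e1 : MeasurePreserving (fun q : Flow T 𝒳 × Noise T 𝒳 => (q.2.1, q.1, q.2.2))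
      (ρ.snd.prod (noiseLaw T m₀)) (m₀.toMeasure.prod (ρ.snd.prod ((volume : Measure I).prod Ξ))) :=
    measurePreserving_rotate _ _ _
  have e2 : MeasurePreserving (fun q : Flow T 𝒳 × Noise T 𝒳 => (q.2.1, (q.1, q.2.2.1), q.2.2.2))
      (ρ.snd.prod (noiseLaw T m₀)) (m₀.toMeasure.prod ((ρ.snd.prod (volume : Measure I)).prod Ξ)) :=
    ((MeasurePreserving.id m₀.toMeasure).prod
      (measurePreserving_prodAssoc ρ.snd (volume : Measure I) Ξ).symm).comp e1
  have e3 : MeasurePreserving (fun q : Flow T 𝒳 × Noise T 𝒳 => (q.2.2.2, q.2.1, (q.1, q.2.2.1)))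
      (ρ.snd.prod (noiseLaw T m₀)) (Ξ.prod (m₀.toMeasure.prod (ρ.snd.prod (volume : Measure I)))) :=
    ((measurePreserving_rotate _ _ _).comp ((MeasurePreserving.id m₀.toMeasure).prod
      Measure.measurePreserving_swap)).comp e2
  have eξ : MeasurePreserving (fun q : Flow T 𝒳 × Noise T 𝒳 => q.2.2.2)
      (ρ.snd.prod (noiseLaw T m₀)) Ξ := by
    have h := measurePreserving_fst.comp e3
    exact h
  have eX : MeasurePreserving (fun q : Flow T 𝒳 × Noise T 𝒳 => q.2.1)
      (ρ.snd.prod (noiseLaw T m₀)) m₀.toMeasure := by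
    have h := measurePreserving_fst.comp e1
    exact h
  have e4 : MeasurePreserving (fun q : Flow T 𝒳 × Noise T 𝒳 => (q.2.1, (q.1, q.2.2.1)))
      (ρ.snd.prod (noiseLaw T m₀)) (m₀.toMeasure.prod (ρ.snd.prod (volume : Measure I))) :=
    by
    have h := measurePreserving_snd.comp e3
    exact h
  have e5 : MeasurePreserving (fun q : Flow T 𝒳 × Noise T 𝒳 => (q.1, q.2.2.1))
      (ρ.snd.prod (noiseLaw T m₀)) (ρ.snd.prod (volume : Measure I)) :=
    by
    have h := measurePreserving_snd.comp e4
    exact h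
  have hsp : Measurable fun q : Flow T 𝒳 × I => (sugg α q.2 q.1, q.1) := hsI.prodMk measurable_fst
  exact
  { X := fun t q => progPath G α w q.1 q.2 t
    Φ := fun q => sugg α q.2.2.1 q.1
    μ := fun q => q.1
    ξ := fun t q => q.2.2.2 t
    measurable_X := fun t => (measurable_pi_apply t).comp hX
    measurable_Φ := hs
    measurable_μ := measurable_fst
    measurable_ξ := fun t => by fun_prop
    law_X_zero := by
      simp only [hP0]
      exact eX.map_eq
    law_suggestion := by
      have := Measure.map_map hsp e5.measurable (μ := ρ.snd.prod (noiseLaw T m₀))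
      rw [e5.map_eq, hρ] at this
      exact this.symm
    law_ξ := fun t => ((measurePreserving_eval (fun _ : Fin T => (volume : Measure I)) t).comp
      eξ).map_eq
    iIndepFun_ξ := by
      rw [iIndepFun_iff_map_fun_eq_pi_map fun t => by fun_prop]
      refine eξ.map_eq.trans (congrArg Measure.pi (funext fun t => ?_))
      exact ((measurePreserving_eval (fun _ : Fin T => (volume : Measure I)) t).comp
        eξ).map_eq.symm
    indep_ξ := by
      simp only [hP0]
      have hY : Measurable fun r : 𝒳 × Flow T 𝒳 × I => (r.1, (sugg α r.2.2 r.2.1, r.2.1)) :=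
        measurable_fst.prodMk (hsp.comp measurable_snd)
      exact indepFun_comp_measurePreserving e3 (X := fun r => r.1)
        (Y := fun r => (r.2.1, (sugg α r.2.2.2 r.2.2.1, r.2.2.1))) measurable_fst
        (hY.comp measurable_snd) (indepFun_prod measurable_id hY)
    indep_X_zero := by
      simp only [hP0]
      exact indepFun_comp_measurePreserving e4 (X := fun r => r.1)
        (Y := fun r => (sugg α r.2.2 r.2.1, r.2.1)) measurable_fst
        (hsp.comp measurable_snd) (indepFun_prod measurable_id hsp)
    dynamics := fun t => ae_of_all _ fun q => progPath_succ G α w q.1 q.2 t }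

/-- The expected costs of following the suggestion in the mean field game. -/
noncomputable def meanCost (G : GameData T 𝒳 Γ)
    (α : (t : Fin T) → I × (Fin (t + 1 + 1) → PM 𝒳) → 𝒳 → Γ) (m₀ : PM 𝒳)
    (ρ : Measure (Restricted T 𝒳 Γ × Flow T 𝒳)) : ℝ :=
  ∫ q, pathCost G (progPath G α id q.1 q.2) q.1 (progAction G α id q.1 q.2)
        ∂(ρ.snd.prod (noiseLaw T m₀))

include hρ in
theorem meanCost_le (hopt : MFGOptimality G m₀ ρ) :
    meanCost G α m₀ ρ ≤ ∫ q, pathCost G (progPath G α w q.1 q.2) q.1 (progAction G α w q.1 q.2)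
        ∂(ρ.snd.prod (noiseLaw T m₀)) :=
  hopt w _ _ (canonicalRealization hΨ hα id m₀ hρ) (canonicalRealization hΨ hα w m₀ hρ)

include hρ in
-- In the canonical realization the flow is independent of the noise, so conditioning on it amounts
-- to freezing it. Equality almost everywhere follows by comparing integrals over sets of flows.
theorem ae_meanPath_law (hcons : MFGConsistency G m₀ ρ) : ∀ᵐ m ∂ρ.snd, ∀ t x,
    (noiseLaw T m₀).real ((fun v => meanPath G α m v t) ⁻¹' {x}) = (m t).1 x := by
  refine ae_all_iff.2 fun t => ae_all_iff.2 fun x => ?_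
  have hc := hcons _ (canonicalRealization hΨ hα id m₀ hρ) t x
  have hX : Measurable fun q : Flow T 𝒳 × Noise T 𝒳 => meanPath G α q.1 q.2 t :=
    (measurable_pi_apply t).comp (measurable_progPath hΨ hα id)
  -- Under the identity modification the canonical state process is `meanPath` by unfolding.
  have hc' : (fun q : Flow T 𝒳 × Noise T 𝒳 => (q.1 t).1 x) =ᵐ[ρ.snd.prod (noiseLaw T m₀)]
      (ρ.snd.prod (noiseLaw T m₀))[((fun q : Flow T 𝒳 × Noise T 𝒳 =>
        meanPath G α q.1 q.2 t) ⁻¹' {x}).indicator (fun _ => (1 : ℝ)) |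
        MeasurableSpace.comap Prod.fst inferInstance] := hc
  have hSm : MeasurableSet ((fun q : Flow T 𝒳 × Noise T 𝒳 => meanPath G α q.1 q.2 t) ⁻¹' {x}) :=
    hX (MeasurableSet.of_discrete)
  have hmx : Measurable fun m : Flow T 𝒳 => (m t).1 x :=
    (measurable_pi_apply x).comp (measurable_subtype_coe.comp (measurable_pi_apply t))
  have hqm : Measurable fun m : Flow T 𝒳 =>
      (noiseLaw T m₀).real ((fun v => meanPath G α m v t) ⁻¹' {x}) :=
    (measurable_measure_prodMk_left hSm).ennreal_toReal
  have hle : ∀ m : Flow T 𝒳, (m t).1 x ≤ 1 := fun m => by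
    rw [← (m t).2.2]
    exact Finset.single_le_sum (f := (m t).1) (fun y _ => (m t).2.1 y) (Finset.mem_univ x)
  refine Integrable.ae_eq_of_forall_setIntegral_eq _ _ ?_ ?_ fun B hB _ => ?_
  · exact Integrable.of_bound hqm.aestronglyMeasurable 1 (ae_of_all _ fun m => by
      rw [Real.norm_of_nonneg measureReal_nonneg]
      exact measureReal_le_one)
  · exact Integrable.of_bound hmx.aestronglyMeasurable 1 (ae_of_all _ fun m => by
      rw [Real.norm_of_nonneg ((m t).2.1 x)]
      exact hle m)
  · have hint : Integrable (((fun q : Flow T 𝒳 × Noise T 𝒳 =>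
        meanPath G α q.1 q.2 t) ⁻¹' {x}).indicator (fun _ => (1 : ℝ)))
        (ρ.snd.prod (noiseLaw T m₀)) := (integrable_const _).indicator hSm
    have hset := setIntegral_condExp (m := MeasurableSpace.comap
      (Prod.fst : Flow T 𝒳 × Noise T 𝒳 → Flow T 𝒳) inferInstance)
      measurable_fst.comap_le hint (s := Prod.fst ⁻¹' B) ⟨B, hB, rfl⟩
    rw [← setIntegral_congr_ae (measurable_fst hB) (hc'.mono fun q hq _ => hq)] at hset
    have hBp : (Prod.fst ⁻¹' B : Set (Flow T 𝒳 × Noise T 𝒳)) = B ×ˢ Set.univ := by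
      ext q; simp
    have hmi : Integrable (fun q : Flow T 𝒳 × Noise T 𝒳 => (q.1 t).1 x)
        (ρ.snd.prod (noiseLaw T m₀)) :=
      Integrable.of_bound (hmx.comp measurable_fst).aestronglyMeasurable 1
        (ae_of_all _ fun q => (Real.norm_of_nonneg ((q.1 t).2.1 x)).trans_le (hle q.1))
    rw [hBp, setIntegral_prod _ hmi.integrableOn, setIntegral_prod _ hint.integrableOn] at hset
    simp only [Measure.restrict_univ, integral_const, probReal_univ, one_smul] at hset
    rw [hset]
    refine setIntegral_congr_fun hB fun m _ => ?_
    have h1 := integral_indicator_const (μ := noiseLaw T m₀) (1 : ℝ)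
      (hSm.preimage measurable_prodMk_left :
        MeasurableSet ((fun v => meanPath G α m v t) ⁻¹' {x}))
    rw [smul_eq_mul, mul_one] at h1
    exact h1.symm

end MeanFieldRealization

/-! ### Deviations in the `N`-player game as deviations in the mean field game -/

section Deviation

variable {T : ℕ} {𝒳 Γ : Type u} [Fintype 𝒳]

/-- A path extending a given initial piece. -/
def extendPath {β : Type*} {k : ℕ} (h : Fin (k + 1) → β) (s : Fin (T + 1)) : β :=
  h ⟨min s k, by omega⟩

theorem extendPath_upTo {β : Type*} (x : Fin (T + 1) → β) (k : ℕ) (hk : k ≤ T) (s : Fin (T + 1))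
    (hs : (s : ℕ) ≤ k) : extendPath (upTo x k hk) s = x s := by
  simp only [extendPath, upTo]
  congr 1
  ext
  simpa using hs

theorem measurable_extendPath {β : Type*} [MeasurableSpace β] {k : ℕ} :
    Measurable (extendPath : (Fin (k + 1) → β) → Fin (T + 1) → β) :=
  measurable_pi_iff.2 fun _ => measurable_pi_apply _

variable [MeasurableSpace 𝒳] [DiscreteMeasurableSpace 𝒳] [Finite Γ] [MeasurableSpace Γ]
  [DiscreteMeasurableSpace Γ]

/-- The restricted strategy that a progressive strategy prescribes on constant histories. -/
def Progressive.restrict (m₀ : PM 𝒳) (p : Progressive T 𝒳 Γ) : Restricted T 𝒳 Γ :=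
  fun t x => p.1 t (fun _ => x, fun _ => m₀)

variable {N : ℕ} [N.AtLeastTwo] {G : GameData T 𝒳 Γ}
  (hΨ : ∀ t, Measurable fun q : (𝒳 × PM 𝒳 × Γ) × I => G.Ψ t q.1.1 q.1.2.1 q.1.2.2 q.2)
  {α : (t : Fin T) → I × (Fin (t + 1 + 1) → PM 𝒳) → 𝒳 → Γ} (hα : ∀ t, Measurable (α t))
  (i : Fin N) (g : NStrategy N T 𝒳 Γ → NStrategy N T 𝒳 Γ) (m₀ : PM 𝒳) (ω : Fin N → Noise T 𝒳)

/-- The modification of a player in the mean field game who simulates `N - 1` opponents with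
randomness `ω` and applies the modification `g` to their empirical measures. -/
noncomputable def simulate (p : Progressive T 𝒳 Γ) : Progressive T 𝒳 Γ :=
  ⟨fun t h => reactAction G α i (g ((p.restrict m₀).toNStrategy N)) (extendPath h.2) ω
    (extendPath h.1) t, fun t => measurable_reactAction hΨ hα
      (measurable_extendPath.comp measurable_snd) measurable_const i measurable_const
      (measurable_extendPath.comp measurable_fst) t⟩

/-- `restrict` recovers a restricted strategy from its inclusion, and the extended histories matter
only up to time `t`. As the reaction ignores the randomness of player `i`, that entry of `ω` may be
overwritten by the true one, `v`. -/
theorem simulate_apply (φ : Restricted T 𝒳 Γ) (m : Flow T 𝒳) (v : Noise T 𝒳)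
    (x : Fin (T + 1) → 𝒳) (t : Fin T) :
    (simulate hΨ hα i g m₀ ω φ.toProgressive).1 t (upTo x t t.isLt.le, upTo m t t.isLt.le) =
      reactAction G α i (g (φ.toNStrategy N)) m (Function.update ω i v) x t :=
  reactAction_congr G α i _ t (fun s hs => extendPath_upTo m t t.isLt.le s hs)
    (fun j hj => by rw [Function.update_of_ne hj]) (fun s hs => extendPath_upTo x t t.isLt.le s hs)

theorem progPath_simulate (m : Flow T 𝒳) (v : Noise T 𝒳) :
    progPath G α (simulate hΨ hα i g m₀ ω) m v = limitPath G α i g m (Function.update ω i v) := by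
  unfold progPath limitPath
  simp only [simulate_apply hΨ hα i g m₀ ω _ m v, Function.update_self]

/-- For frozen opponents, deviating in the limit system is the same as using one deterministic
modification in the mean field game. -/
theorem cost_simulate (m : Flow T 𝒳) (v : Noise T 𝒳) :
    pathCost G (progPath G α (simulate hΨ hα i g m₀ ω) m v) m
      (progAction G α (simulate hΨ hα i g m₀ ω) m v) =
    limitCost G α i g m (Function.update ω i v) := by
  unfold limitCost
  rw [progPath_simulate]
  congr 1
  funext t
  unfold progAction
  rw [progPath_simulate, simulate_apply hΨ hα i g m₀ ω _ m v, Function.update_self]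

omit [Finite Γ] [DiscreteMeasurableSpace Γ] in
-- A restricted strategy reads only the own state, so the simulated opponents drop out.
theorem limitCost_id (m : Flow T 𝒳) : limitCost G α i id m ω =
    pathCost G (progPath G α id m (ω i)) m (progAction G α id m (ω i)) := rfl

end Deviation

/-! ### Comparison of the `N`-player game with the mean field game -/

theorem integral_comp_measurePreserving {Ω Ω' : Type*} [MeasurableSpace Ω] [MeasurableSpace Ω']
    {P : Measure Ω} {Q : Measure Ω'} {e : Ω → Ω'} (he : MeasurePreserving e P Q) {h : Ω' → ℝ}
    (hh : Measurable h) : ∫ ω, h (e ω) ∂P = ∫ ω, h ω ∂Q := by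
  rw [← he.map_eq, integral_map he.measurable.aemeasurable hh.aestronglyMeasurable]

section Comparison

variable {T : ℕ} {𝒳 Γ : Type u} [Fintype 𝒳] [MeasurableSpace 𝒳] [DiscreteMeasurableSpace 𝒳]
  [Finite Γ] [MeasurableSpace Γ] [DiscreteMeasurableSpace Γ] {N : ℕ} [N.AtLeastTwo]
  {G : GameData T 𝒳 Γ}
  (hΨ : ∀ t, Measurable fun q : (𝒳 × PM 𝒳 × Γ) × I => G.Ψ t q.1.1 q.1.2.1 q.1.2.2 q.2)
  {L : ℝ} (hf : ∀ (t t' : Fin T) (x x' : 𝒳) (m m' : PM 𝒳) (u u' : Γ),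
      |G.f t x m u - G.f t' x' m' u'| ≤
        L * (discDist t t' + discDist x x' + tvDist m m' + discDist u u'))
  (hF : ∀ (x x' : 𝒳) (m m' : PM 𝒳), |G.F x m - G.F x' m'| ≤ L * (discDist x x' + tvDist m m'))
  {α : (t : Fin T) → I × (Fin (t + 1 + 1) → PM 𝒳) → 𝒳 → Γ}
  (hα : ∀ t, Measurable (α t)) (i : Fin N) (g : NStrategy N T 𝒳 Γ → NStrategy N T 𝒳 Γ)
  {w : ℝ → ℝ} (hmono : MonotoneOn w (Set.Ici 0))
  (h01 : ∀ s, 0 ≤ s → w s ∈ Set.Icc (0 : ℝ) 1)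
  (hw : ∀ (t : Fin T) (x : 𝒳) (u : Γ) (m m' : PM 𝒳),
      (volume : Measure I) {z | G.Ψ t x m u z ≠ G.Ψ t x m' u z} ≤ ENNReal.ofReal (w (tvDist m m')))
  (m₀ : PM 𝒳) {C : ℝ} (hC : ∀ x M v, |pathCost G x M v| ≤ C)
  {ρ : Measure (Restricted T 𝒳 Γ × Flow T 𝒳)} [IsProbabilityMeasure ρ]
  (hρ : (ρ.snd.prod (volume : Measure I)).map (fun q => (sugg α q.2 q.1, q.1)) = ρ)

include hΨ hf hF hα hC in
-- Redrawing all the randomness of player `i` puts the opponents' randomness into an outer integral.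
theorem integral_limitCost : ∫ q, limitCost G α i g q.1 q.2
      ∂(ρ.snd.prod (Measure.pi fun _ : Fin N => noiseLaw T m₀)) =
    ∫ ω, (∫ q, limitCost G α i g q.1 (Function.update ω i q.2) ∂(ρ.snd.prod (noiseLaw T m₀)))
      ∂(Measure.pi fun _ : Fin N => noiseLaw T m₀) := by
  have e1 := ((MeasurePreserving.id ρ.snd).prod
    (measurePreserving_update (fun _ : Fin N => noiseLaw T m₀) i)).comp
    (measurePreserving_rotate (Measure.pi fun _ : Fin N => noiseLaw T m₀) ρ.snd (noiseLaw T m₀))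
  have hm := measurable_limitCost hΨ hf hF hα i g
    (measurable_fst : Measurable fun q : Flow T 𝒳 × (Fin N → Noise T 𝒳) => q.1) measurable_snd
  rw [← integral_comp_measurePreserving e1 hm, integral_prod]
  · rfl
  · exact Integrable.of_bound (hm.comp e1.measurable).aestronglyMeasurable C
      (ae_of_all _ fun q => hC _ _ _)

include hΨ hf hF hα hC hρ in
-- Optimality is applied separately to `simulate` for each `ω` and then averaged, so the mean field
-- game needs no randomized modifications.
theorem meanCost_le_integral_limitCost (hopt : MFGOptimality G m₀ ρ) :
    meanCost G α m₀ ρ ≤ ∫ q, limitCost G α i g q.1 q.2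
      ∂(ρ.snd.prod (Measure.pi fun _ : Fin N => noiseLaw T m₀)) := by
  rw [integral_limitCost hΨ hf hF hα i g m₀ hC]
  have h : ∀ ω : Fin N → Noise T 𝒳, meanCost G α m₀ ρ ≤
      ∫ q, limitCost G α i g q.1 (Function.update ω i q.2) ∂(ρ.snd.prod (noiseLaw T m₀)) := by
    intro ω
    simp only [← cost_simulate hΨ hα i g m₀ ω]
    exact meanCost_le hΨ hα _ m₀ hρ hopt
  have hm := measurable_limitCost hΨ hf hF hα i g
    (measurable_fst : Measurable fun q : Flow T 𝒳 × (Fin N → Noise T 𝒳) => q.1) measurable_snd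
  have hup : Measurable fun q : (Fin N → Noise T 𝒳) × Flow T 𝒳 × Noise T 𝒳 =>
      limitCost G α i g q.2.1 (Function.update q.1 i q.2.2) :=
    hm.comp ((measurable_fst.comp measurable_snd).prodMk
      ((measurable_update_prod (β := fun _ : Fin N => Noise T 𝒳) i).comp
        (measurable_fst.prodMk (measurable_snd.comp measurable_snd))))
  have hint : Integrable (fun q : (Fin N → Noise T 𝒳) × Flow T 𝒳 × Noise T 𝒳 =>
      limitCost G α i g q.2.1 (Function.update q.1 i q.2.2))
      ((Measure.pi fun _ : Fin N => noiseLaw T m₀).prod (ρ.snd.prod (noiseLaw T m₀))) :=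
    Integrable.of_bound hup.aestronglyMeasurable C (ae_of_all _ fun q => hC _ _ _)
  calc meanCost G α m₀ ρ
      = ∫ _, meanCost G α m₀ ρ ∂(Measure.pi fun _ : Fin N => noiseLaw T m₀) := by simp
    _ ≤ _ := integral_mono (integrable_const _) hint.integral_prod_left h

include hΨ hf hF hα in
theorem integral_limitCost_id : ∫ q, limitCost G α i id q.1 q.2
      ∂(ρ.snd.prod (Measure.pi fun _ : Fin N => noiseLaw T m₀)) = meanCost G α m₀ ρ := by
  have e1 := (MeasurePreserving.id ρ.snd).prod
    (measurePreserving_eval (fun _ : Fin N => noiseLaw T m₀) i)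
  simp only [limitCost_id]
  exact integral_comp_measurePreserving e1 (measurable_pathCost hf hF
    (measurable_progPath hΨ hα id) measurable_fst (measurable_progAction hΨ hα id))

/-- The expected costs of player `i` in the `N`-player game, when the players' suggestions are
generated from a common flow and player `i` modifies the suggestion by `g`. -/
noncomputable def nCost (G : GameData T 𝒳 Γ)
    (α : (t : Fin T) → I × (Fin (t + 1 + 1) → PM 𝒳) → 𝒳 → Γ) (m₀ : PM 𝒳)
    (ρ : Measure (Restricted T 𝒳 Γ × Flow T 𝒳)) (i : Fin N)
    (g : NStrategy N T 𝒳 Γ → NStrategy N T 𝒳 Γ) : ℝ :=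
  ∫ q, coupleCost G α i g q.1 q.2 ∂(ρ.snd.prod (Measure.pi fun _ : Fin N => noiseLaw T m₀))

include hΨ hf hF hα hC hρ hmono h01 hw in
theorem abs_nCost_sub_le (hcons : MFGConsistency G m₀ ρ) :
    |nCost G α m₀ ρ i g - ∫ q, limitCost G α i g q.1 q.2
      ∂(ρ.snd.prod (Measure.pi fun _ : Fin N => noiseLaw T m₀))| ≤
      gapBound T w (rateConst 𝒳) L C (N - 1) := by
  have hml := measurable_limitCost hΨ hf hF hα i g
    (measurable_fst : Measurable fun q : Flow T 𝒳 × (Fin N → Noise T 𝒳) => q.1) measurable_snd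
  have hmc := measurable_coupleCost hΨ hf hF hα i g
    (measurable_fst : Measurable fun q : Flow T 𝒳 × (Fin N → Noise T 𝒳) => q.1) measurable_snd
  have hil : Integrable (fun q => limitCost G α i g q.1 q.2)
      (ρ.snd.prod (Measure.pi fun _ : Fin N => noiseLaw T m₀)) :=
    Integrable.of_bound hml.aestronglyMeasurable C (ae_of_all _ fun q => hC _ _ _)
  have hic : Integrable (fun q => coupleCost G α i g q.1 q.2)
      (ρ.snd.prod (Measure.pi fun _ : Fin N => noiseLaw T m₀)) :=
    Integrable.of_bound hmc.aestronglyMeasurable C (ae_of_all _ fun q => hC _ _ _)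
  unfold nCost
  rw [integral_prod _ hic, integral_prod _ hil,
    ← integral_sub hic.integral_prod_left hil.integral_prod_left, ← Real.norm_eq_abs]
  have := norm_integral_le_of_norm_le_const (μ := ρ.snd) (f := fun m =>
    ∫ ω, coupleCost G α i g m ω ∂(Measure.pi fun _ : Fin N => noiseLaw T m₀) -
      ∫ ω, limitCost G α i g m ω ∂(Measure.pi fun _ : Fin N => noiseLaw T m₀))
    (C := gapBound T w (rateConst 𝒳) L C (N - 1)) (by
      filter_upwards [ae_meanPath_law hΨ hα m₀ hρ hcons] with m hm
      exact abs_integral_cost_sub_le hΨ hf hF hα i g hmono h01 hw m₀ hm hC)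
  simpa using this

end Comparison

/-! ### The law of the suggestions -/

section Mixture

variable {T : ℕ} {𝒳 Γ : Type u} [Fintype 𝒳] [MeasurableSpace Γ]

theorem exists_sugg_law [MeasurableSpace 𝒳] [DiscreteMeasurableSpace 𝒳]
    {ρ : Measure (Restricted T 𝒳 Γ × Flow T 𝒳)} (hR2 : HasOneStepInformation ρ) :
    ∃ α : (t : Fin T) → I × (Fin (t + 1 + 1) → PM 𝒳) → 𝒳 → Γ, (∀ t, Measurable (α t)) ∧
      (ρ.snd.prod (volume : Measure I)).map (fun q => (sugg α q.2 q.1, q.1)) = ρ := by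
  obtain ⟨α, hα, Ω, _, P, _, Φ, μ, Z, hΦ, hμ, hZ, hlaw, hZl, hind, hΦα⟩ := hR2
  refine ⟨α, hα, ?_⟩
  have h1 : ρ.snd = P.map μ := by
    rw [← hlaw, Measure.snd_map_prodMk hΦ]
  have h2 : P.map (fun ω => (μ ω, Z ω)) = (P.map μ).prod volume := by
    rw [← hZl]
    exact (indepFun_iff_map_prod_eq_prod_map_map hμ.aemeasurable hZ.aemeasurable).1 hind.symm
  have h3 : Φ = fun ω => sugg α (Z ω) (μ ω) := funext fun ω => funext fun t => hΦα t ω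
  rw [h1, ← h2, Measure.map_map ((measurable_sugg hα measurable_snd measurable_fst).prodMk
    measurable_fst) (hμ.prodMk hZ)]
  rw [h3] at hlaw
  exact hlaw

variable [Finite Γ] [Nonempty Γ] [DiscreteMeasurableSpace Γ]
  {α : (t : Fin T) → I × (Fin (t + 1 + 1) → PM 𝒳) → 𝒳 → Γ} (hα : ∀ t, Measurable (α t))
  {ρ : Measure (Restricted T 𝒳 Γ × Flow T 𝒳)} [IsProbabilityMeasure ρ]
  (hρ : (ρ.snd.prod (volume : Measure I)).map (fun q => (sugg α q.2 q.1, q.1)) = ρ)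

include hα hρ

/-- Both sides disintegrate `ρ` with respect to the flow; disintegrations are unique up to a null
set. -/
theorem ae_map_sugg_eq_condKernel :
    ∀ᵐ m ∂ρ.snd, (volume : Measure I).map (fun z => sugg α z m) =
      (ρ.map Prod.swap).condKernel m := by
  have hs : Measurable fun q : Flow T 𝒳 × I => sugg α q.2 q.1 :=
    measurable_sugg hα measurable_snd measurable_fst
  have hsm : ∀ m : Flow T 𝒳, Measurable fun z : I => sugg α z m := fun m =>
    hs.comp measurable_prodMk_left
  let κ : Kernel (Flow T 𝒳) (Restricted T 𝒳 Γ) :=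
    ⟨fun m => (volume : Measure I).map fun z => sugg α z m, by
      refine Measure.measurable_of_measurable_coe _ fun s hs' => ?_
      simp only [Measure.map_apply (hsm _) hs']
      exact measurable_measure_prodMk_left (hs hs')⟩
  have hκ : ∀ m, κ m = (volume : Measure I).map fun z => sugg α z m := fun _ => rfl
  have : IsMarkovKernel κ := ⟨fun m => by
    rw [hκ]
    exact Measure.isProbabilityMeasure_map (hsm m).aemeasurable⟩
  have : IsFiniteMeasure (ρ.map Prod.swap) := inferInstance
  have hfst : (ρ.map Prod.swap).fst = ρ.snd := Measure.fst_map_swap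
  have hdis : ρ.map Prod.swap = (ρ.map Prod.swap).fst ⊗ₘ κ := by
    rw [hfst]
    conv_lhs => rw [← hρ]
    rw [Measure.map_map measurable_swap (hs.prodMk measurable_fst)]
    ext s hs'
    rw [Measure.map_apply (measurable_swap.comp (hs.prodMk measurable_fst)) hs',
      Measure.compProd_apply hs', Measure.prod_apply
        ((measurable_swap.comp (hs.prodMk measurable_fst)) hs')]
    refine lintegral_congr fun m => ?_
    rw [hκ, Measure.map_apply (hsm m) (measurable_prodMk_left hs')]
    rfl
  have := eq_condKernel_of_measure_eq_compProd κ hdis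
  rwa [hfst] at this

/-- Conditionally i.i.d. suggestions are produced by feeding independent uniform variables and one
common flow into `sugg α`. -/
theorem mixture_eq (N : ℕ) : mixture ρ N =
    (ρ.snd.prod (Measure.pi fun _ : Fin N => (volume : Measure I))).map
      (fun q j => sugg α (q.2 j) q.1) := by
  have hs : Measurable fun q : Flow T 𝒳 × (Fin N → I) => fun j => sugg α (q.2 j) q.1 :=
    measurable_pi_iff.2 fun j =>
      measurable_sugg hα ((measurable_pi_apply j).comp measurable_snd) measurable_fst
  have hsm : ∀ m : Flow T 𝒳, Measurable fun z : I => sugg α z m := fun m =>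
    measurable_sugg hα measurable_id measurable_const
  have hsN : ∀ m : Flow T 𝒳, Measurable fun Z : Fin N → I => fun j => sugg α (Z j) m := fun m =>
    hs.comp measurable_prodMk_left
  have hmeas : Measurable fun m : Flow T 𝒳 =>
      (Measure.pi fun _ : Fin N => (volume : Measure I)).map fun Z j => sugg α (Z j) m := by
    refine Measure.measurable_of_measurable_coe _ fun s hs' => ?_
    simp only [Measure.map_apply (hsN _) hs']
    exact measurable_measure_prodMk_left (hs hs')
  have hae : (fun m => Measure.pi fun _ : Fin N => (ρ.map Prod.swap).condKernel m) =ᵐ[ρ.snd]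
      fun m => (Measure.pi fun _ : Fin N => (volume : Measure I)).map
        fun Z j => sugg α (Z j) m := by
    filter_upwards [ae_map_sugg_eq_condKernel hα hρ] with m hm
    rw [← hm]
    have : IsProbabilityMeasure ((volume : Measure I).map fun z => sugg α z m) :=
      Measure.isProbabilityMeasure_map (hsm m).aemeasurable
    exact (Measure.pi_map_pi (μ := fun _ : Fin N => (volume : Measure I))
      (fun _ => (hsm m).aemeasurable)).symm
  unfold mixture
  rw [Measure.bind_congr_right hae]
  ext s hs'
  rw [Measure.bind_apply hs' hmeas.aemeasurable, Measure.map_apply hs hs',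
    Measure.prod_apply (hs hs')]
  refine lintegral_congr fun m => ?_
  rw [Measure.map_apply (hsN m) hs']
  rfl

end Mixture

/-! ### Realizations of the `N`-player game -/

section Realizations

theorem measurePreserving_uncurry_swap (N T : ℕ) :
    MeasurePreserving (fun (ξ : Fin N → Fin T → I) (p : Fin T × Fin N) => ξ p.2 p.1)
      (Measure.pi fun _ => Measure.pi fun _ => volume) (Measure.pi fun _ => volume) := by
  have hm : Measurable fun (ξ : Fin N → Fin T → I) (p : Fin T × Fin N) => ξ p.2 p.1 := by fun_prop
  refine ⟨hm, (Measure.pi_eq fun s hs => ?_).symm⟩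
  rw [Measure.map_apply hm (MeasurableSet.univ_pi hs)]
  have h : (fun (ξ : Fin N → Fin T → I) (p : Fin T × Fin N) => ξ p.2 p.1) ⁻¹' Set.univ.pi s =
      Set.univ.pi fun j => Set.univ.pi fun t => s (t, j) := by
    ext ξ
    simp only [Set.mem_preimage, Set.mem_pi, Set.mem_univ, true_implies, Prod.forall]
    exact ⟨fun h j t => h t j, fun h t j => h j t⟩
  rw [h, Measure.pi_pi, Fintype.prod_prod_type_right]
  simp only [Measure.pi_pi]

variable {T : ℕ} {𝒳 Γ : Type u} [Fintype 𝒳] [MeasurableSpace 𝒳]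

/-- Regroups the randomness from one tuple per player into one family per kind, as in a realization
of the game. -/
theorem measurePreserving_split (m₀ : PM 𝒳) (N : ℕ) :
    MeasurePreserving (fun ω : Fin N → Noise T 𝒳 =>
        ((fun j => (ω j).1), (fun j => (ω j).2.1), fun p : Fin T × Fin N => (ω p.2).2.2 p.1))
      (Measure.pi fun _ => noiseLaw T m₀)
      ((Measure.pi fun _ => m₀.toMeasure).prod ((Measure.pi fun _ => (volume : Measure I)).prod
        (Measure.pi fun _ => volume))) := by
  have h1 := measurePreserving_arrowProdEquivProdArrow 𝒳 (I × (Fin T → I)) (Fin N)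
    (fun _ => m₀.toMeasure) (fun _ => (volume : Measure I).prod (Measure.pi fun _ => volume))
  have h2 := measurePreserving_arrowProdEquivProdArrow I (Fin T → I) (Fin N)
    (fun _ => volume) (fun _ => Measure.pi fun _ => volume)
  have h3 := (MeasurePreserving.id (Measure.pi fun _ : Fin N => (volume : Measure I))).prod
    (measurePreserving_uncurry_swap N T)
  exact ((MeasurePreserving.id (Measure.pi fun _ : Fin N => m₀.toMeasure)).prod
    (h3.comp h2)).comp h1

variable {N : ℕ} [N.AtLeastTwo]

/-- The costs of player `i` in the `N`-player game when player `i` plays `ψ`. -/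
noncomputable def playerCost (G : GameData T 𝒳 Γ) (i : Fin N) (x₀ : Fin N → 𝒳)
    (φ : Fin N → NStrategy N T 𝒳 Γ) (ψ : NStrategy N T 𝒳 Γ) (ξ : Fin T → Fin N → I) : ℝ :=
  pathCost G (fun s => nPath G i x₀ φ ψ ξ s i) (fun s => (empOthers (nPath G i x₀ φ ψ ξ s) i).1)
    (action ψ i (nPath G i x₀ φ ψ ξ))

/-- The dynamics determine the states almost surely from the inputs, so only the joint law of the
inputs matters. -/
theorem cost_eq_integral_playerCost {G : GameData T 𝒳 Γ} {𝔪 : Measure (Fin N → 𝒳)}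
    {γ : Measure (Fin N → NStrategy N T 𝒳 Γ)}
    {γ' : Measure (NStrategy N T 𝒳 Γ × NStrategy N T 𝒳 Γ)} {i : Fin N}
    {Ω : Type u} [MeasurableSpace Ω] {P : Measure Ω} (R : NRealization G 𝔪 γ γ' i P) :
    R.cost = ∫ ω, playerCost G i (R.X 0 ω) (R.Φ ω) (R.Φ' ω) (fun t j => R.ξ t j ω) ∂P := by
  refine integral_congr_ae ?_
  filter_upwards [ae_all_iff.2 fun t => ae_all_iff.2 fun j => R.dynamics t j] with ω hω
  have h : (fun s => R.X s ω) =
      nPath G i (R.X 0 ω) (R.Φ ω) (R.Φ' ω) (fun t j => R.ξ t j ω) :=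
    eq_recPath (isProgressiveStep_nStep G i _ _ _) rfl fun t => funext fun j => hω t j
  unfold playerCost
  rw [← h]
  rfl

theorem measurePreserving_realization {G : GameData T 𝒳 Γ} {𝔪 : Measure (Fin N → 𝒳)}
    {γ : Measure (Fin N → NStrategy N T 𝒳 Γ)}
    {γ' : Measure (NStrategy N T 𝒳 Γ × NStrategy N T 𝒳 Γ)} {i : Fin N}
    {Ω : Type u} [MeasurableSpace Ω] {P : Measure Ω} [IsProbabilityMeasure P]
    (R : NRealization G 𝔪 γ γ' i P) {D : Type*} [MeasurableSpace D] {H : (Fin T → I) → D}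
    (hH : Measurable H) :
    MeasurePreserving (fun ω => ((fun p : Fin T × Fin N => R.ξ p.1 p.2 ω), R.X 0 ω,
        H (fun t => R.ϑ t ω), R.Φ ω)) P
      ((Measure.pi fun _ => volume).prod
        (𝔪.prod ((P.map fun ω => H fun t => R.ϑ t ω).prod γ))) := by
  have hξ : Measurable fun ω (p : Fin T × Fin N) => R.ξ p.1 p.2 ω :=
    measurable_pi_iff.2 fun p => R.measurable_ξ p.1 p.2
  have hϑ : Measurable fun ω => H fun t => R.ϑ t ω :=
    hH.comp (measurable_pi_iff.2 fun t => R.measurable_ϑ t)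
  have hX := R.measurable_X 0
  have hΦ := R.measurable_Φ
  have i1 : IndepFun (fun ω (p : Fin T × Fin N) => R.ξ p.1 p.2 ω)
      (fun ω => (R.X 0 ω, H (fun t => R.ϑ t ω), R.Φ ω)) P :=
    R.indep_ξ.comp measurable_id (ψ := fun r : (Fin N → 𝒳) × (Fin T → I) ×
      (Fin N → NStrategy N T 𝒳 Γ) => (r.1, H r.2.1, r.2.2)) (by fun_prop)
  have i2 : IndepFun (R.X 0) (fun ω => (H (fun t => R.ϑ t ω), R.Φ ω)) P :=
    R.indep_X_zero.comp measurable_id (ψ := fun r : (Fin T → I) ×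
      (Fin N → NStrategy N T 𝒳 Γ) => (H r.1, r.2)) (by fun_prop)
  have i3 : IndepFun (fun ω => H (fun t => R.ϑ t ω)) R.Φ P :=
    R.indep_ϑ.comp hH measurable_id
  refine ⟨hξ.prodMk (hX.prodMk (hϑ.prodMk hΦ)), ?_⟩
  rw [(indepFun_iff_map_prod_eq_prod_map_map hξ.aemeasurable
      (hX.prodMk (hϑ.prodMk hΦ)).aemeasurable).1 i1,
    (indepFun_iff_map_prod_eq_prod_map_map hX.aemeasurable (hϑ.prodMk hΦ).aemeasurable).1 i2,
    (indepFun_iff_map_prod_eq_prod_map_map hϑ.aemeasurable hΦ.aemeasurable).1 i3,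
    R.law_X_zero, R.law_Φ]
  congr 1
  have := (iIndepFun_iff_map_fun_eq_pi_map (μ := P)
    (fun p : Fin T × Fin N => (R.measurable_ξ p.1 p.2).aemeasurable)).1 R.iIndepFun_ξ
  refine this.trans (congrArg Measure.pi (funext fun p => R.law_ξ p.1 p.2))

theorem ae_follow {G : GameData T 𝒳 Γ} {𝔪 : Measure (Fin N → 𝒳)} [Finite Γ]
    {γ : Measure (Fin N → NStrategy N T 𝒳 Γ)} {γ' : Measure (NStrategy N T 𝒳 Γ)} {i : Fin N}
    {Ω : Type u} [MeasurableSpace Ω] {P : Measure Ω}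
    (R : NRealization G 𝔪 γ (followSuggestion γ') i P) : ∀ᵐ ω ∂P, R.Φ' ω = R.Φ ω i := by
  have hΦi : Measurable fun ω => R.Φ ω i := (measurable_pi_apply i).comp R.measurable_Φ
  have h := R.law_modification
  have h0 : followSuggestion γ' {p | p.2 = p.1}ᶜ = 0 := by
    unfold followSuggestion
    rw [Measure.map_apply Measurable.of_discrete MeasurableSet.of_discrete]
    simp
  rw [← h, Measure.map_apply (hΦi.prodMk R.measurable_Φ') MeasurableSet.of_discrete] at h0
  exact h0

/-- Doob–Dynkin factorization at each time. Reading the factors as a function of the suggestion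
turns `ϑ` into a random map between strategies, independent of the other inputs. -/
theorem exists_randomized_modification {G : GameData T 𝒳 Γ} {𝔪 : Measure (Fin N → 𝒳)} [Finite Γ]
    [Nonempty Γ] {γ : Measure (Fin N → NStrategy N T 𝒳 Γ)}
    {γ' : Measure (NStrategy N T 𝒳 Γ × NStrategy N T 𝒳 Γ)} {i : Fin N}
    {Ω : Type u} [MeasurableSpace Ω] {P : Measure Ω} (R : NRealization G 𝔪 γ γ' i P) :
    ∃ H : (Fin T → I) → NStrategy N T 𝒳 Γ → NStrategy N T 𝒳 Γ, Measurable H ∧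
      ∀ᵐ ω ∂P, R.Φ' ω = H (fun t => R.ϑ t ω) (R.Φ ω i) := by
  choose k hk hkΦ using R.adapted
  choose h hh hkh using fun t => (hk t).exists_eq_measurable_comp
  refine ⟨fun θ φ t => h t (φ, θ t), ?_, ?_⟩
  · exact measurable_pi_iff.2 fun φ => measurable_pi_iff.2 fun t =>
      (hh t).comp (measurable_const.prodMk (measurable_pi_apply t))
  · filter_upwards [ae_all_iff.2 hkΦ] with ω hω
    funext t
    rw [hω t, hkh t]
    rfl

set_option linter.unusedSectionVars false

variable [DiscreteMeasurableSpace 𝒳] [Finite Γ] [MeasurableSpace Γ] [DiscreteMeasurableSpace Γ]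
  {G : GameData T 𝒳 Γ}
  (hΨ : ∀ t, Measurable fun q : (𝒳 × PM 𝒳 × Γ) × I => G.Ψ t q.1.1 q.1.2.1 q.1.2.2 q.2)
  {L : ℝ} (hf : ∀ (t t' : Fin T) (x x' : 𝒳) (m m' : PM 𝒳) (u u' : Γ),
      |G.f t x m u - G.f t' x' m' u'| ≤
        L * (discDist t t' + discDist x x' + tvDist m m' + discDist u u'))
  (hF : ∀ (x x' : 𝒳) (m m' : PM 𝒳), |G.F x m - G.F x' m'| ≤ L * (discDist x x' + tvDist m m'))
  {α : (t : Fin T) → I × (Fin (t + 1 + 1) → PM 𝒳) → 𝒳 → Γ} (hα : ∀ t, Measurable (α t))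
  (m₀ : PM 𝒳) {C : ℝ} (hC : ∀ x M v, |pathCost G x M v| ≤ C)
  {ρ : Measure (Restricted T 𝒳 Γ × Flow T 𝒳)} [IsProbabilityMeasure ρ]

include hΨ hf hF in
theorem measurable_playerCost (i : Fin N) :
    Measurable fun r : (Fin T × Fin N → I) × (Fin N → 𝒳) ×
      (NStrategy N T 𝒳 Γ → NStrategy N T 𝒳 Γ) × (Fin N → NStrategy N T 𝒳 Γ) =>
      playerCost G i r.2.1 r.2.2.2 (r.2.2.1 (r.2.2.2 i)) fun t j => r.1 (t, j) := by
  have hψ : Measurable fun r : (Fin T × Fin N → I) × (Fin N → 𝒳) ×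
      (NStrategy N T 𝒳 Γ → NStrategy N T 𝒳 Γ) × (Fin N → NStrategy N T 𝒳 Γ) =>
      r.2.2.1 (r.2.2.2 i) :=
    (Measurable.of_discrete (f := fun r : (NStrategy N T 𝒳 Γ → NStrategy N T 𝒳 Γ) ×
      (Fin N → NStrategy N T 𝒳 Γ) => r.1 (r.2 i))).comp (measurable_snd.comp measurable_snd)
  have hp := measurable_nPath hΨ i (by fun_prop) (by fun_prop) hψ
    (ξ := fun (r : (Fin T × Fin N → I) × (Fin N → 𝒳) × (NStrategy N T 𝒳 Γ → NStrategy N T 𝒳 Γ) ×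
      (Fin N → NStrategy N T 𝒳 Γ)) t j => r.1 (t, j)) (x₀ := fun r => r.2.1)
    (φ := fun r => r.2.2.2) (by fun_prop)
  refine measurable_pathCost hf hF ?_ ?_ ?_
  · exact (Measurable.of_discrete (f := fun p : Fin (T + 1) → Fin N → 𝒳 => fun s => p s i)).comp hp
  · exact (Measurable.of_discrete (f := fun p : Fin (T + 1) → Fin N → 𝒳 =>
      fun s => (empOthers (p s) i).1)).comp hp
  · exact (Measurable.of_discrete (f := fun r : NStrategy N T 𝒳 Γ × (Fin (T + 1) → Fin N → 𝒳) =>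
        action r.1 i r.2)).comp (hψ.prodMk hp)

include hα in
-- The inputs of an arbitrary realization have the same law as those built from a modification, a
-- flow and the private randomness of the players. This transfers costs to the product space of the
-- coupling.
theorem measurePreserving_inputs {D : Type*} [MeasurableSpace D] (κ : Measure D) [SFinite κ] :
    MeasurePreserving (fun r : D × Flow T 𝒳 × (Fin N → Noise T 𝒳) =>
        ((fun p : Fin T × Fin N => (r.2.2 p.2).2.2 p.1), (fun j => (r.2.2 j).1), r.1,
          fun j => (sugg α (r.2.2 j).2.1 r.2.1).toNStrategy N))
      (κ.prod (ρ.snd.prod (Measure.pi fun _ : Fin N => noiseLaw T m₀)))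
      ((Measure.pi fun _ => volume).prod ((Measure.pi fun _ => m₀.toMeasure).prod (κ.prod
        ((ρ.snd.prod (Measure.pi fun _ : Fin N => (volume : Measure I))).map
          fun q j => (sugg α (q.2 j) q.1).toNStrategy N)))) := by
  set A : Measure (Fin N → 𝒳) := Measure.pi fun _ => m₀.toMeasure
  set B : Measure (Fin N → I) := Measure.pi fun _ => volume
  set Ξ : Measure (Fin T × Fin N → I) := Measure.pi fun _ => volume
  have e0 := (MeasurePreserving.id κ).prod ((MeasurePreserving.id ρ.snd).prod
    (measurePreserving_split (T := T) m₀ N))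
  have e1 := (MeasurePreserving.id κ).prod (measurePreserving_rotate ρ.snd A (B.prod Ξ))
  have e2 := measurePreserving_rotate κ A (ρ.snd.prod (B.prod Ξ))
  have e3 := (MeasurePreserving.id A).prod ((MeasurePreserving.id κ).prod
    (Measure.measurePreserving_swap.comp (measurePreserving_prodAssoc ρ.snd B Ξ).symm))
  have e4 := (MeasurePreserving.id A).prod (measurePreserving_rotate κ Ξ (ρ.snd.prod B))
  have e5 := measurePreserving_rotate A Ξ (κ.prod (ρ.snd.prod B))
  have hs : Measurable fun (q : Flow T 𝒳 × (Fin N → I)) j => (sugg α (q.2 j) q.1).toNStrategy N :=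
    measurable_pi_iff.2 fun j => (Measurable.of_discrete (f := fun φ : Restricted T 𝒳 Γ =>
      φ.toNStrategy N)).comp
        (measurable_sugg hα ((measurable_pi_apply j).comp measurable_snd) measurable_fst)
  have e6 := (MeasurePreserving.id Ξ).prod ((MeasurePreserving.id A).prod
    ((MeasurePreserving.id κ).prod (hs.measurePreserving (ρ.snd.prod B))))
  exact e6.comp (e5.comp (e4.comp (e3.comp (e2.comp (e1.comp e0)))))

variable [Nonempty Γ]

include hα in
theorem map_mixture_eq
    (hρ : (ρ.snd.prod (volume : Measure I)).map (fun q => (sugg α q.2 q.1, q.1)) = ρ) :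
    ((mixture ρ N).map fun φ j => (φ j).toNStrategy N) =
      (ρ.snd.prod (Measure.pi fun _ : Fin N => (volume : Measure I))).map
        fun q j => (sugg α (q.2 j) q.1).toNStrategy N := by
  rw [mixture_eq hα hρ, Measure.map_map Measurable.of_discrete]
  · rfl
  · exact measurable_pi_iff.2 fun j =>
      measurable_sugg hα ((measurable_pi_apply j).comp measurable_snd) measurable_fst

include hΨ hf hF hα hC in
/-- The expected costs of player `i` who applies a random modification, independent of everything
else, are the average of the expected costs over the modifications. -/
theorem cost_eq_integral_nCost
    (hρ : (ρ.snd.prod (volume : Measure I)).map (fun q => (sugg α q.2 q.1, q.1)) = ρ)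
    {γ' : Measure (NStrategy N T 𝒳 Γ × NStrategy N T 𝒳 Γ)} {i : Fin N}
    {Ω : Type u} [MeasurableSpace Ω] {P : Measure Ω} [IsProbabilityMeasure P]
    (R : NRealization G (Measure.pi fun _ : Fin N => m₀.toMeasure)
      ((mixture ρ N).map fun φ j => (φ j).toNStrategy N) γ' i P)
    {H : (Fin T → I) → NStrategy N T 𝒳 Γ → NStrategy N T 𝒳 Γ} (hH : Measurable H)
    (hΦ : ∀ᵐ ω ∂P, R.Φ' ω = H (fun t => R.ϑ t ω) (R.Φ ω i)) :
    R.cost = ∫ g, nCost G α m₀ ρ i g ∂(P.map fun ω => H fun t => R.ϑ t ω) := by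
  have hϑ : Measurable fun ω => H fun t => R.ϑ t ω :=
    hH.comp (measurable_pi_iff.2 fun t => R.measurable_ϑ t)
  have : IsProbabilityMeasure (P.map fun ω => H fun t => R.ϑ t ω) :=
    Measure.isProbabilityMeasure_map hϑ.aemeasurable
  have hm := measurable_playerCost hΨ hf hF i
  have e1 := measurePreserving_realization R hH
  have e2 := measurePreserving_inputs (N := N) hα m₀ (ρ := ρ)
    (P.map fun ω => H fun t => R.ϑ t ω)
  rw [← map_mixture_eq hα hρ] at e2
  calc R.cost = ∫ ω, playerCost G i (R.X 0 ω) (R.Φ ω) (H (fun t => R.ϑ t ω) (R.Φ ω i))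
        (fun t j => R.ξ t j ω) ∂P := by
        rw [cost_eq_integral_playerCost]
        refine integral_congr_ae ?_
        filter_upwards [hΦ] with ω hω
        rw [hω]
    _ = _ := integral_comp_measurePreserving e1 hm
    _ = ∫ r, coupleCost G α i r.1 r.2.1 r.2.2 ∂((P.map fun ω => H fun t => R.ϑ t ω).prod
          (ρ.snd.prod (Measure.pi fun _ : Fin N => noiseLaw T m₀))) :=
        (integral_comp_measurePreserving e2 hm).symm
    _ = _ := by
        refine integral_prod _ (Integrable.of_bound
          (hm.comp e2.measurable).aestronglyMeasurable C (ae_of_all _ fun r => hC _ _ _))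

end Realizations

/-- The mixture of the conditional laws of a correlated solution of the mean field game is an
approximate correlated equilibrium of the `N`-player game. -/
theorem exists_isCorrelatedEquilibrium_mixture {T : ℕ} {𝒳 Γ : Type u} [Fintype 𝒳] [Nonempty 𝒳]
    [MeasurableSpace 𝒳] [DiscreteMeasurableSpace 𝒳] [Finite Γ] [Nonempty Γ] [MeasurableSpace Γ]
    [DiscreteMeasurableSpace Γ] {G : GameData T 𝒳 Γ}
    (hΨ : ∀ t, Measurable fun q : (𝒳 × PM 𝒳 × Γ) × I => G.Ψ t q.1.1 q.1.2.1 q.1.2.2 q.2)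
    (hA2 : G.HasModulus) (hA3 : G.LipschitzCosts) {m₀ : PM 𝒳}
    {ρ : Measure (Restricted T 𝒳 Γ × Flow T 𝒳)} [IsProbabilityMeasure ρ]
    (hρ : IsCorrelatedMFGSolution G m₀ ρ) (hR2 : HasOneStepInformation ρ) :
    ∃ ε : ℕ → ℝ, (∀ N, 0 ≤ ε N) ∧ Tendsto ε atTop (𝓝 0) ∧
      ∀ (N : ℕ) [N.AtLeastTwo],
        IsCorrelatedEquilibrium G (Measure.pi fun _ : Fin N => m₀.toMeasure) (ε N)
          ((mixture ρ N).map fun φ j => (φ j).toNStrategy N) := by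
  obtain ⟨w, hmono, h01, hw0, hw⟩ := hA2
  obtain ⟨L, hf, hF⟩ := hA3
  obtain ⟨hopt, hcons⟩ := hρ
  obtain ⟨C, hC0, hC⟩ := exists_abs_pathCost_le hf hF m₀
  obtain ⟨α, hα, hlaw⟩ := exists_sugg_law hR2
  have hc : 0 < rateConst 𝒳 := by
    unfold rateConst
    positivity
  -- The gap is paid once for the obedient player and once for the deviator; there are `N - 1`
  -- opponents.
  refine ⟨fun N => 2 * gapBound T w (rateConst 𝒳) L C (N - 1), fun N =>
    mul_nonneg (by norm_num) (gapBound_nonneg h01 hc.le L hC0 _), ?_, fun N _ => ⟨?_, ?_⟩⟩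
  · simpa using ((tendsto_gapBound (T := T) h01 hw0 hc L C).comp
      (tendsto_sub_atTop_nat 1)).const_mul 2
  · have hs : Measurable fun (q : Flow T 𝒳 × (Fin N → I)) j =>
        (sugg α (q.2 j) q.1).toNStrategy N :=
      measurable_pi_iff.2 fun j => (Measurable.of_discrete (f := fun φ : Restricted T 𝒳 Γ =>
        φ.toNStrategy N)).comp
          (measurable_sugg hα ((measurable_pi_apply j).comp measurable_snd) measurable_fst)
    rw [map_mixture_eq hα hlaw]
    exact Measure.isProbabilityMeasure_map hs.aemeasurable
  · intro i γ' _ Ω Ω' _ _ P P' _ _ R R'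
    obtain ⟨H, hH, hΦ⟩ := exists_randomized_modification R'
    have hgap : ∀ g : NStrategy N T 𝒳 Γ → NStrategy N T 𝒳 Γ, _ := fun g =>
      abs_nCost_sub_le hΨ hf hF hα i g hmono h01 hw m₀ hC hlaw hcons
    have h1 : R.cost ≤ meanCost G α m₀ ρ + gapBound T w (rateConst 𝒳) L C (N - 1) := by
      have hR := cost_eq_integral_nCost hΨ hf hF hα m₀ hC hlaw R (H := fun _ => id)
        measurable_const (ae_follow R)
      -- Obedience is the constant random modification `id`, whose law is a point mass.
      rw [Measure.map_const, measure_univ, one_smul, integral_dirac] at hR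
      have := abs_le.1 (hgap id)
      rw [integral_limitCost_id hΨ hf hF hα i m₀] at this
      linarith [this.2]
    have h2 : meanCost G α m₀ ρ - gapBound T w (rateConst 𝒳) L C (N - 1) ≤ R'.cost := by
      have hϑ : Measurable fun ω => H fun t => R'.ϑ t ω :=
        hH.comp (measurable_pi_iff.2 fun t => R'.measurable_ϑ t)
      have : IsProbabilityMeasure (P'.map fun ω => H fun t => R'.ϑ t ω) :=
        Measure.isProbabilityMeasure_map hϑ.aemeasurable
      rw [cost_eq_integral_nCost hΨ hf hF hα m₀ hC hlaw R' hH hΦ]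
      calc meanCost G α m₀ ρ - gapBound T w (rateConst 𝒳) L C (N - 1)
          = ∫ _, (meanCost G α m₀ ρ - gapBound T w (rateConst 𝒳) L C (N - 1))
              ∂(P'.map fun ω => H fun t => R'.ϑ t ω) := by simp
        _ ≤ _ := by
          -- The bound holds for each deterministic `g`, hence for the average; integrability is
          -- free because there are finitely many `g`.
          refine integral_mono (integrable_const _) Integrable.of_finite fun g => ?_
          have h3 := abs_le.1 (hgap g)
          have h4 := meanCost_le_integral_limitCost hΨ hf hF hα i g m₀ hC hlaw hopt
          beta_reduce
          linarith [h3.1]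
    linarith

end CorrelatedMFG

theorem mainTheorem1 {T : ℕ} {𝒳 Γ : Type u}
    [Fintype 𝒳] [Nonempty 𝒳] [TopologicalSpace 𝒳] [DiscreteTopology 𝒳]
    [MeasurableSpace 𝒳] [DiscreteMeasurableSpace 𝒳]
    [Fintype Γ] [Nonempty Γ] [TopologicalSpace Γ] [DiscreteTopology Γ]
    [MeasurableSpace Γ] [DiscreteMeasurableSpace Γ]
    (G : CorrelatedMFG.GameData T 𝒳 Γ)
    (hΨ : ∀ t, Measurable fun q : (𝒳 × CorrelatedMFG.PM 𝒳 × Γ) × unitInterval =>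
      G.Ψ t q.1.1 q.1.2.1 q.1.2.2 q.2)
    (hA1 : G.NonDegenerate)
    (hA2 : G.HasModulus ∧ G.AEContinuous)
    (hA3 : G.LipschitzCosts)
    (m₀ : CorrelatedMFG.PM 𝒳)
    (ρ : Measure (CorrelatedMFG.Restricted T 𝒳 Γ × CorrelatedMFG.Flow T 𝒳))
    [IsProbabilityMeasure ρ]
    (hρ : CorrelatedMFG.IsCorrelatedMFGSolution G m₀ ρ)
    (hR1 : CorrelatedMFG.FinitelyManyFlows ρ)
    (hR2 : CorrelatedMFG.HasOneStepInformation ρ) :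
    ∃ ε : ℕ → ℝ, (∀ N, 0 ≤ ε N) ∧ Tendsto ε atTop (𝓝 0) ∧
      ∀ (N : ℕ) [N.AtLeastTwo],
        CorrelatedMFG.IsCorrelatedEquilibrium G (Measure.pi fun _ : Fin N => m₀.toMeasure) (ε N)
          ((CorrelatedMFG.mixture ρ N).map fun φ j => (φ j).toNStrategy N) := by
  exact CorrelatedMFG.exists_isCorrelatedEquilibrium_mixture hΨ hA2.1 hA3 hρ hR2
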